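/- **Setting.** There are $n$ items with scores $\alpha_1,\dots,\alpha_n>0$ of dynamic range $\max_i\alpha_i/\min_i\alpha_i\le h$. Put $p_{ij}=\alpha_j/(\alpha_i+\alpha_j)$ and let $\pi=\alpha/\sum_i\alpha_i$ be the normalized score vector. Let $\mathcal G=([n],\mathcal E,\{w_{ij}\})$ be a fixed (deterministic) undirected graph with symmetric weights $w_{ij}=w_{ji}\in[0,1]$, with $w_{ij}=0$ for $(i,j)\notin\mathcal E$. Let $d_{\max}$ and $d_{\min}$ be the maximum and the minimum of the weighted degrees $\sum_{j:(i,j)\in\mathcal E}w_{ij}$, let $$L^W=\sum_{(i,j)\in\mathcal E,\ i<j}w_{ij}(e_i-e_j)(e_i-e_j)^{\mathrm T},\qquad \lambda_{n-1}(L^W)=\min_{v\ne 0,\ v^{\mathrm T}\mathbf 1=0}\frac{v^{\mathrm T}L^Wv}{\|v\|_2^2}.$$ For each edge $(i,j)\in\mathcal E$ with $i<j$ one observes $Z_{ij}^{(1)},\dots,Z_{ij}^{(k)}\sim\mathrm{Bernoulli}(p_{ij})$, all of these variables being independent over edges and repetitions ($Z_{ij}^{(m)}=1$ means that $j$ beat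 $i$). Put $\hat p_{ij}=\frac1k\sum_{m=1}^kZ_{ij}^{(m)}$ and $\hat p_{ji}=1-\hat p_{ij}$. The weighted spectral estimator $\hat\pi$ is the stationary distribution of the stochastic matrix $\hat S$ with $\hat S_{ij}=\hat p_{ij}w_{ij}/d_{\max}$ for $(i,j)\in\mathcal E$, $\hat S_{ii}=1-\frac1{d_{\max}}\sum_{l:(i,l)\in\mathcal E}\hat p_{il}w_{il}$, and $\hat S_{ij}=0$ otherwise. **Theorem 4.1.** For every $h$ there are constants $c_1,c_2,c_3,C>0$, depending only on $h$, such that the following holds for all $n$, $k$, $\alpha$, $\mathcal G$ as above and all real $p$. Suppose that $\mathcal G$ is connected as a weighted graph (its edges of positive weight connect all vertices), that $d_{\min}\ge1$ and $d_{\max}\le 2np$, and that $$k\ \ge\ \frac{640\,h^2\,n\log(n)\,p}{\lambda_{n-1}(L^W)^2}.$$ Then, with probability at least $1-C n^{-5}$, the matrix $\hat S$ has a unique stationary distribution $\hat\pi$, and $$\frac{\|\hat\pi-\pi\|_\infty}{\|\pi\|_\infty}\le \frac{c_1}{\lambda_{n-1}(L^W)}\sqrt{\frac{n\log(n)\,p}{k}}+\frac{c_2}{\lambda_{n-1}(L^W)^2}\sqrt{\frac{n^2\log(n)\,p^2}{k}}+\frac{c_3}{\lambda_{n-1}(L^W)^3}\sqrt{\frac{n^4\log(n)\,p^3}{k}}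 .$$ -/

import Mathlib

open MeasureTheory ProbabilityTheory Matrix

noncomputable section

namespace WeightedBTL

/-- A weighted observation graph on `n` items: an undirected graph together with symmetric edge
weights in `[0, 1]` that vanish off the edges. -/
structure WeightedGraph (n : ℕ) where
  graph : SimpleGraph (Fin n)
  weight : Fin n → Fin n → ℝ
  weight_symm : ∀ i j, weight i j = weight j i
  weight_nonneg : ∀ i j, 0 ≤ weight i j
  weight_le_one : ∀ i j, weight i j ≤ 1
  weight_eq_zero : ∀ i j, ¬ graph.Adj i j → weight i j = 0

namespace WeightedGraph

variable {n : ℕ} (G : WeightedGraph n)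

/-- The graph formed by the edges of positive weight. An edge of weight zero counts as absent in
the weighted graph. -/
def support : SimpleGraph (Fin n) where
  Adj i j := G.graph.Adj i j ∧ 0 < G.weight i j
  symm := ⟨fun i j h => ⟨h.1.symm, G.weight_symm i j ▸ h.2⟩⟩
  loopless := ⟨fun i h => G.graph.loopless.irrefl i h.1⟩

/-- A weighted graph is connected if its edges of positive weight connect all vertices. -/
def Connected : Prop := G.support.Connected

open Classical in
/-- The weighted degree `∑_{j : (i, j) ∈ E} w_ij` of the item `i`. -/
def degree (i : Fin n) : ℝ := ∑ j with G.graph.Adj i j, G.weight i j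

/-- The maximum weighted degree. -/
def dMax : ℝ := ⨆ i, G.degree i

/-- The minimum weighted degree. -/
def dMin : ℝ := ⨅ i, G.degree i

open Classical in
/-- The weighted Laplacian `∑_{(i, j) ∈ E, i < j} w_ij (e_i - e_j) (e_i - e_j)ᵀ`. -/
def laplacian : Matrix (Fin n) (Fin n) ℝ :=
  ∑ e : Fin n × Fin n with e.1 < e.2 ∧ G.graph.Adj e.1 e.2,
    G.weight e.1 e.2 •
      Matrix.vecMulVec (Pi.single e.1 1 - Pi.single e.2 1) (Pi.single e.1 1 - Pi.single e.2 1)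

/-- The spectral gap of the weighted Laplacian (its second smallest eigenvalue): the minimum of
the Rayleigh quotient `vᵀ L v / ‖v‖₂²` over the nonzero vectors `v` orthogonal to the all-ones
vector. -/
def spectralGap : ℝ :=
  sInf {x : ℝ | ∃ v : Fin n → ℝ, v ≠ 0 ∧ ∑ i, v i = 0 ∧
    x = (v ⬝ᵥ (G.laplacian *ᵥ v)) / ∑ i, v i ^ 2}

open Classical in
/-- The matrix with entries `q_ij w_ij / d` on the edges, `1 - (1 / d) ∑_{l : (i, l) ∈ E} q_il w_il`
on the diagonal and zero elsewhere, where `d` is the maximum weighted degree. -/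
def markovMatrix (q : Fin n → Fin n → ℝ) : Matrix (Fin n) (Fin n) ℝ :=
  Matrix.of fun i j =>
    if G.graph.Adj i j then q i j * G.weight i j / G.dMax
    else if i = j then 1 - (1 / G.dMax) * ∑ l with G.graph.Adj i l, q i l * G.weight i l
    else 0

end WeightedGraph

/-- The Bradley-Terry-Luce probability that item `j` is preferred over item `i`. -/
def btlProb {n : ℕ} (α : Fin n → ℝ) (i j : Fin n) : ℝ := α j / (α i + α j)

/-- The dynamic range `max_i α_i / min_i α_i` of a score vector. -/
def dynamicRange {n : ℕ} (α : Fin n → ℝ) : ℝ := (⨆ i, α i) / (⨅ i, α i)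

/-- The score vector normalized to have sum one. -/
def normalizedScore {n : ℕ} (α : Fin n → ℝ) : Fin n → ℝ := fun i => α i / ∑ j, α j

/-- The comparison data `Z i j m`, for edges `(i, j)` with `i < j` and `m ∈ [k]`, are independent
Bernoulli variables with parameter `p_ij`. The value `true` means that `j` beat `i` in the `m`-th
comparison of the two items. Values of `Z i j m` at other pairs `(i, j)` are irrelevant. -/
structure IsBTLSample {n k : ℕ} {Ω : Type*} [MeasurableSpace Ω] (P : Measure Ω)
    (G : SimpleGraph (Fin n)) (α : Fin n → ℝ) (Z : Fin n → Fin n → Fin k → Ω → Bool) : Prop where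
  measurable : ∀ i j m, i < j → G.Adj i j → Measurable (Z i j m)
  prob_true : ∀ i j m, i < j → G.Adj i j →
    P {ω | Z i j m ω = true} = ENNReal.ofReal (btlProb α i j)
  indep : iIndepFun
    (fun c : {e : Fin n × Fin n // e.1 < e.2 ∧ G.Adj e.1 e.2} × Fin k =>
      Z c.1.1.1 c.1.1.2 c.2) P

/-- The empirical probability of `j` beating `i`. For `i < j` it is the fraction of the `k`
comparisons of `i` and `j` won by `j`; for `j < i` it is the complementary fraction. -/
def empiricalProb {n k : ℕ} (z : Fin n → Fin n → Fin k → Bool) (i j : Fin n) : ℝ :=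
  if i < j then (∑ m : Fin k, if z i j m = true then (1 : ℝ) else 0) / k
  else 1 - (∑ m : Fin k, if z j i m = true then (1 : ℝ) else 0) / k

/-- `μ` is a stationary distribution of the matrix `M`: a probability vector with `μᵀ M = μᵀ`. -/
def IsStationary {n : ℕ} (M : Matrix (Fin n) (Fin n) ℝ) (μ : Fin n → ℝ) : Prop :=
  (∀ i, 0 ≤ μ i) ∧ ∑ i, μ i = 1 ∧ μ ᵥ* M = μ

end WeightedBTL

end

open MeasureTheory ProbabilityTheory Matrix

noncomputable section

namespace WeightedBTL

/-! ### Finite products of Bernoulli distributions -/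

section Bernoulli

variable {ι : Type*} [Fintype ι] [DecidableEq ι]

/-- The mass of `z` under the product of the Bernoulli distributions with parameters `p c`. -/
def bernoulliMass (p : ι → ℝ) (z : ι → Bool) : ℝ := ∏ c, if z c = true then p c else 1 - p c

/-- The expectation of `F` under the product of the Bernoulli distributions. -/
def bernoulliExp (p : ι → ℝ) (F : (ι → Bool) → ℝ) : ℝ := ∑ z, bernoulliMass p z * F z

open Classical in
/-- The probability of the event `S` under the product of the Bernoulli distributions. -/
def bernoulliProb (p : ι → ℝ) (S : (ι → Bool) → Prop) : ℝ :=
  bernoulliExp p fun z => if S z then 1 else 0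

/-- The centered coordinates. -/
def centered (p : ι → ℝ) (z : ι → Bool) (c : ι) : ℝ := (if z c = true then 1 else 0) - p c

variable {p : ι → ℝ}

omit [DecidableEq ι] in
lemma bernoulliMass_nonneg (hp : ∀ c, p c ∈ Set.Icc (0 : ℝ) 1) (z : ι → Bool) :
    0 ≤ bernoulliMass p z := by
  refine Finset.prod_nonneg fun c _ => ?_
  have := hp c
  split_ifs
  · exact this.1
  · linarith [this.2]

lemma sum_bernoulliMass (p : ι → ℝ) : ∑ z, bernoulliMass p z = 1 := by
  classical
  have := (Finset.prod_univ_sum (fun _ : ι => (Finset.univ : Finset Bool))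
    (fun c b => if b = true then p c else 1 - p c)).symm
  simp only [Fintype.piFinset_univ] at this
  simpa [bernoulliMass] using this

lemma bernoulliExp_mono (hp : ∀ c, p c ∈ Set.Icc (0 : ℝ) 1) {F F' : (ι → Bool) → ℝ}
    (hF : ∀ z, F z ≤ F' z) : bernoulliExp p F ≤ bernoulliExp p F' :=
  Finset.sum_le_sum fun z _ => mul_le_mul_of_nonneg_left (hF z) (bernoulliMass_nonneg hp z)

lemma bernoulliExp_const (p : ι → ℝ) (a : ℝ) : bernoulliExp p (fun _ => a) = a := by
  rw [bernoulliExp, ← Finset.sum_mul, sum_bernoulliMass, one_mul]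

lemma bernoulliExp_const_mul (a : ℝ) (F : (ι → Bool) → ℝ) :
    bernoulliExp p (fun z => a * F z) = a * bernoulliExp p F := by
  simp only [bernoulliExp, Finset.mul_sum]
  exact Finset.sum_congr rfl fun z _ => by ring

lemma bernoulliExp_sum {κ : Type*} (s : Finset κ) (F : κ → (ι → Bool) → ℝ) :
    bernoulliExp p (fun z => ∑ i ∈ s, F i z) = ∑ i ∈ s, bernoulliExp p (F i) := by
  simp only [bernoulliExp, Finset.mul_sum]
  exact Finset.sum_comm

/-- Resampling one coordinate does not change expectations. -/
lemma bernoulliExp_resample (p : ι → ℝ) (c : ι) (F : (ι → Bool) → ℝ) :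
    bernoulliExp p F = bernoulliExp p fun z =>
      p c * F (Function.update z c true) + (1 - p c) * F (Function.update z c false) := by
  have key : ∀ G : (ι → Bool) → ℝ, bernoulliExp p G =
      ∑ x : {j // j ≠ c} → Bool, (∏ j, if x j = true then p j else 1 - p j) *
        (p c * G ((Equiv.funSplitAt c Bool).symm (true, x)) +
          (1 - p c) * G ((Equiv.funSplitAt c Bool).symm (false, x))) := by
    intro G
    have hm : ∀ y : Bool × ({j // j ≠ c} → Bool),
        bernoulliMass p ((Equiv.funSplitAt c Bool).symm y) =
          (if y.1 = true then p c else 1 - p c) *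
            ∏ j, if y.2 j = true then p j else 1 - p j := by
      intro y
      rw [bernoulliMass, Fintype.prod_eq_mul_prod_subtype_ne _ c]
      congr 1
      · simp [Equiv.funSplitAt, Equiv.piSplitAt]
      · refine Finset.prod_congr rfl fun j _ => ?_
        simp [Equiv.funSplitAt, Equiv.piSplitAt, j.2]
    rw [bernoulliExp, ← (Equiv.funSplitAt c Bool).symm.sum_comp, Fintype.sum_prod_type_right]
    refine Finset.sum_congr rfl fun x _ => ?_
    simp only [hm, Fintype.sum_bool]
    simp only [if_true, Bool.false_eq_true, if_false]
    ring
  have hu : ∀ (b b' : Bool) (x : {j // j ≠ c} → Bool),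
      Function.update ((Equiv.funSplitAt c Bool).symm (b, x)) c b' =
        (Equiv.funSplitAt c Bool).symm (b', x) := by
    intro b b' x
    ext j
    by_cases hj : j = c
    · subst hj; simp [Equiv.funSplitAt, Equiv.piSplitAt]
    · simp [Equiv.funSplitAt, Equiv.piSplitAt, hj]
  rw [key, key]
  simp only [hu]
  refine Finset.sum_congr rfl fun x _ => ?_
  ring

lemma bernoulliExp_centered_mul (p : ι → ℝ) (c : ι) (F : (ι → Bool) → ℝ) :
    bernoulliExp p (fun z => centered p z c * F z) =
      bernoulliExp p fun z =>
        p c * (1 - p c) * (F (Function.update z c true) - F (Function.update z c false)) := by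
  rw [bernoulliExp_resample p c]
  congr 1
  ext z
  simp [centered]
  ring

lemma bernoulliProb_mono (hp : ∀ c, p c ∈ Set.Icc (0 : ℝ) 1) {S T : (ι → Bool) → Prop}
    (h : ∀ z, S z → T z) : bernoulliProb p S ≤ bernoulliProb p T := by
  refine bernoulliExp_mono hp fun z => ?_
  by_cases hS : S z
  · simp [hS, h z hS]
  · simp only [hS, if_false]; positivity

lemma bernoulliProb_or_le (hp : ∀ c, p c ∈ Set.Icc (0 : ℝ) 1) (S T : (ι → Bool) → Prop) :
    bernoulliProb p (fun z => S z ∨ T z) ≤ bernoulliProb p S + bernoulliProb p T := by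
  rw [bernoulliProb, bernoulliProb, bernoulliProb, bernoulliExp, bernoulliExp, bernoulliExp,
    ← Finset.sum_add_distrib]
  refine Finset.sum_le_sum fun z _ => ?_
  rw [← mul_add]
  refine mul_le_mul_of_nonneg_left ?_ (bernoulliMass_nonneg hp z)
  by_cases hS : S z <;> by_cases hT : T z <;> simp [hS, hT]

lemma bernoulliProb_exists_le (hp : ∀ c, p c ∈ Set.Icc (0 : ℝ) 1) {κ : Type*} (s : Finset κ)
    (S : κ → (ι → Bool) → Prop) :
    bernoulliProb p (fun z => ∃ i ∈ s, S i z) ≤ ∑ i ∈ s, bernoulliProb p (S i) := by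
  classical
  simp only [bernoulliProb]
  rw [← bernoulliExp_sum]
  refine bernoulliExp_mono hp fun z => ?_
  have h0 : ∀ i ∈ s, (0 : ℝ) ≤ if S i z then 1 else 0 := fun i _ => by positivity
  split_ifs with h
  · obtain ⟨i, hi, hS⟩ := h
    refine le_trans ?_ (Finset.single_le_sum h0 hi)
    simp [hS]
  · exact Finset.sum_nonneg h0

lemma bernoulliProb_compl (p : ι → ℝ) (S : (ι → Bool) → Prop) :
    bernoulliProb p S = 1 - bernoulliProb p (fun z => ¬ S z) := by
  rw [eq_sub_iff_add_eq, ← bernoulliExp_const p 1]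
  simp only [bernoulliProb, bernoulliExp]
  rw [← Finset.sum_add_distrib]
  refine Finset.sum_congr rfl fun z _ => ?_
  by_cases hS : S z <;> simp [hS]

/-- Markov's inequality. -/
lemma bernoulliProb_le_of_le (hp : ∀ c, p c ∈ Set.Icc (0 : ℝ) 1) {S : (ι → Bool) → Prop}
    {F : (ι → Bool) → ℝ} {a : ℝ} (ha : 0 < a) (hF : ∀ z, 0 ≤ F z) (hS : ∀ z, S z → a ≤ F z) :
    bernoulliProb p S ≤ bernoulliExp p F / a := by
  rw [div_eq_inv_mul, ← bernoulliExp_const_mul]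
  refine bernoulliExp_mono hp fun z => ?_
  split_ifs with h
  · rw [← div_eq_inv_mul, le_div_iff₀ ha, one_mul]; exact hS z h
  · exact mul_nonneg (inv_nonneg.2 ha.le) (hF z)

/-- **Hoeffding's lemma** for a Bernoulli variable. -/
lemma bernoulli_mgf_le {p : ℝ} (hp : p ∈ Set.Icc (0 : ℝ) 1) (a : ℝ) :
    p * Real.exp ((1 - p) * a) + (1 - p) * Real.exp (-p * a) ≤ Real.exp (a ^ 2 / 8) := by
  let q : unitInterval := ⟨p, hp⟩
  have h := (hasSubgaussianMGF_of_mem_Icc (μ := bernoulliMeasure (1 : ℝ) 0 q) (X := id) (a := 0)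
    (b := 1) aemeasurable_id (by
      rw [ae_iff]
      simp [bernoulliMeasure])).mgf_le a
  simp only [mgf, integral_bernoulliMeasure] at h
  simp [q] at h
  convert h using 1
  · ring_nf
  · ring_nf

lemma bernoulliExp_exp_block_le (hp : ∀ c, p c ∈ Set.Icc (0 : ℝ) 1) (S : Finset ι)
    (a : (ι → Bool) → ι → ℝ) (ha : ∀ c ∈ S, ∀ z b, a (Function.update z c b) = a z) :
    bernoulliExp p (fun z => Real.exp (∑ c ∈ S, (centered p z c * a z c - a z c ^ 2 / 8))) ≤ 1 := by
  induction S using Finset.induction_on with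
  | empty => simp [bernoulliExp_const]
  | insert c S hc ih =>
    refine le_trans ?_ (ih fun c hc => ha c (Finset.mem_insert_of_mem hc))
    rw [bernoulliExp_resample p c]
    refine bernoulliExp_mono hp fun z => ?_
    have hac := ha c (Finset.mem_insert_self c S) z
    have hS : ∀ b, ∑ c' ∈ S, (centered p (Function.update z c b) c' * a z c' - a z c' ^ 2 / 8) =
        ∑ c' ∈ S, (centered p z c' * a z c' - a z c' ^ 2 / 8) := fun b =>
      Finset.sum_congr rfl fun c' hc' => by
        have : c' ≠ c := fun h => hc (h ▸ hc')
        simp [centered, this]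
    simp only [Finset.sum_insert hc, hac, hS, Real.exp_add]
    have h1 : centered p (Function.update z c true) c = 1 - p c := by simp [centered]
    have h0 : centered p (Function.update z c false) c = - p c := by simp [centered]
    rw [h1, h0, Real.exp_sub, Real.exp_sub]
    have hm := bernoulli_mgf_le (hp c) (a z c)
    have hE := Real.exp_pos (a z c ^ 2 / 8)
    have hR := Real.exp_pos (∑ c' ∈ S, (centered p z c' * a z c' - a z c' ^ 2 / 8))
    calc _ = (p c * Real.exp ((1 - p c) * a z c) + (1 - p c) * Real.exp (-p c * a z c)) /
          Real.exp (a z c ^ 2 / 8) *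
            Real.exp (∑ c' ∈ S, (centered p z c' * a z c' - a z c' ^ 2 / 8)) := by ring
      _ ≤ 1 * Real.exp (∑ c' ∈ S, (centered p z c' * a z c' - a z c' ^ 2 / 8)) :=
        mul_le_mul_of_nonneg_right ((div_le_one hE).2 hm) hR.le
      _ = _ := one_mul _

lemma bernoulliProb_sum_gt_le (hp : ∀ c, p c ∈ Set.Icc (0 : ℝ) 1) (S : Finset ι)
    (a : (ι → Bool) → ι → ℝ) (ha : ∀ c ∈ S, ∀ z b, a (Function.update z c b) = a z)
    {x : ℝ} (hx : 0 ≤ x) :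
    bernoulliProb p (fun z => x * √(∑ c ∈ S, a z c ^ 2) < ∑ c ∈ S, centered p z c * a z c) ≤
      Real.exp (-(2 * x ^ 2)) := by
  set a' : (ι → Bool) → ι → ℝ := fun z c => 4 * x / √(∑ c ∈ S, a z c ^ 2) * a z c with ha'
  have h := bernoulliExp_exp_block_le hp S a' fun c hc z b => by
    simp only [ha', ha c hc z b]
  refine (bernoulliProb_le_of_le hp (Real.exp_pos (2 * x ^ 2)) (fun z => (Real.exp_pos _).le)
    fun z hz => ?_).trans ((div_le_div_of_nonneg_right h (Real.exp_pos _).le).trans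
      (by rw [Real.exp_neg, one_div]))
  rw [Real.exp_le_exp]
  set T := ∑ c ∈ S, a z c ^ 2 with hT
  have hT0 : 0 ≤ T := Finset.sum_nonneg fun c _ => sq_nonneg _
  have hTpos : 0 < T := by
    refine lt_of_le_of_ne hT0 fun h0 => ?_
    rw [← h0, Real.sqrt_zero, mul_zero] at hz
    have hz0 := (Finset.sum_eq_zero_iff_of_nonneg fun c _ => sq_nonneg (a z c)).1 h0.symm
    rw [Finset.sum_eq_zero fun c hc => by rw [pow_eq_zero_iff two_ne_zero |>.1 (hz0 c hc), mul_zero]]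
      at hz
    exact lt_irrefl _ hz
  have hsq : 0 < √T := Real.sqrt_pos.2 hTpos
  have e1 : ∑ c ∈ S, (centered p z c * a' z c - a' z c ^ 2 / 8) =
      4 * x * ((∑ c ∈ S, centered p z c * a z c) / √T) - 2 * x ^ 2 := by
    have : ∀ c ∈ S, centered p z c * a' z c - a' z c ^ 2 / 8 =
        4 * x / √T * (centered p z c * a z c) - 2 * x ^ 2 / T * a z c ^ 2 := by
      intro c _
      simp only [ha']
      rw [mul_pow, div_pow, Real.sq_sqrt hT0]
      ring
    rw [Finset.sum_congr rfl this, Finset.sum_sub_distrib, ← Finset.mul_sum, ← Finset.mul_sum,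
      ← hT]
    field_simp
  rw [e1]
  have h2 : x ≤ (∑ c ∈ S, centered p z c * a z c) / √T := (le_div_iff₀ hsq).2 hz.le
  nlinarith

/-- **Hoeffding's inequality**, where the coefficients may depend on coordinates outside the
block of coordinates that are summed. -/
lemma bernoulliProb_abs_sum_gt_le (hp : ∀ c, p c ∈ Set.Icc (0 : ℝ) 1) (S : Finset ι)
    (a : (ι → Bool) → ι → ℝ) (ha : ∀ c ∈ S, ∀ z b, a (Function.update z c b) = a z)
    {x : ℝ} (hx : 0 ≤ x) (M : (ι → Bool) → ℝ) (hM : ∀ z, x * √(∑ c ∈ S, a z c ^ 2) ≤ M z) :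
    bernoulliProb p (fun z => M z < |∑ c ∈ S, centered p z c * a z c|) ≤
      2 * Real.exp (-(2 * x ^ 2)) := by
  have h1 := bernoulliProb_sum_gt_le hp S a ha hx
  have h2 := bernoulliProb_sum_gt_le hp S (fun z => -a z) (fun c hc z b => by rw [ha c hc z b]) hx
  rw [two_mul]
  refine le_trans ?_ ((bernoulliProb_or_le hp _ _).trans (add_le_add h1 h2))
  refine bernoulliProb_mono hp fun z hz => ?_
  rcases lt_abs.1 ((hM z).trans_lt hz) with h | h
  · exact Or.inl h
  · right
    simpa using h

end Bernoulli

/-! ### Moments of random symmetric matrices -/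

section MatrixMoment

variable {m : Type*} [Fintype m] [DecidableEq m]

/-- A symmetric matrix in an orthonormal eigenbasis. -/
lemma exists_orthogonal_diagonal {X : Matrix m m ℝ} (hX : Xᵀ = X) :
    ∃ (U : Matrix m m ℝ) (x : m → ℝ), Uᵀ * U = 1 ∧ U * Uᵀ = 1 ∧
      ∀ k, X ^ k = U * diagonal (fun i => x i ^ k) * Uᵀ := by
  have hH : X.IsHermitian := by
    rw [IsHermitian, conjTranspose_eq_transpose_of_trivial, hX]
  let U : Matrix m m ℝ := hH.eigenvectorUnitary
  have hstar : star U = Uᵀ := by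
    rw [star_eq_conjTranspose, conjTranspose_eq_transpose_of_trivial]
  have h1 : Uᵀ * U = 1 := by
    rw [← hstar]; exact Unitary.coe_star_mul_self hH.eigenvectorUnitary
  have h2 : U * Uᵀ = 1 := by
    rw [← hstar]; exact Unitary.coe_mul_star_self hH.eigenvectorUnitary
  obtain ⟨x, hs⟩ : ∃ x, X = U * diagonal x * Uᵀ := by
    refine ⟨hH.eigenvalues, ?_⟩
    conv_lhs => rw [hH.spectral_theorem, Unitary.conjStarAlgAut_apply]
    rw [← hstar]
    rfl
  refine ⟨U, x, h1, h2, fun k => ?_⟩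
  induction k with
  | zero => simp [h2]
  | succ k ih =>
    have : U * diagonal (fun i => x i ^ k) * Uᵀ * (U * diagonal x * Uᵀ) =
        U * (diagonal (fun i => x i ^ k) * (Uᵀ * U) * diagonal x) * Uᵀ := by
      simp only [Matrix.mul_assoc]
    rw [pow_succ, ih, hs, this, h1, Matrix.mul_one, diagonal_mul_diagonal]
    simp only [pow_succ]

lemma sum_pow_mul_pow_le (x y : ℝ) {N : ℕ} (hN : Even N) :
    ∑ a ∈ Finset.range (N + 1), x ^ a * y ^ (N - a) ≤ (N + 1) / 2 * (x ^ N + y ^ N) := by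
  have hrefl : ∑ a ∈ Finset.range (N + 1), x ^ a * y ^ (N - a) =
      ∑ a ∈ Finset.range (N + 1), x ^ (N - a) * y ^ a := by
    rw [← Finset.sum_range_reflect]
    refine Finset.sum_congr rfl fun a ha => ?_
    have : a ≤ N := by simpa [Nat.lt_succ_iff] using ha
    congr 2
    omega
  have hterm : ∀ a ∈ Finset.range (N + 1),
      x ^ a * y ^ (N - a) + x ^ (N - a) * y ^ a ≤ x ^ N + y ^ N := by
    intro a ha
    have ha' : a ≤ N := by simpa [Nat.lt_succ_iff] using ha
    have key : ∀ s t : ℝ, 0 ≤ s → 0 ≤ t →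
        s ^ a * t ^ (N - a) + s ^ (N - a) * t ^ a ≤ s ^ N + t ^ N := by
      intro s t hs ht
      have e : ∀ r : ℝ, r ^ N = r ^ a * r ^ (N - a) := fun r => by rw [← pow_add]; congr 1; omega
      rw [e s, e t]
      rcases le_total s t with h | h
      · nlinarith [mul_nonneg (sub_nonneg.2 (pow_le_pow_left₀ hs h a))
          (sub_nonneg.2 (pow_le_pow_left₀ hs h (N - a)))]
      · nlinarith [mul_nonneg (sub_nonneg.2 (pow_le_pow_left₀ ht h a))
          (sub_nonneg.2 (pow_le_pow_left₀ ht h (N - a)))]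
    have := key |x| |y| (abs_nonneg _) (abs_nonneg _)
    rw [hN.pow_abs, hN.pow_abs] at this
    refine le_trans (add_le_add ?_ ?_) this <;>
    · rw [← abs_pow, ← abs_pow, ← abs_mul]; exact le_abs_self _
  have := Finset.sum_le_sum hterm
  rw [Finset.sum_add_distrib, ← hrefl, Finset.sum_const, Finset.card_range, nsmul_eq_mul] at this
  push_cast at this
  linarith

lemma trace_sq_mul_pow_eq_sum {A X U : Matrix m m ℝ} {x : m → ℝ} (hA : Aᵀ = A) {N : ℕ}
    (hX : X ^ N = U * diagonal (fun i => x i ^ N) * Uᵀ) {V : Matrix m m ℝ} (hV : V * Vᵀ = 1) :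
    (A ^ 2 * X ^ N).trace = ∑ i, ∑ j, (Uᵀ * A * V) i j ^ 2 * x i ^ N := by
  have : (A ^ 2 * X ^ N).trace =
      (diagonal (fun i => x i ^ N) * ((Uᵀ * A * V) * (Uᵀ * A * V)ᵀ)).trace := by
    rw [hX, Matrix.trace_mul_comm, pow_two]
    simp only [transpose_mul, transpose_transpose, hA]
    rw [show Uᵀ * A * V * (Vᵀ * (A * U)) = Uᵀ * A * (V * Vᵀ) * A * U by
      simp only [Matrix.mul_assoc], hV, Matrix.mul_one, Matrix.mul_assoc, Matrix.mul_assoc,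
      Matrix.trace_mul_comm]
    simp only [Matrix.mul_assoc]
  rw [this, trace]
  refine Finset.sum_congr rfl fun i _ => ?_
  rw [diag_apply, diagonal_mul, Matrix.mul_apply, Finset.mul_sum]
  refine Finset.sum_congr rfl fun j _ => ?_
  rw [transpose_apply]; ring

lemma trace_sq_mul_pow_nonneg {A X : Matrix m m ℝ} (hA : Aᵀ = A) (hX : Xᵀ = X) {N : ℕ}
    (hN : Even N) : 0 ≤ (A ^ 2 * X ^ N).trace := by
  obtain ⟨U, x, -, hU, h⟩ := exists_orthogonal_diagonal hX
  rw [trace_sq_mul_pow_eq_sum hA (h N) hU]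
  exact Finset.sum_nonneg fun i _ => Finset.sum_nonneg fun j _ =>
    mul_nonneg (sq_nonneg _) (hN.pow_nonneg _)

lemma pow_diag_nonneg {X : Matrix m m ℝ} (hX : Xᵀ = X) {N : ℕ} (hN : Even N) (i : m) :
    0 ≤ (X ^ N) i i := by
  obtain ⟨r, rfl⟩ := hN
  rw [pow_add, Matrix.mul_apply]
  refine Finset.sum_nonneg fun j _ => ?_
  have : (X ^ r) j i = (X ^ r) i j := by
    conv_lhs => rw [← hX, ← transpose_pow, transpose_apply]
  rw [this]
  exact mul_self_nonneg _

lemma trace_mul_pow_mul_mul_pow_le {A X Y : Matrix m m ℝ} (hA : Aᵀ = A) (hX : Xᵀ = X)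
    (hY : Yᵀ = Y) {N : ℕ} (hN : Even N) :
    ∑ a ∈ Finset.range (N + 1), (A * X ^ a * A * Y ^ (N - a)).trace ≤
      (N + 1) / 2 * ((A ^ 2 * X ^ N).trace + (A ^ 2 * Y ^ N).trace) := by
  obtain ⟨U, x, -, hU, hx⟩ := exists_orthogonal_diagonal hX
  obtain ⟨V, y, -, hV, hy⟩ := exists_orthogonal_diagonal hY
  have hterm : ∀ a b, (A * X ^ a * A * Y ^ b).trace =
      ∑ i, ∑ j, (Uᵀ * A * V) i j ^ 2 * (x i ^ a * y j ^ b) := by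
    intro a b
    have : (A * X ^ a * A * Y ^ b).trace =
        (diagonal (fun i => x i ^ a) * (Uᵀ * A * V) *
          (diagonal (fun i => y i ^ b) * (Uᵀ * A * V)ᵀ)).trace := by
      rw [hx, hy]
      simp only [transpose_mul, transpose_transpose, hA]
      rw [show A * (U * diagonal (fun i => x i ^ a) * Uᵀ) * A *
        (V * diagonal (fun i => y i ^ b) * Vᵀ) =
        (A * U) * (diagonal (fun i => x i ^ a) * Uᵀ * A * V * diagonal (fun i => y i ^ b) * Vᵀ) by
        simp only [Matrix.mul_assoc], Matrix.trace_mul_comm]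
      simp only [Matrix.mul_assoc]
    rw [this, trace]
    refine Finset.sum_congr rfl fun i _ => ?_
    rw [diag_apply, Matrix.mul_apply]
    refine Finset.sum_congr rfl fun j _ => ?_
    rw [diagonal_mul, diagonal_mul, transpose_apply]; ring
  have hY2 : (A ^ 2 * Y ^ N).trace = ∑ i, ∑ j, (Uᵀ * A * V) i j ^ 2 * y j ^ N := by
    rw [trace_sq_mul_pow_eq_sum hA (hy N) hU, Finset.sum_comm]
    refine Finset.sum_congr rfl fun i _ => Finset.sum_congr rfl fun j _ => ?_
    have : Vᵀ * A * U = (Uᵀ * A * V)ᵀ := by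
      simp only [transpose_mul, transpose_transpose, hA, Matrix.mul_assoc]
    rw [this, transpose_apply]
  rw [trace_sq_mul_pow_eq_sum hA (hx N) hV, hY2]
  simp only [hterm]
  rw [Finset.sum_comm, ← Finset.sum_add_distrib, Finset.mul_sum]
  refine Finset.sum_le_sum fun i _ => ?_
  rw [Finset.sum_comm, ← Finset.sum_add_distrib, Finset.mul_sum]
  refine Finset.sum_le_sum fun j _ => ?_
  rw [← Finset.mul_sum]
  calc _ ≤ (Uᵀ * A * V) i j ^ 2 * ((N + 1) / 2 * (x i ^ N + y j ^ N)) :=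
        mul_le_mul_of_nonneg_left (sum_pow_mul_pow_le _ _ hN) (sq_nonneg _)
    _ = _ := by ring

lemma pow_succ_sub_pow_succ (X Y : Matrix m m ℝ) (N : ℕ) :
    X ^ (N + 1) - Y ^ (N + 1) =
      ∑ a ∈ Finset.range (N + 1), X ^ a * (X - Y) * Y ^ (N - a) := by
  induction N with
  | zero => simp
  | succ N ih =>
    rw [Finset.sum_range_succ, Nat.sub_self, pow_zero, Matrix.mul_one]
    have : ∑ a ∈ Finset.range (N + 1), X ^ a * (X - Y) * Y ^ (N + 1 - a) =
        (X ^ (N + 1) - Y ^ (N + 1)) * Y := by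
      rw [ih, Finset.sum_mul]
      refine Finset.sum_congr rfl fun a ha => ?_
      have ha' : a ≤ N := by simpa [Nat.lt_succ_iff] using ha
      rw [Nat.sub_add_comm ha', pow_succ, Matrix.mul_assoc (X ^ a * (X - Y))]
    rw [this, pow_succ X, pow_succ Y (N + 1)]
    noncomm_ring

variable {ι : Type*} [Fintype ι] [DecidableEq ι] {p : ι → ℝ}

/-- The sum of symmetric matrices with independent centered Bernoulli coefficients. -/
def bernoulliMatrix (p : ι → ℝ) (A : ι → Matrix m m ℝ) (z : ι → Bool) : Matrix m m ℝ :=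
  ∑ c, centered p z c • A c

omit [Fintype m] [DecidableEq m] [DecidableEq ι] in
lemma bernoulliMatrix_transpose {A : ι → Matrix m m ℝ} (hA : ∀ c, (A c)ᵀ = A c)
    (z : ι → Bool) : (bernoulliMatrix p A z)ᵀ = bernoulliMatrix p A z := by
  simp only [bernoulliMatrix, transpose_sum, transpose_smul, hA]

omit [Fintype m] [DecidableEq m] in
lemma bernoulliMatrix_update_sub (p : ι → ℝ) (A : ι → Matrix m m ℝ) (z : ι → Bool) (c : ι) :
    bernoulliMatrix p A (Function.update z c true) -
      bernoulliMatrix p A (Function.update z c false) = A c := by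
  rw [bernoulliMatrix, bernoulliMatrix, ← Finset.sum_sub_distrib,
    Finset.sum_eq_single c (fun c' _ h => by simp [centered, h]) (by simp)]
  rw [← sub_smul]
  simp [centered]

/-- The recursion of the even trace moments. -/
lemma bernoulliExp_trace_pow_succ_le (hp : ∀ c, p c ∈ Set.Icc (0 : ℝ) 1)
    {A : ι → Matrix m m ℝ} (hA : ∀ c, (A c)ᵀ = A c) {d : m → ℝ} {σ : ℝ}
    (hd : ∑ c, A c ^ 2 = diagonal d) (hσ : ∀ i, d i ≤ σ) (q : ℕ) :
    bernoulliExp p (fun z => (bernoulliMatrix p A z ^ (2 * (q + 1))).trace) ≤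
      (2 * q + 1) / 2 * σ * bernoulliExp p (fun z => (bernoulliMatrix p A z ^ (2 * q)).trace) := by
  set X := bernoulliMatrix p A with hXdef
  have hX : ∀ z, (X z)ᵀ = X z := bernoulliMatrix_transpose hA
  have hev : Even (2 * q) := even_two_mul q
  have e1 : ∀ z, (X z ^ (2 * (q + 1))).trace =
      ∑ c, centered p z c * (A c * X z ^ (2 * q + 1)).trace := by
    intro z
    rw [show 2 * (q + 1) = (2 * q + 1) + 1 by ring, pow_succ']
    conv_lhs => enter [1, 1]; rw [hXdef, bernoulliMatrix]
    rw [Finset.sum_mul, trace_sum]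
    refine Finset.sum_congr rfl fun c _ => ?_
    rw [smul_mul_assoc, trace_smul, smul_eq_mul]
  have e2 : ∀ c, bernoulliExp p (fun z => centered p z c * (A c * X z ^ (2 * q + 1)).trace) ≤
      (2 * q + 1) / 2 * bernoulliExp p (fun z => (A c ^ 2 * X z ^ (2 * q)).trace) := by
    intro c
    rw [bernoulliExp_centered_mul, ← bernoulliExp_const_mul,
      bernoulliExp_resample p c (fun z => (2 * q + 1) / 2 * (A c ^ 2 * X z ^ (2 * q)).trace)]
    refine bernoulliExp_mono hp fun z => ?_
    set X₁ := X (Function.update z c true)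
    set X₀ := X (Function.update z c false)
    have hsub : X₁ - X₀ = A c := bernoulliMatrix_update_sub p A z c
    have hdiff : (A c * X₁ ^ (2 * q + 1)).trace - (A c * X₀ ^ (2 * q + 1)).trace =
        ∑ a ∈ Finset.range (2 * q + 1), (A c * X₁ ^ a * A c * X₀ ^ (2 * q - a)).trace := by
      rw [← trace_sub, ← Matrix.mul_sub, pow_succ_sub_pow_succ, hsub, Matrix.mul_sum, trace_sum]
      simp only [Matrix.mul_assoc]
    have hle := trace_mul_pow_mul_mul_pow_le (hA c) (hX (Function.update z c true))
      (hX (Function.update z c false)) hev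
    rw [hdiff]
    have t1 := trace_sq_mul_pow_nonneg (hA c) (hX (Function.update z c true)) hev
    have t0 := trace_sq_mul_pow_nonneg (hA c) (hX (Function.update z c false)) hev
    have hpc := hp c
    have hpq : 0 ≤ p c * (1 - p c) := mul_nonneg hpc.1 (by linarith [hpc.2])
    refine (mul_le_mul_of_nonneg_left hle hpq).trans ?_
    push_cast
    have hq : (0 : ℝ) ≤ (2 * q + 1) / 2 := by positivity
    nlinarith [mul_nonneg hq (mul_nonneg (sq_nonneg (p c)) t1),
      mul_nonneg hq (mul_nonneg (sq_nonneg (1 - p c)) t0)]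
  calc _ = ∑ c, bernoulliExp p (fun z => centered p z c * (A c * X z ^ (2 * q + 1)).trace) := by
        simp only [e1]; exact bernoulliExp_sum _ _
    _ ≤ ∑ c, (2 * q + 1) / 2 * bernoulliExp p (fun z => (A c ^ 2 * X z ^ (2 * q)).trace) :=
        Finset.sum_le_sum fun c _ => e2 c
    _ = (2 * q + 1) / 2 * bernoulliExp p (fun z => (diagonal d * X z ^ (2 * q)).trace) := by
        rw [← Finset.mul_sum, ← bernoulliExp_sum]
        simp only [← trace_sum, ← Finset.sum_mul, hd]
    _ ≤ (2 * q + 1) / 2 * bernoulliExp p (fun z => σ * (X z ^ (2 * q)).trace) := by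
        refine mul_le_mul_of_nonneg_left (bernoulliExp_mono hp fun z => ?_) (by positivity)
        rw [trace, trace, Finset.mul_sum]
        refine Finset.sum_le_sum fun i _ => ?_
        rw [diag_apply, diag_apply, diagonal_mul]
        exact mul_le_mul_of_nonneg_right (hσ i) (pow_diag_nonneg (hX z) hev i)
    _ = _ := by rw [bernoulliExp_const_mul]; ring

lemma bernoulliExp_trace_pow_le (hp : ∀ c, p c ∈ Set.Icc (0 : ℝ) 1)
    {A : ι → Matrix m m ℝ} (hA : ∀ c, (A c)ᵀ = A c) {d : m → ℝ} {σ : ℝ} (hσ0 : 0 ≤ σ)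
    (hd : ∑ c, A c ^ 2 = diagonal d) (hσ : ∀ i, d i ≤ σ) {q r : ℕ} (hr : r ≤ q) :
    bernoulliExp p (fun z => (bernoulliMatrix p A z ^ (2 * r)).trace) ≤
      Fintype.card m * (q * σ) ^ r := by
  induction r with
  | zero => simp [bernoulliExp_const]
  | succ r ih =>
    refine (bernoulliExp_trace_pow_succ_le hp hA hd hσ r).trans ?_
    have hrq : ((r : ℝ) + 1) ≤ q := by exact_mod_cast hr
    calc _ ≤ (2 * r + 1) / 2 * σ * (Fintype.card m * (q * σ) ^ r) :=
          mul_le_mul_of_nonneg_left (ih (by omega)) (by positivity)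
      _ ≤ (q * σ) * (Fintype.card m * (q * σ) ^ r) := by
          refine mul_le_mul_of_nonneg_right (mul_le_mul_of_nonneg_right ?_ hσ0) (by positivity)
          linarith
      _ = _ := by ring

/-- The trace of an even power controls the norm of a symmetric matrix. -/
lemma mulVec_dotProduct_self_le {X : Matrix m m ℝ} (hX : Xᵀ = X) {q : ℕ} (hq : q ≠ 0) {t : ℝ}
    (h : (X ^ (2 * q)).trace ≤ t ^ (2 * q)) (v : m → ℝ) :
    (X *ᵥ v) ⬝ᵥ (X *ᵥ v) ≤ t ^ 2 * (v ⬝ᵥ v) := by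
  obtain ⟨U, x, hU', hU, hx⟩ := exists_orthogonal_diagonal hX
  have htr : (X ^ (2 * q)).trace = ∑ i, x i ^ (2 * q) := by
    rw [hx, Matrix.trace_mul_comm, ← Matrix.mul_assoc, hU', Matrix.one_mul, trace_diagonal]
  have hxi : ∀ i, x i ^ 2 ≤ t ^ 2 := by
    intro i
    have h1 : x i ^ (2 * q) ≤ t ^ (2 * q) := by
      refine le_trans ?_ (htr ▸ h)
      exact Finset.single_le_sum (f := fun i => x i ^ (2 * q))
        (fun j _ => (even_two_mul q).pow_nonneg _) (Finset.mem_univ i)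
    rw [pow_mul, pow_mul] at h1
    exact (pow_le_pow_iff_left₀ (sq_nonneg _) (sq_nonneg _) hq).1 h1
  have hv : v ⬝ᵥ v = (Uᵀ *ᵥ v) ⬝ᵥ (Uᵀ *ᵥ v) := by
    rw [dotProduct_mulVec, vecMul_transpose, mulVec_mulVec, hU, one_mulVec]
  have hXv : (X *ᵥ v) ⬝ᵥ (X *ᵥ v) = ∑ i, x i ^ 2 * (Uᵀ *ᵥ v) i ^ 2 := by
    have : (X *ᵥ v) ⬝ᵥ (X *ᵥ v) = v ⬝ᵥ (X ^ 2 *ᵥ v) := by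
      rw [dotProduct_mulVec, ← mulVec_transpose, hX, mulVec_mulVec, ← pow_two, dotProduct_comm]
    rw [this, hx, ← mulVec_mulVec, ← mulVec_mulVec, dotProduct_mulVec, ← mulVec_transpose,
      dotProduct]
    refine Finset.sum_congr rfl fun i _ => ?_
    rw [mulVec_diagonal]; ring
  rw [hXv, hv, dotProduct, Finset.mul_sum]
  refine Finset.sum_le_sum fun i _ => ?_
  rw [← pow_two]
  exact mul_le_mul_of_nonneg_right (hxi i) (sq_nonneg _)

end MatrixMoment

/-! ### The Euclidean norm of a vector -/

section EuclideanNorm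

variable {V : Type*} [Fintype V]

/-- The Euclidean norm on `V → ℝ`. -/
def l2norm (u : V → ℝ) : ℝ := ‖WithLp.toLp 2 u‖

lemma l2norm_nonneg (u : V → ℝ) : 0 ≤ l2norm u := norm_nonneg _

lemma l2norm_sq (u : V → ℝ) : l2norm u ^ 2 = ∑ i, u i ^ 2 := by
  rw [l2norm, EuclideanSpace.norm_sq_eq]
  simp

lemma l2norm_sq_eq_dotProduct (u : V → ℝ) : l2norm u ^ 2 = u ⬝ᵥ u := by
  rw [l2norm_sq, dotProduct]
  exact Finset.sum_congr rfl fun i _ => pow_two _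

lemma l2norm_add_le (u v : V → ℝ) : l2norm (u + v) ≤ l2norm u + l2norm v := norm_add_le _ _

lemma l2norm_smul (a : ℝ) (u : V → ℝ) : l2norm (a • u) = |a| * l2norm u := by
  rw [l2norm, WithLp.toLp_smul, norm_smul, Real.norm_eq_abs, l2norm]

lemma l2norm_zero : l2norm (0 : V → ℝ) = 0 := by simp [l2norm]

lemma eq_zero_of_l2norm_eq_zero {u : V → ℝ} (h : l2norm u = 0) : u = 0 := by
  have : WithLp.toLp 2 u = 0 := norm_eq_zero.1 h
  simpa using this

lemma dotProduct_le_l2norm (u v : V → ℝ) : u ⬝ᵥ v ≤ l2norm u * l2norm v := by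
  refine (abs_le_of_sq_le_sq' ?_ (mul_nonneg (l2norm_nonneg u) (l2norm_nonneg v))).2
  rw [mul_pow, l2norm_sq, l2norm_sq]
  exact Finset.sum_mul_sq_le_sq_mul_sq _ _ _

lemma l2norm_le_of_sq_le {u : V → ℝ} {a : ℝ} (ha : 0 ≤ a) (h : u ⬝ᵥ u ≤ a ^ 2) :
    l2norm u ≤ a := by
  rw [← l2norm_sq_eq_dotProduct] at h
  exact (pow_le_pow_iff_left₀ (l2norm_nonneg u) ha two_ne_zero).1 h

lemma l2norm_mono {u v : V → ℝ} (h : ∀ i, |u i| ≤ |v i|) : l2norm u ≤ l2norm v := by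
  refine (pow_le_pow_iff_left₀ (l2norm_nonneg u) (l2norm_nonneg v) two_ne_zero).1 ?_
  rw [l2norm_sq, l2norm_sq]
  exact Finset.sum_le_sum fun i _ => sq_le_sq.2 (h i)

lemma l2norm_mul_le {a u : V → ℝ} {M : ℝ} (h : ∀ i, |a i| ≤ M) :
    l2norm (a * u) ≤ |M| * l2norm u := by
  rw [← l2norm_smul]
  refine l2norm_mono fun i => ?_
  rw [Pi.mul_apply, Pi.smul_apply, smul_eq_mul, abs_mul, abs_mul]
  exact mul_le_mul_of_nonneg_right ((h i).trans (le_abs_self M)) (abs_nonneg _)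

lemma abs_le_l2norm (u : V → ℝ) (i : V) : |u i| ≤ l2norm u := by
  refine abs_le_of_sq_le_sq ?_ (l2norm_nonneg u)
  rw [l2norm_sq]
  exact Finset.single_le_sum (f := fun i => u i ^ 2) (fun j _ => sq_nonneg _) (Finset.mem_univ i)

lemma norm_le_l2norm (u : V → ℝ) : ‖u‖ ≤ l2norm u :=
  (pi_norm_le_iff_of_nonneg (l2norm_nonneg u)).2 fun i => abs_le_l2norm u i

lemma l2norm_le_sqrt_card_mul (u : V → ℝ) : l2norm u ≤ √(Fintype.card V) * ‖u‖ := by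
  refine abs_le_of_sq_le_sq' ?_ (by positivity) |>.2
  rw [l2norm_sq, mul_pow, Real.sq_sqrt (by positivity)]
  calc ∑ i, u i ^ 2 ≤ ∑ _i : V, ‖u‖ ^ 2 := Finset.sum_le_sum fun i _ =>
        sq_le_sq.2 (by rw [abs_of_nonneg (norm_nonneg u)]; exact norm_le_pi_norm u i)
    _ = _ := by simp

end EuclideanNorm

/-! ### Comparison networks -/

/-- A network of single comparisons `c ∈ ι` between the items `src c` and `tgt c`, with weights and
with scores of the items. -/
structure ComparisonNetwork (V ι : Type*) where
  src : ι → V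
  tgt : ι → V
  src_ne_tgt : ∀ c, src c ≠ tgt c
  weight : ι → ℝ
  weight_nonneg : ∀ c, 0 ≤ weight c
  score : V → ℝ

namespace ComparisonNetwork

variable {V ι : Type*} [Fintype V] [DecidableEq V] [Fintype ι]
  (N : ComparisonNetwork V ι)

/-- The comparisons in which an item takes part. -/
def incident (i : V) : Finset ι := {c | N.src c = i ∨ N.tgt c = i}

/-- The scores lie in `[1, h]`, the weights are at most `κ`, the weighted degrees are at most `D`,
and the spectral gap is at least `lam`. -/
structure IsBounded (h κ D lam : ℝ) : Prop where
  one_le_score : ∀ i, 1 ≤ N.score i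
  score_le : ∀ i, N.score i ≤ h
  weight_le : ∀ c, N.weight c ≤ κ
  degree_le : ∀ i, ∑ c ∈ N.incident i, N.weight c ≤ D
  lam_pos : 0 < lam
  poincare : ∀ v : V → ℝ, ∑ i, v i = 0 →
    lam * ∑ i, v i ^ 2 ≤ ∑ c, N.weight c * (v (N.tgt c) - v (N.src c)) ^ 2

/-- The signed indicator of the end points of a comparison. -/
def edge (c : ι) : V → ℝ := Pi.single (N.tgt c) 1 - Pi.single (N.src c) 1

omit [Fintype ι] in
lemma dotProduct_edge (f : V → ℝ) (c : ι) : f ⬝ᵥ N.edge c = f (N.tgt c) - f (N.src c) := by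
  simp [edge, dotProduct_sub]

/-- The probability that the target of a comparison wins. -/
def winProb (c : ι) : ℝ := N.score (N.tgt c) / (N.score (N.src c) + N.score (N.tgt c))

/-- The conductance of a comparison. -/
def conductance (c : ι) : ℝ :=
  N.score (N.src c) * N.score (N.tgt c) / (N.score (N.src c) + N.score (N.tgt c))

/-- The coordinate of an item. -/
abbrev coord (i : V) : (V → ℝ) →ₗ[ℝ] ℝ := LinearMap.proj i

/-- The Laplacian weighted by the conductances. -/
def lap : (V → ℝ) →ₗ[ℝ] (V → ℝ) :=
  ∑ c, (N.weight c * N.conductance c) •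
    ((coord (N.tgt c) - coord (N.src c)).smulRight (N.edge c))

omit [Fintype V] in
lemma lap_apply (u : V → ℝ) : N.lap u =
    ∑ c, (N.weight c * N.conductance c * (u (N.tgt c) - u (N.src c))) • N.edge c := by
  simp only [lap, LinearMap.sum_apply, LinearMap.smul_apply, LinearMap.smulRight_apply,
    LinearMap.sub_apply, LinearMap.proj_apply, smul_smul]

/-- The noise operator of the noise variables `η`. -/
def noise (η : ι → ℝ) : (V → ℝ) →ₗ[ℝ] (V → ℝ) :=
  ∑ c, (η c * N.weight c) •
    ((N.score (N.src c) • coord (N.src c) + N.score (N.tgt c) • coord (N.tgt c)).smulRight (N.edge c))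

omit [Fintype V] in
lemma noise_apply (η : ι → ℝ) (u : V → ℝ) : N.noise η u =
    ∑ c, (η c * N.weight c * (N.score (N.src c) * u (N.src c) + N.score (N.tgt c) * u (N.tgt c))) •
      N.edge c := by
  simp only [noise, LinearMap.sum_apply, LinearMap.smul_apply, LinearMap.smulRight_apply,
    LinearMap.add_apply, LinearMap.proj_apply, smul_smul, smul_eq_mul]

lemma dotProduct_lap (f u : V → ℝ) : f ⬝ᵥ N.lap u = ∑ c, N.weight c * N.conductance c *
    (u (N.tgt c) - u (N.src c)) * (f (N.tgt c) - f (N.src c)) := by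
  rw [lap_apply, dotProduct_sum]
  refine Finset.sum_congr rfl fun c _ => ?_
  rw [dotProduct_smul, dotProduct_edge, smul_eq_mul]

lemma dotProduct_noise (f : V → ℝ) (η : ι → ℝ) (u : V → ℝ) : f ⬝ᵥ N.noise η u =
    ∑ c, η c * (N.weight c *
      (N.score (N.src c) * u (N.src c) + N.score (N.tgt c) * u (N.tgt c)) *
      (f (N.tgt c) - f (N.src c))) := by
  rw [noise_apply, dotProduct_sum]
  refine Finset.sum_congr rfl fun c _ => ?_
  rw [dotProduct_smul, dotProduct_edge, smul_eq_mul]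
  ring

lemma sum_lap (u : V → ℝ) : ∑ i, N.lap u i = 0 := by
  have := N.dotProduct_lap 1 u
  simpa [dotProduct] using this

lemma sum_noise (η : ι → ℝ) (u : V → ℝ) : ∑ i, N.noise η u i = 0 := by
  have := N.dotProduct_noise 1 η u
  simpa [dotProduct] using this

lemma lap_symm (f u : V → ℝ) : f ⬝ᵥ N.lap u = N.lap f ⬝ᵥ u := by
  rw [dotProduct_comm (N.lap f), dotProduct_lap, dotProduct_lap]
  exact Finset.sum_congr rfl fun c _ => by ring

omit [Fintype V] in
lemma lap_const (a : ℝ) : N.lap (fun _ => a) = 0 := by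
  rw [lap_apply]; simp

/-- The Laplacian made invertible on the constants. -/
def augmentedLap : Module.End ℝ (V → ℝ) :=
  N.lap + (∑ i, coord i).smulRight 1

/-- The Green operator, an inverse of the Laplacian on vectors with sum zero. -/
def green : (V → ℝ) →ₗ[ℝ] (V → ℝ) := Ring.inverse N.augmentedLap

lemma augmentedLap_apply (u : V → ℝ) : N.augmentedLap u = N.lap u + (∑ i, u i) • 1 := by
  simp [augmentedLap, LinearMap.sum_apply]

namespace IsBounded

variable {N} {h κ D lam : ℝ} (H : N.IsBounded h κ D lam)
include H

lemma score_pos (i : V) : 0 < N.score i := zero_lt_one.trans_le (H.one_le_score i)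

lemma conductance_ge (c : ι) : 1 / 2 ≤ N.conductance c := by
  have h1 := H.one_le_score (N.src c)
  have h2 := H.one_le_score (N.tgt c)
  rw [conductance, div_le_div_iff₀ two_pos (by linarith)]
  nlinarith

lemma conductance_le (c : ι) : N.conductance c ≤ h / 2 := by
  have h1 := H.one_le_score (N.src c)
  have h2 := H.one_le_score (N.tgt c)
  have h3 := H.score_le (N.src c)
  have h4 := H.score_le (N.tgt c)
  rw [conductance, div_le_div_iff₀ (by linarith) two_pos]
  nlinarith

lemma winProb_mem (c : ι) : N.winProb c ∈ Set.Icc (0 : ℝ) 1 := by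
  have h1 := H.score_pos (N.src c)
  have h2 := H.score_pos (N.tgt c)
  exact ⟨by rw [winProb]; positivity, by
    rw [winProb, div_le_one (by positivity)]; linarith⟩

lemma sum_weight_mul_le (f : V → ℝ) (hf : ∀ i, 0 ≤ f i) :
    ∑ c, N.weight c * (f (N.src c) + f (N.tgt c)) ≤ D * ∑ i, f i := by
  have hc : ∀ c, N.weight c * (f (N.src c) + f (N.tgt c)) =
      ∑ i, if N.src c = i ∨ N.tgt c = i then f i * N.weight c else 0 := by
    intro c
    have : ∀ i, (if N.src c = i ∨ N.tgt c = i then f i * N.weight c else 0) =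
        (if N.src c = i then f i * N.weight c else 0) +
          (if N.tgt c = i then f i * N.weight c else 0) := by
      intro i
      by_cases h1 : N.src c = i <;> by_cases h2 : N.tgt c = i <;> simp [h1, h2]
      exact absurd (h1.trans h2.symm) (N.src_ne_tgt c)
    simp only [this, Finset.sum_add_distrib, Finset.sum_ite_eq, Finset.mem_univ, if_true]
    ring
  simp only [hc]
  rw [Finset.sum_comm, Finset.mul_sum]
  refine Finset.sum_le_sum fun i _ => ?_
  rw [← Finset.sum_filter, ← Finset.mul_sum, mul_comm]
  exact mul_le_mul_of_nonneg_right (H.degree_le i) (hf i)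

lemma sum_weight_sq_sub_le (v : V → ℝ) :
    ∑ c, N.weight c * (v (N.tgt c) - v (N.src c)) ^ 2 ≤ 2 * D * ∑ i, v i ^ 2 := by
  have := H.sum_weight_mul_le (fun i => v i ^ 2) (fun i => sq_nonneg _)
  rw [mul_assoc]
  refine le_trans ?_ (mul_le_mul_of_nonneg_left this two_pos.le)
  rw [Finset.mul_sum]
  refine Finset.sum_le_sum fun c _ => ?_
  nlinarith [N.weight_nonneg c, mul_nonneg (N.weight_nonneg c)
    (sq_nonneg (v (N.tgt c) + v (N.src c)))]

lemma energy_ge (v : V → ℝ) :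
    1 / 2 * ∑ c, N.weight c * (v (N.tgt c) - v (N.src c)) ^ 2 ≤ v ⬝ᵥ N.lap v := by
  rw [dotProduct_lap, Finset.mul_sum]
  refine Finset.sum_le_sum fun c _ => ?_
  have := mul_le_mul_of_nonneg_right (H.conductance_ge c)
    (mul_nonneg (N.weight_nonneg c) (sq_nonneg (v (N.tgt c) - v (N.src c))))
  linarith

lemma energy_le [Nonempty V] (v : V → ℝ) :
    v ⬝ᵥ N.lap v ≤ h * D * l2norm v ^ 2 := by
  obtain ⟨i⟩ := ‹Nonempty V›
  have hh : 0 ≤ h := (H.score_pos i).le.trans (H.score_le i)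
  rw [l2norm_sq]
  have := mul_le_mul_of_nonneg_left (H.sum_weight_sq_sub_le v) (half_pos zero_lt_one |>.le)
  calc v ⬝ᵥ N.lap v ≤ h / 2 * ∑ c, N.weight c * (v (N.tgt c) - v (N.src c)) ^ 2 := by
        rw [dotProduct_lap, Finset.mul_sum]
        refine Finset.sum_le_sum fun c _ => ?_
        have := mul_le_mul_of_nonneg_right (H.conductance_le c)
          (mul_nonneg (N.weight_nonneg c) (sq_nonneg (v (N.tgt c) - v (N.src c))))
        linarith
    _ ≤ h / 2 * (2 * D * ∑ i, v i ^ 2) :=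
        mul_le_mul_of_nonneg_left (H.sum_weight_sq_sub_le v) (by linarith)
    _ = _ := by ring

lemma energy_ge_l2norm {v : V → ℝ} (hv : ∑ i, v i = 0) :
    lam / 2 * l2norm v ^ 2 ≤ v ⬝ᵥ N.lap v := by
  rw [l2norm_sq]
  linarith [H.energy_ge v, H.poincare v hv]

lemma l2norm_le_lap {v : V → ℝ} (hv : ∑ i, v i = 0) :
    l2norm v ≤ 2 / lam * l2norm (N.lap v) := by
  have h1 := H.energy_ge_l2norm hv
  have h2 := dotProduct_le_l2norm v (N.lap v)
  have hl := H.lam_pos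
  rcases (l2norm_nonneg v).eq_or_lt with h0 | h0
  · rw [← h0]; have := l2norm_nonneg (N.lap v); positivity
  · have h3 : l2norm v * (lam / 2 * l2norm v) ≤ l2norm v * l2norm (N.lap v) := by
      nlinarith
    have h4 := le_of_mul_le_mul_left h3 h0
    rw [div_mul_eq_mul_div, le_div_iff₀ hl]
    linarith

variable [Nonempty V]

lemma isUnit_augmentedLap : IsUnit N.augmentedLap := by
  rw [Module.End.isUnit_iff]
  have hinj : Function.Injective N.augmentedLap := by
    refine (injective_iff_map_eq_zero _).2 fun u hu => ?_
    rw [augmentedLap_apply] at hu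
    have hs : ∑ i, u i = 0 := by
      have := congrArg (fun f : V → ℝ => ∑ i, f i) hu
      simp only [Pi.add_apply, Pi.smul_apply, Pi.one_apply, smul_eq_mul, mul_one,
        Finset.sum_add_distrib, N.sum_lap, Finset.sum_const, Pi.zero_apply, nsmul_eq_mul,
        zero_add, mul_zero] at this
      have hc : ((Finset.univ : Finset V).card : ℝ) ≠ 0 := by
        simp [Fintype.card_ne_zero]
      exact (mul_eq_zero.1 this).resolve_left hc
    rw [hs, zero_smul, add_zero] at hu
    have := H.l2norm_le_lap hs
    rw [hu, l2norm_zero, mul_zero] at this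
    exact eq_zero_of_l2norm_eq_zero (le_antisymm this (l2norm_nonneg u))
  exact ⟨hinj, LinearMap.injective_iff_surjective.1 hinj⟩

lemma augmentedLap_green (ζ : V → ℝ) : N.augmentedLap (N.green ζ) = ζ := by
  have := Ring.mul_inverse_cancel _ H.isUnit_augmentedLap
  exact LinearMap.congr_fun this ζ

lemma green_augmentedLap (u : V → ℝ) : N.green (N.augmentedLap u) = u := by
  have := Ring.inverse_mul_cancel _ H.isUnit_augmentedLap
  exact LinearMap.congr_fun this u

lemma green_lap {u : V → ℝ} (hu : ∑ i, u i = 0) : N.green (N.lap u) = u := by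
  have := H.green_augmentedLap u
  rwa [augmentedLap_apply, hu, zero_smul, add_zero] at this

lemma sum_green {ζ : V → ℝ} (hζ : ∑ i, ζ i = 0) : ∑ i, N.green ζ i = 0 := by
  have h1 := H.augmentedLap_green ζ
  rw [augmentedLap_apply] at h1
  have := congrArg (fun f : V → ℝ => ∑ i, f i) h1
  simp only [Pi.add_apply, Pi.smul_apply, Pi.one_apply, smul_eq_mul, mul_one,
    Finset.sum_add_distrib, N.sum_lap, Finset.sum_const, hζ, nsmul_eq_mul,
    zero_add] at this
  have hc : ((Finset.univ : Finset V).card : ℝ) ≠ 0 := by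
    simp [Fintype.card_ne_zero]
  exact (mul_eq_zero.1 this).resolve_left hc

lemma lap_green {ζ : V → ℝ} (hζ : ∑ i, ζ i = 0) : N.lap (N.green ζ) = ζ := by
  have h1 := H.augmentedLap_green ζ
  rwa [augmentedLap_apply, H.sum_green hζ, zero_smul, add_zero] at h1

lemma l2norm_green_le {ζ : V → ℝ} (hζ : ∑ i, ζ i = 0) :
    l2norm (N.green ζ) ≤ 2 / lam * l2norm ζ := by
  have := H.l2norm_le_lap (H.sum_green hζ)
  rwa [H.lap_green hζ] at this

end IsBounded

end ComparisonNetwork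

lemma sum_single_sub_const {V : Type*} [Fintype V] [DecidableEq V] [Nonempty V] (i : V) :
    ∑ j, (Pi.single i 1 - fun _ => (Fintype.card V : ℝ)⁻¹ : V → ℝ) j = 0 := by
  have : (Fintype.card V : ℝ) ≠ 0 := by exact_mod_cast Fintype.card_ne_zero
  simp [this]

namespace ComparisonNetwork

variable {V ι : Type*} [Fintype V] [DecidableEq V] [Fintype ι]
  (N : ComparisonNetwork V ι)

/-! ### The Green operator in the supremum norm -/

/-- The end point of a comparison other than `i`. -/
def other (i : V) (c : ι) : V := if N.src c = i then N.tgt c else N.src c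

omit [Fintype V] in
lemma lap_apply_coord (u : V → ℝ) (i : V) : N.lap u i =
    ∑ c ∈ N.incident i, N.weight c * N.conductance c * (u i - u (N.other i c)) := by
  rw [lap_apply, Finset.sum_apply, incident, Finset.sum_filter]
  refine Finset.sum_congr rfl fun c _ => ?_
  rw [Pi.smul_apply, smul_eq_mul, edge, Pi.sub_apply, other]
  have hne := N.src_ne_tgt c
  by_cases h1 : N.src c = i
  · have h2 : N.tgt c ≠ i := fun h => hne (h1.trans h.symm)
    simp only [h1, true_or, if_true, Pi.single_eq_same, Pi.single_eq_of_ne h2.symm]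
    ring
  · by_cases h2 : N.tgt c = i
    · simp only [h2, h1, or_true, if_true, if_false, Pi.single_eq_same,
        Pi.single_eq_of_ne (Ne.symm h1)]
      ring
    · simp [h1, h2]

/-- One step of the lazy random walk with rate `d`. -/
def walk (d : ℝ) : Module.End ℝ (V → ℝ) := 1 - d⁻¹ • N.lap

omit [Fintype V] in
lemma walk_apply (d : ℝ) (u : V → ℝ) : N.walk d u = u - d⁻¹ • N.lap u := rfl

lemma sum_walk (d : ℝ) (u : V → ℝ) : ∑ i, N.walk d u i = ∑ i, u i := by
  simp only [walk_apply, Pi.sub_apply, Pi.smul_apply, smul_eq_mul, Finset.sum_sub_distrib,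
    ← Finset.mul_sum, N.sum_lap, mul_zero, sub_zero]

omit [Fintype V] in
lemma lap_walk (d : ℝ) (u : V → ℝ) : N.lap (N.walk d u) = N.walk d (N.lap u) := by
  simp [walk_apply]

namespace IsBounded

variable {N} {h κ D lam : ℝ} (H : N.IsBounded h κ D lam)
include H

lemma lam_le [Nontrivial V] : lam ≤ 2 * D := by
  obtain ⟨i, j, hij⟩ := exists_pair_ne V
  set v : V → ℝ := Pi.single i 1 - Pi.single j 1 with hv
  have h0 : ∑ i, v i = 0 := by simp [hv]
  have h1 := H.poincare v h0
  have h2 := H.sum_weight_sq_sub_le v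
  have h3 : 0 < ∑ i, v i ^ 2 := by
    refine Finset.sum_pos' (fun k _ => sq_nonneg _) ⟨i, Finset.mem_univ _, ?_⟩
    simp [hv, Pi.single_eq_of_ne hij]
  exact le_of_mul_le_mul_right (h1.trans h2) h3

lemma one_le_h [Nonempty V] : 1 ≤ h := by
  obtain ⟨i⟩ := ‹Nonempty V›
  exact (H.one_le_score i).trans (H.score_le i)

lemma degree_pos [Nontrivial V] : 0 < D := by
  linarith [H.lam_le, H.lam_pos]

lemma norm_walk_le [Nontrivial V] (u : V → ℝ) : ‖N.walk (h * D) u‖ ≤ ‖u‖ := by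
  have hh := H.one_le_h
  have hD := H.degree_pos
  have hhD : 0 < h * D := by positivity
  refine (pi_norm_le_iff_of_nonneg (norm_nonneg u)).2 fun i => ?_
  set s := ∑ c ∈ N.incident i, (h * D)⁻¹ * (N.weight c * N.conductance c) with hs
  have hterm : ∀ c, 0 ≤ (h * D)⁻¹ * (N.weight c * N.conductance c) := fun c =>
    mul_nonneg (inv_nonneg.2 hhD.le) (mul_nonneg (N.weight_nonneg c)
      (by linarith [H.conductance_ge c]))
  have hs1 : s ≤ 1 := by
    have : s ≤ ∑ c ∈ N.incident i, (h * D)⁻¹ * (h / 2) * N.weight c := by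
      refine Finset.sum_le_sum fun c _ => ?_
      have := mul_le_mul_of_nonneg_left (H.conductance_le c)
        (mul_nonneg (inv_nonneg.2 hhD.le) (N.weight_nonneg c))
      linarith
    rw [← Finset.mul_sum] at this
    refine this.trans ((mul_le_mul_of_nonneg_left (H.degree_le i) (by positivity)).trans ?_)
    rw [mul_inv]
    field_simp
    norm_num
  have e : N.walk (h * D) u i = (1 - s) * u i +
      ∑ c ∈ N.incident i, (h * D)⁻¹ * (N.weight c * N.conductance c) * u (N.other i c) := by
    rw [walk_apply, Pi.sub_apply, Pi.smul_apply, smul_eq_mul, lap_apply_coord, hs, sub_mul,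
      one_mul, Finset.sum_mul, sub_add, ← Finset.sum_sub_distrib, Finset.mul_sum]
    congr 1
    exact Finset.sum_congr rfl fun c _ => by ring
  rw [e, Real.norm_eq_abs]
  have hu : ∀ j, |u j| ≤ ‖u‖ := fun j => norm_le_pi_norm u j
  calc _ ≤ (1 - s) * ‖u‖ +
        ∑ c ∈ N.incident i, (h * D)⁻¹ * (N.weight c * N.conductance c) * ‖u‖ := by
        refine (abs_add_le _ _).trans (add_le_add ?_ ?_)
        · rw [abs_mul, abs_of_nonneg (sub_nonneg.2 hs1)]
          exact mul_le_mul_of_nonneg_left (hu i) (sub_nonneg.2 hs1)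
        · refine (Finset.abs_sum_le_sum_abs _ _).trans (Finset.sum_le_sum fun c _ => ?_)
          rw [abs_mul, abs_of_nonneg (hterm c)]
          exact mul_le_mul_of_nonneg_left (hu _) (hterm c)
    _ = ‖u‖ := by rw [← Finset.sum_mul, ← hs]; ring

lemma l2norm_lap_sq_le [Nonempty V] (u : V → ℝ) :
    l2norm (N.lap u) ^ 2 ≤ h * D * (u ⬝ᵥ N.lap u) := by
  set w := N.lap u with hw
  have hB : (w ⬝ᵥ N.lap u) ^ 2 ≤ (w ⬝ᵥ N.lap w) * (u ⬝ᵥ N.lap u) := by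
    simp only [dotProduct_lap]
    have hnn : ∀ c, 0 ≤ N.weight c * N.conductance c := fun c =>
      mul_nonneg (N.weight_nonneg c) (by linarith [H.conductance_ge c])
    have := Finset.sum_mul_sq_le_sq_mul_sq (Finset.univ : Finset ι)
      (fun c => √(N.weight c * N.conductance c) * (w (N.tgt c) - w (N.src c)))
      (fun c => √(N.weight c * N.conductance c) * (u (N.tgt c) - u (N.src c)))
    have e : ∀ a b : V → ℝ, ∀ c, N.weight c * N.conductance c * (a (N.tgt c) - a (N.src c)) *
        (b (N.tgt c) - b (N.src c)) =
        (√(N.weight c * N.conductance c) * (b (N.tgt c) - b (N.src c))) *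
        (√(N.weight c * N.conductance c) * (a (N.tgt c) - a (N.src c))) := by
      intro a b c
      have := Real.mul_self_sqrt (hnn c)
      linear_combination (-(a (N.tgt c) - a (N.src c)) * (b (N.tgt c) - b (N.src c))) * this
    simp only [e]
    simpa only [pow_two] using this
  rw [← hw, ← l2norm_sq_eq_dotProduct] at hB
  have hE := H.energy_le w
  have hu : 0 ≤ u ⬝ᵥ w := by
    rw [hw]
    refine le_trans ?_ (H.energy_ge u)
    exact mul_nonneg (by norm_num) (Finset.sum_nonneg fun c _ =>
      mul_nonneg (N.weight_nonneg c) (sq_nonneg _))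
  rcases (sq_nonneg (l2norm w)).eq_or_lt with h0 | h0
  · rw [← h0] at hE ⊢
    obtain ⟨i⟩ := ‹Nonempty V›
    have hD : 0 ≤ D := (Finset.sum_nonneg fun c _ => N.weight_nonneg c).trans (H.degree_le i)
    have := (H.score_pos i).le.trans (H.score_le i)
    positivity
  · have := hB.trans (mul_le_mul_of_nonneg_right hE hu)
    refine le_of_mul_le_mul_left ?_ h0
    linarith

lemma l2norm_walk_sq_le [Nontrivial V] {u : V → ℝ} (hu : ∑ i, u i = 0) :
    l2norm (N.walk (h * D) u) ^ 2 ≤ (1 - lam / (2 * (h * D))) * l2norm u ^ 2 := by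
  have hhD : 0 < h * D := mul_pos (by linarith [H.one_le_h]) H.degree_pos
  have h1 := H.l2norm_lap_sq_le u
  have h2 := H.energy_ge_l2norm hu
  have e : l2norm (N.walk (h * D) u) ^ 2 =
      l2norm u ^ 2 - 2 * (h * D)⁻¹ * (u ⬝ᵥ N.lap u) + (h * D)⁻¹ ^ 2 * l2norm (N.lap u) ^ 2 := by
    rw [l2norm_sq_eq_dotProduct, l2norm_sq_eq_dotProduct, l2norm_sq_eq_dotProduct, walk_apply]
    simp only [sub_dotProduct, dotProduct_sub, smul_dotProduct, dotProduct_smul, smul_eq_mul]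
    rw [dotProduct_comm (N.lap u) u]
    ring
  have h3 : (h * D)⁻¹ ^ 2 * l2norm (N.lap u) ^ 2 ≤ (h * D)⁻¹ * (u ⬝ᵥ N.lap u) := by
    refine (mul_le_mul_of_nonneg_left h1 (by positivity)).trans (le_of_eq ?_)
    field_simp
  have h4 := mul_le_mul_of_nonneg_left h2 (inv_nonneg.2 hhD.le)
  have h5 : lam / (2 * (h * D)) = (h * D)⁻¹ * (lam / 2) := by field_simp
  rw [e, h5]
  linarith

lemma norm_green_le [Nontrivial V] (hn : 1 ≤ Real.log (Fintype.card V)) {ζ : V → ℝ}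
    (hζ : ∑ i, ζ i = 0) :
    ‖N.green ζ‖ ≤ 6 * Real.log (Fintype.card V) / lam * ‖ζ‖ := by
  have hh := H.one_le_h
  have hD := H.degree_pos
  have hl := H.lam_pos
  have hhD : 0 < h * D := by positivity
  have hlD : lam ≤ 2 * (h * D) := H.lam_le.trans (by nlinarith)
  set W := N.walk (h * D)
  set u := N.green ζ with hu
  set n : ℝ := (Fintype.card V : ℝ) with hndef
  have hn0 : 0 < n := by rw [hndef]; exact_mod_cast Fintype.card_pos
  have hu0 : ∑ i, u i = 0 := H.sum_green hζ
  have hlap : N.lap u = ζ := H.lap_green hζ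
  have hsum : ∀ t, ∑ i, (W^[t] u) i = 0 := by
    intro t
    induction t with
    | zero => exact hu0
    | succ t ih => rw [Function.iterate_succ_apply', sum_walk, ih]
  have hlapt : ∀ t, N.lap (W^[t] u) = W^[t] ζ := by
    intro t
    induction t with
    | zero => exact hlap
    | succ t ih => rw [Function.iterate_succ_apply', lap_walk, ih, Function.iterate_succ_apply']
  have hζt : ∀ t, ‖W^[t] ζ‖ ≤ ‖ζ‖ := by
    intro t
    induction t with
    | zero => exact le_rfl
    | succ t ih => rw [Function.iterate_succ_apply']; exact (H.norm_walk_le _).trans ih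
  have hstep : ∀ t : ℕ, ‖u‖ ≤ ‖W^[t] u‖ + t * ((h * D)⁻¹ * ‖ζ‖) := by
    intro t
    induction t with
    | zero => simp
    | succ t ih =>
      have e : W^[t] u = W^[t + 1] u + (h * D)⁻¹ • W^[t] ζ := by
        rw [Function.iterate_succ_apply', ← hlapt t]
        simp [W, walk_apply]
      have : ‖W^[t] u‖ ≤ ‖W^[t + 1] u‖ + (h * D)⁻¹ * ‖ζ‖ := by
        rw [e]
        refine (norm_add_le _ _).trans (add_le_add_right ?_ _)
        rw [norm_smul, Real.norm_of_nonneg (inv_nonneg.2 hhD.le)]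
        exact mul_le_mul_of_nonneg_left (hζt t) (inv_nonneg.2 hhD.le)
      push_cast
      linarith
  set a := lam / (2 * (h * D)) with ha
  have ha0 : 0 < a := by positivity
  have ha1 : a ≤ 1 := (div_le_one (by positivity)).2 hlD
  have hl2 : ∀ t, l2norm (W^[t] u) ^ 2 ≤ (1 - a) ^ t * l2norm u ^ 2 := by
    intro t
    induction t with
    | zero => simp
    | succ t ih =>
      rw [Function.iterate_succ_apply', pow_succ' (1 - a), mul_assoc]
      exact (H.l2norm_walk_sq_le (hsum t)).trans (mul_le_mul_of_nonneg_left ih (by linarith))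
  set T := ⌈Real.log n / a⌉₊ with hT
  have hT1 : Real.log n / a ≤ T := Nat.le_ceil _
  have hT2 : (T : ℝ) < Real.log n / a + 1 := Nat.ceil_lt_add_one (by positivity)
  have hdecay : (1 - a) ^ T ≤ 1 / n := by
    calc (1 - a) ^ T ≤ Real.exp (-a) ^ T :=
          pow_le_pow_left₀ (by linarith) (Real.one_sub_le_exp_neg a) _
      _ = Real.exp (-(a * T)) := by rw [← Real.exp_nat_mul]; congr 1; ring
      _ ≤ Real.exp (-Real.log n) := by
          rw [Real.exp_le_exp, neg_le_neg_iff]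
          rwa [div_le_iff₀' ha0] at hT1
      _ = 1 / n := by rw [Real.exp_neg, Real.exp_log hn0, one_div]
  have hu2 : l2norm u ^ 2 ≤ (2 / lam) ^ 2 * (n * ‖ζ‖ ^ 2) := by
    have h1 := H.l2norm_green_le hζ
    have h2 := l2norm_le_sqrt_card_mul ζ
    have h3 : l2norm u ≤ 2 / lam * (√n * ‖ζ‖) :=
      h1.trans (mul_le_mul_of_nonneg_left h2 (by positivity))
    calc l2norm u ^ 2 ≤ (2 / lam * (√n * ‖ζ‖)) ^ 2 :=
          pow_le_pow_left₀ (l2norm_nonneg u) h3 2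
      _ = _ := by rw [mul_pow, mul_pow, Real.sq_sqrt hn0.le]
  have hfin : ‖W^[T] u‖ ≤ 2 / lam * ‖ζ‖ := by
    refine (norm_le_l2norm _).trans (abs_le_of_sq_le_sq' ?_ (by positivity)).2
    calc l2norm (W^[T] u) ^ 2 ≤ 1 / n * ((2 / lam) ^ 2 * (n * ‖ζ‖ ^ 2)) :=
          (hl2 T).trans (mul_le_mul hdecay hu2 (sq_nonneg _) (by positivity))
      _ = _ := by field_simp
  have hTD : T * (h * D)⁻¹ ≤ 2 * Real.log n / lam + 2 / lam := by
    have e1 : Real.log n / a * (h * D)⁻¹ = 2 * Real.log n / lam := by rw [ha]; field_simp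
    have e2 : (h * D)⁻¹ ≤ 2 / lam := by
      rw [inv_eq_one_div, div_le_div_iff₀ hhD hl]; linarith
    have := mul_le_mul_of_nonneg_right hT2.le (inv_nonneg.2 hhD.le)
    rw [add_mul, one_mul, e1] at this
    linarith
  calc ‖u‖ ≤ ‖W^[T] u‖ + T * ((h * D)⁻¹ * ‖ζ‖) := hstep T
    _ ≤ 2 / lam * ‖ζ‖ + (2 * Real.log n / lam + 2 / lam) * ‖ζ‖ := by
        rw [← mul_assoc]
        exact add_le_add hfin (mul_le_mul_of_nonneg_right hTD (norm_nonneg _))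
    _ = (2 * Real.log n + 4) / lam * ‖ζ‖ := by ring
    _ ≤ _ := by
        refine mul_le_mul_of_nonneg_right (div_le_div_of_nonneg_right ?_ hl.le) (norm_nonneg _)
        linarith

end IsBounded

/-! ### The rows of the Green operator -/

/-- The row `i` of the Green operator. -/
def greenRow (i : V) : V → ℝ := N.green (Pi.single i 1 - fun _ => (Fintype.card V : ℝ)⁻¹)

namespace IsBounded

variable {N} {h κ D lam : ℝ} (H : N.IsBounded h κ D lam)
include H

lemma greenRow_dotProduct [Nonempty V] (i : V) {ζ : V → ℝ} (hζ : ∑ j, ζ j = 0) :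
    N.greenRow i ⬝ᵥ ζ = N.green ζ i := by
  conv_lhs => rw [← H.lap_green hζ]
  rw [lap_symm, greenRow, H.lap_green (sum_single_sub_const i), sub_dotProduct,
    single_dotProduct, one_mul]
  have : (fun _ => (Fintype.card V : ℝ)⁻¹ : V → ℝ) ⬝ᵥ N.green ζ = 0 := by
    rw [dotProduct, ← Finset.mul_sum, H.sum_green hζ, mul_zero]
  rw [this, sub_zero]

lemma energy_greenRow_le [Nonempty V] (i : V) :
    ∑ c, N.weight c * (N.greenRow i (N.tgt c) - N.greenRow i (N.src c)) ^ 2 ≤ 4 / lam := by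
  have h0 := sum_single_sub_const i
  set e : V → ℝ := Pi.single i 1 - fun _ => (Fintype.card V : ℝ)⁻¹ with he
  have h1 := H.energy_ge (N.greenRow i)
  rw [greenRow, H.lap_green h0] at h1
  have h2 := dotProduct_le_l2norm (N.green e) e
  have h3 := H.l2norm_green_le h0
  have hc : (0 : ℝ) < Fintype.card V := by exact_mod_cast Fintype.card_pos
  have h4 : l2norm e ≤ 1 := by
    refine l2norm_le_of_sq_le zero_le_one ?_
    have : e ⬝ᵥ e = e i := by
      conv_lhs => rw [he]
      rw [sub_dotProduct, single_dotProduct, one_mul]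
      have : (fun _ => (Fintype.card V : ℝ)⁻¹ : V → ℝ) ⬝ᵥ e = 0 := by
        rw [dotProduct, ← Finset.mul_sum, h0, mul_zero]
      rw [← he, this, sub_zero]
    rw [this, he]
    simp
  have hl := H.lam_pos
  have h5 : l2norm (N.green e) * l2norm e ≤ 2 / lam := by
    have hb : l2norm (N.green e) ≤ 2 / lam * 1 :=
      h3.trans (mul_le_mul_of_nonneg_left h4 (by positivity))
    calc _ ≤ (2 / lam * 1) * 1 := mul_le_mul hb h4 (l2norm_nonneg _) (by positivity)
      _ = _ := by ring
  have h6 : 1 / 2 * ∑ c, N.weight c * (N.greenRow i (N.tgt c) - N.greenRow i (N.src c)) ^ 2 ≤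
    2 / lam := h1.trans (h2.trans h5)
  have : (4 : ℝ) / lam = 2 * (2 / lam) := by ring
  rw [this]
  linarith

end IsBounded

end ComparisonNetwork

namespace ComparisonNetwork

variable {V ι : Type*} [Fintype V] [DecidableEq V] [Fintype ι]
  (N : ComparisonNetwork V ι)

/-! ### The noise operator -/

/-- The antisymmetric matrix of the noise between pairs of items. -/
def skewNoise (η : ι → ℝ) : Matrix V V ℝ :=
  ∑ c, (η c * N.weight c) • (Matrix.single (N.tgt c) (N.src c) 1 -
    Matrix.single (N.src c) (N.tgt c) 1)

/-- The net noise at the items. -/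
def netNoise (η : ι → ℝ) : V → ℝ := ∑ c, (η c * N.weight c) • N.edge c

lemma noise_eq (η : ι → ℝ) (u : V → ℝ) :
    N.noise η u = N.skewNoise η *ᵥ (N.score * u) + N.netNoise η * (N.score * u) := by
  rw [noise_apply, skewNoise, netNoise, Matrix.sum_mulVec, Finset.sum_mul,
    ← Finset.sum_add_distrib]
  refine Finset.sum_congr rfl fun c _ => ?_
  rw [Matrix.smul_mulVec, Matrix.sub_mulVec, Matrix.single_mulVec_eq, Matrix.single_mulVec_eq]
  ext i
  simp only [edge, Pi.smul_apply, Pi.sub_apply, Pi.add_apply, Pi.mul_apply, smul_eq_mul, one_mul,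
    Pi.single_apply]
  by_cases h1 : i = N.tgt c <;> by_cases h2 : i = N.src c
  · exact absurd (h2.symm.trans h1) (N.src_ne_tgt c)
  · subst h1; simp [h2]; ring
  · subst h2; simp [h1]; ring
  · simp [h1, h2]

lemma skewNoise_mulVec_apply (η : ι → ℝ) (x : V → ℝ) (i : V) : (N.skewNoise η *ᵥ x) i =
    ∑ c ∈ N.incident i, η c * (N.weight c *
      (if N.tgt c = i then x (N.src c) else - x (N.tgt c))) := by
  rw [skewNoise, Matrix.sum_mulVec, Finset.sum_apply, incident, Finset.sum_filter]
  refine Finset.sum_congr rfl fun c _ => ?_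
  rw [Matrix.smul_mulVec, Matrix.sub_mulVec, Matrix.single_mulVec_eq, Matrix.single_mulVec_eq]
  simp only [Pi.smul_apply, Pi.sub_apply, smul_eq_mul, one_mul, Pi.single_apply]
  by_cases h1 : i = N.tgt c <;> by_cases h2 : i = N.src c
  · exact absurd (h2.symm.trans h1) (N.src_ne_tgt c)
  · subst h1; simp [h2]; ring
  · subst h2; simp [h1, Ne.symm h1]; ring
  · simp [h1, h2, Ne.symm h1, Ne.symm h2]

omit [Fintype V] in
lemma netNoise_apply (η : ι → ℝ) (i : V) : N.netNoise η i =
    ∑ c ∈ N.incident i, η c * (N.weight c * (if N.tgt c = i then 1 else -1)) := by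
  rw [netNoise, Finset.sum_apply, incident, Finset.sum_filter]
  refine Finset.sum_congr rfl fun c _ => ?_
  simp only [edge, Pi.smul_apply, Pi.sub_apply, smul_eq_mul, Pi.single_apply]
  by_cases h1 : i = N.tgt c <;> by_cases h2 : i = N.src c
  · exact absurd (h2.symm.trans h1) (N.src_ne_tgt c)
  · subst h1; simp [h2]
  · subst h2; simp [Ne.symm h1, h1]
  · simp [h1, h2, Ne.symm h1, Ne.symm h2]

/-- The noise with the comparisons of the item `j` removed. -/
def dropNoise (j : V) (η : ι → ℝ) : ι → ℝ := fun c =>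
  if N.src c = j ∨ N.tgt c = j then 0 else η c

/-- The noise of the comparisons of the item `j`. -/
def localNoise (j : V) (η : ι → ℝ) : ι → ℝ := fun c =>
  if N.src c = j ∨ N.tgt c = j then η c else 0

omit [Fintype V] in
lemma noise_eq_dropNoise_add (j : V) (η : ι → ℝ) (u : V → ℝ) :
    N.noise η u = N.noise (N.dropNoise j η) u + N.noise (N.localNoise j η) u := by
  simp only [noise_apply, ← Finset.sum_add_distrib, ← add_smul]
  refine Finset.sum_congr rfl fun c _ => ?_
  congr 1
  by_cases hc : N.src c = j ∨ N.tgt c = j <;> simp [dropNoise, localNoise, hc]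

omit [Fintype V] in
lemma noise_apply_coord (η : ι → ℝ) (u : V → ℝ) (i : V) : N.noise η u i =
    ∑ c, η c * N.weight c * (N.score (N.src c) * u (N.src c) + N.score (N.tgt c) * u (N.tgt c)) *
      N.edge c i := by
  rw [noise_apply, Finset.sum_apply]
  rfl

omit [Fintype V] in
lemma noise_localNoise_self (j : V) (η : ι → ℝ) (u : V → ℝ) :
    N.noise (N.localNoise j η) u j = N.noise η u j := by
  rw [noise_apply_coord, noise_apply_coord]
  refine Finset.sum_congr rfl fun c _ => ?_
  by_cases h : N.src c = j ∨ N.tgt c = j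
  · simp [localNoise, h]
  · push Not at h
    have : N.edge c j = 0 := by
      simp [edge, Pi.single_eq_of_ne (Ne.symm h.1), Pi.single_eq_of_ne (Ne.symm h.2)]
    rw [this, mul_zero, mul_zero]

omit [Fintype V] in
lemma noise_localNoise_of_ne {i j : V} (hij : i ≠ j) (η : ι → ℝ) (u : V → ℝ) :
    N.noise (N.localNoise j η) u i =
      N.skewNoise η i j * (N.score i * u i + N.score j * u j) := by
  rw [noise_apply_coord, skewNoise, Matrix.sum_apply, Finset.sum_mul]
  refine Finset.sum_congr rfl fun c _ => ?_
  have hne := N.src_ne_tgt c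
  simp only [localNoise, edge,
    Pi.sub_apply, Pi.single_apply, Matrix.smul_apply, Matrix.sub_apply, smul_eq_mul,
    Matrix.single_apply]
  by_cases h1 : N.src c = j
  · by_cases h2 : N.tgt c = i
    · subst h1; subst h2; simp [hij, hne, add_comm]
    · simp [h1, h2, Ne.symm h2, hij, Ne.symm hij]
  · by_cases h2 : N.tgt c = j
    · by_cases h3 : N.src c = i
      · subst h2; subst h3; simp [hij, hij.symm]
      · simp [h1, h2, h3, Ne.symm h3, hij]
    · simp [h1, h2]

/-- The terms of the Neumann series of the stationary distribution. -/
def neumann (η : ι → ℝ) (r : ℕ) : V → ℝ := (fun u => N.green (N.noise η u))^[r] 1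

lemma neumann_zero (η : ι → ℝ) : N.neumann η 0 = 1 := rfl

lemma neumann_succ (η : ι → ℝ) (r : ℕ) :
    N.neumann η (r + 1) = N.green (N.noise η (N.neumann η r)) :=
  Function.iterate_succ_apply' _ _ _

/-- The noise is bounded at scale `b` as an operator. -/
structure IsBoundedNoise (b : ℝ) (η : ι → ℝ) : Prop where
  skew_le : ∀ u, l2norm (N.skewNoise η *ᵥ u) ≤ b * l2norm u
  net_le : ∀ j, |N.netNoise η j| ≤ b / 2

/-- The noise at each item `j` is small against the first `R` terms of the Neumann series that are
computed without the comparisons of `j`. -/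
def IsLeaveOneOutNoise (h b : ℝ) (R : ℕ) (η : ι → ℝ) : Prop :=
  ∀ j, ∀ r < R, |(N.skewNoise η *ᵥ (N.score * N.neumann (N.dropNoise j η) r)) j| ≤
    b / 2 * (h * ‖N.neumann (N.dropNoise j η) r‖)

namespace IsBounded

variable {N} {h κ D lam : ℝ} (H : N.IsBounded h κ D lam) {b : ℝ} {η : ι → ℝ}
include H

lemma abs_score_le (i : V) : |N.score i| ≤ h := by
  rw [abs_of_pos (H.score_pos i)]
  exact H.score_le i

lemma l2norm_score_mul_le [Nonempty V] (u : V → ℝ) : l2norm (N.score * u) ≤ h * l2norm u := by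
  have := l2norm_mul_le (a := N.score) (u := u) H.abs_score_le
  rwa [abs_of_nonneg (zero_le_one.trans H.one_le_h)] at this

lemma l2norm_noise_le [Nonempty V] (hb : 0 ≤ b) (hη : N.IsBoundedNoise b η) (u : V → ℝ) :
    l2norm (N.noise η u) ≤ 3 / 2 * (b * h) * l2norm u := by
  rw [noise_eq]
  have h1 := H.l2norm_score_mul_le u
  have h2 := hη.skew_le (N.score * u)
  have h3 := l2norm_mul_le (a := N.netNoise η) (u := N.score * u) hη.net_le
  rw [abs_of_nonneg (by positivity)] at h3
  have h4 := mul_le_mul_of_nonneg_left h1 hb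
  refine (l2norm_add_le _ _).trans ?_
  linarith

lemma l2norm_green_noise_le [Nonempty V] (hb : 0 ≤ b) (hη : N.IsBoundedNoise b η) (u : V → ℝ) :
    l2norm (N.green (N.noise η u)) ≤ 3 * (b * h / lam) * l2norm u := by
  have hl := H.lam_pos
  refine (H.l2norm_green_le (N.sum_noise η u)).trans ?_
  refine (mul_le_mul_of_nonneg_left (H.l2norm_noise_le hb hη u) (by positivity)).trans
    (le_of_eq ?_)
  field_simp

lemma l2norm_noise_localNoise_le [Nonempty V] (hb : 0 ≤ b) (hη : N.IsBoundedNoise b η) (j : V)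
    {u : V → ℝ} {A : ℝ} (hA : ‖u‖ ≤ A)
    (hu : |(N.skewNoise η *ᵥ (N.score * u)) j| ≤ b / 2 * (h * A)) :
    l2norm (N.noise (N.localNoise j η) u) ≤ 3 * (b * h) * A := by
  have hh := zero_le_one.trans H.one_le_h
  have hA0 : 0 ≤ A := (norm_nonneg u).trans hA
  have hcoord : ∀ i, |N.score i * u i| ≤ h * A := fun i => by
    rw [abs_mul]
    exact mul_le_mul (H.abs_score_le i) ((norm_le_pi_norm u i).trans hA) (abs_nonneg _) hh
  set w := N.noise (N.localNoise j η) u with hw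
  have hj : |w j| ≤ b * (h * A) := by
    rw [hw, noise_localNoise_self, noise_eq, Pi.add_apply, Pi.mul_apply, Pi.mul_apply]
    refine (abs_add_le _ _).trans ?_
    rw [abs_mul (N.netNoise η j)]
    have := mul_le_mul (hη.net_le j) (hcoord j) (abs_nonneg _) (by positivity)
    linarith
  have hsplit : ∀ i, |w i| ≤
      |((b * (h * A)) • (Pi.single j 1 : V → ℝ) + (2 * (h * A)) •
        fun i => |(N.skewNoise η *ᵥ Pi.single j 1) i|) i| := by
    intro i
    have hnn : 0 ≤ 2 * (h * A) * |N.skewNoise η i j| := by positivity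
    simp only [Pi.add_apply, Pi.smul_apply, smul_eq_mul, Matrix.mulVec_single_one, Matrix.col_apply]
    by_cases hij : i = j
    · subst hij
      have hnn' : 0 ≤ b * (h * A) := by positivity
      rw [Pi.single_eq_same, mul_one, abs_of_nonneg (add_nonneg hnn' hnn)]
      linarith
    · rw [Pi.single_eq_of_ne hij, mul_zero, zero_add, abs_of_nonneg hnn, hw,
        noise_localNoise_of_ne N hij, abs_mul, mul_comm]
      refine mul_le_mul_of_nonneg_right ((abs_add_le _ _).trans ?_) (abs_nonneg _)
      linarith [hcoord i, hcoord j]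
  have hs1 : l2norm (Pi.single j 1 : V → ℝ) = 1 := by
    rw [l2norm]; simp
  have hs2 : l2norm (fun i => |(N.skewNoise η *ᵥ Pi.single j 1) i|) ≤ b := by
    have h1 := hη.skew_le (Pi.single j 1)
    rw [hs1, mul_one] at h1
    refine le_trans (l2norm_mono fun i => ?_) h1
    rw [abs_abs]
  refine (l2norm_mono hsplit).trans ((l2norm_add_le _ _).trans ?_)
  rw [l2norm_smul, l2norm_smul, hs1, abs_of_nonneg (by positivity), abs_of_nonneg (by positivity)]
  have := mul_le_mul_of_nonneg_left hs2 (by positivity : 0 ≤ 2 * (h * A))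
  linarith

/-- One step of the leave-one-out recursion. -/
lemma neumann_succ_bound [Nontrivial V] (hn : 1 ≤ Real.log (Fintype.card V)) (hb : 0 ≤ b)
    (hη : N.IsBoundedNoise b η) {R : ℕ} (hloo : N.IsLeaveOneOutNoise h b R η) {r : ℕ} (hr : r < R)
    {A : ℝ}
    (hA : ∀ j, ‖N.neumann η r‖ + l2norm (N.neumann η r - N.neumann (N.dropNoise j η) r) ≤ A) :
    ‖N.neumann η (r + 1)‖ ≤ 12 * Real.log (Fintype.card V) * (b * h / lam) * A ∧
    ∀ j, l2norm (N.neumann η (r + 1) - N.neumann (N.dropNoise j η) (r + 1)) ≤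
      9 * (b * h / lam) * A := by
  have hl := H.lam_pos
  have hh := zero_le_one.trans H.one_le_h
  have hA0 : 0 ≤ A := by
    obtain ⟨j⟩ := (inferInstance : Nonempty V)
    exact (add_nonneg (norm_nonneg _) (l2norm_nonneg _)).trans (hA j)
  set y := N.neumann η r with hy
  have hyA : ‖y‖ ≤ A := by
    obtain ⟨j⟩ := (inferInstance : Nonempty V)
    linarith [hA j, l2norm_nonneg (y - N.neumann (N.dropNoise j η) r)]
  have hdA : ∀ j, l2norm (y - N.neumann (N.dropNoise j η) r) ≤ A := fun j => by
    linarith [hA j, norm_nonneg y]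
  have hy'A : ∀ j, ‖N.neumann (N.dropNoise j η) r‖ ≤ A := fun j => by
    have h1 : N.neumann (N.dropNoise j η) r = y - (y - N.neumann (N.dropNoise j η) r) := by abel
    rw [h1]
    exact (norm_sub_le _ _).trans ((add_le_add_right (norm_le_l2norm _) _).trans (hA j))
  have hloo' : ∀ j, |(N.skewNoise η *ᵥ (N.score * N.neumann (N.dropNoise j η) r)) j| ≤
      b / 2 * (h * A) := fun j => (hloo j r hr).trans
    (mul_le_mul_of_nonneg_left (mul_le_mul_of_nonneg_left (hy'A j) hh) (by positivity))
  constructor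
  · have hnoise : ‖N.noise η y‖ ≤ 2 * (b * h) * A := by
      refine (pi_norm_le_iff_of_nonneg (by positivity)).2 fun j => ?_
      have hdec : N.score * y = N.score * N.neumann (N.dropNoise j η) r +
          N.score * (y - N.neumann (N.dropNoise j η) r) := by ring
      have h1 : |(N.skewNoise η *ᵥ (N.score * (y - N.neumann (N.dropNoise j η) r))) j| ≤
          b * (h * A) := by
        refine (abs_le_l2norm _ j).trans ((hη.skew_le _).trans
          (mul_le_mul_of_nonneg_left ?_ hb))
        exact (H.l2norm_score_mul_le _).trans (mul_le_mul_of_nonneg_left (hdA j) hh)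
      have h2 : |N.netNoise η j * (N.score j * y j)| ≤ b / 2 * (h * A) := by
        rw [abs_mul, abs_mul]
        exact mul_le_mul (hη.net_le j) (mul_le_mul (H.abs_score_le j)
          ((norm_le_pi_norm y j).trans hyA) (abs_nonneg _) hh) (by positivity) (by positivity)
      rw [Real.norm_eq_abs, noise_eq, Pi.add_apply, Pi.mul_apply, Pi.mul_apply, hdec,
        Matrix.mulVec_add, Pi.add_apply]
      refine (abs_add_le _ _).trans ((add_le_add_left (abs_add_le _ _) _).trans ?_)
      linarith [hloo' j]
    rw [neumann_succ]
    refine (H.norm_green_le hn (N.sum_noise η y)).trans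
      ((mul_le_mul_of_nonneg_left hnoise (by positivity)).trans (le_of_eq ?_))
    ring
  · intro j
    rw [neumann_succ, neumann_succ, ← map_sub]
    have hdec : N.noise η y - N.noise (N.dropNoise j η) (N.neumann (N.dropNoise j η) r) =
        N.noise η (y - N.neumann (N.dropNoise j η) r) +
          N.noise (N.localNoise j η) (N.neumann (N.dropNoise j η) r) := by
      rw [map_sub, N.noise_eq_dropNoise_add j η (N.neumann (N.dropNoise j η) r)]
      abel
    rw [← hy, hdec, map_add]
    refine (l2norm_add_le _ _).trans ?_
    have h1 := H.l2norm_green_noise_le hb hη (y - N.neumann (N.dropNoise j η) r)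
    have h2 := H.l2norm_green_le (N.sum_noise (N.localNoise j η) (N.neumann (N.dropNoise j η) r))
    have h3 := H.l2norm_noise_localNoise_le hb hη j (hy'A j) (hloo' j)
    have h4 := mul_le_mul_of_nonneg_left h3 (by positivity : 0 ≤ 2 / lam)
    have h5 := mul_le_mul_of_nonneg_left (hdA j) (by positivity : 0 ≤ 3 * (b * h / lam))
    have e : 2 / lam * (3 * (b * h) * A) = 6 * (b * h / lam) * A := by ring
    linarith

/-- The terms of the Neumann series decay geometrically in the supremum norm. -/
lemma norm_neumann_le [Nontrivial V] (hn : 1 ≤ Real.log (Fintype.card V)) (hb : 0 ≤ b)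
    (hη : N.IsBoundedNoise b η) {R : ℕ} (hloo : N.IsLeaveOneOutNoise h b R η)
    (h1 : ‖N.neumann η 1‖ ≤ 3 * (b * h / lam)) {r : ℕ} (hr : r < R) :
    ‖N.neumann η (r + 1)‖ ≤
      12 * (b * h / lam) * (21 * Real.log (Fintype.card V) * (b * h / lam)) ^ r := by
  have hl := H.lam_pos
  have hh := zero_le_one.trans H.one_le_h
  set τ := b * h / lam with hτ
  have hτ0 : 0 ≤ τ := by positivity
  set L := Real.log (Fintype.card V)
  have key : ∀ r < R, ∀ j,
      ‖N.neumann η (r + 1)‖ + l2norm (N.neumann η (r + 1) - N.neumann (N.dropNoise j η) (r + 1)) ≤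
        12 * τ * (21 * L * τ) ^ r := by
    intro r
    induction r with
    | zero =>
      intro hr j
      have h2 := (H.neumann_succ_bound hn hb hη hloo hr (A := 1) fun j => by
        rw [neumann_zero, neumann_zero, sub_self, l2norm_zero, add_zero, norm_one]).2 j
      rw [← hτ] at h2
      rw [zero_add] at h2 ⊢
      rw [pow_zero]
      linarith
    | succ r ih =>
      intro hr j
      obtain ⟨h2, h3⟩ := H.neumann_succ_bound hn hb hη hloo hr (ih (by omega))
      have h4 := h3 j
      rw [← hτ] at h2 h4
      set A := 12 * τ * (21 * L * τ) ^ r with hA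
      have hA0 : 0 ≤ τ * A := by positivity
      have e : 12 * τ * (21 * L * τ) ^ (r + 1) = 21 * L * (τ * A) := by rw [hA]; ring
      rw [e]
      nlinarith
  obtain ⟨j⟩ := (inferInstance : Nonempty V)
  linarith [key r hr j,
    l2norm_nonneg (N.neumann η (r + 1) - N.neumann (N.dropNoise j η) (r + 1))]

lemma eq_sum_neumann_add [Nonempty V] {v : V → ℝ} {a : ℝ} (hv : ∑ i, v i = 0)
    (hs : N.lap v = N.noise η (a • 1 + v)) (R : ℕ) :
    v = a • ∑ r ∈ Finset.range R, N.neumann η (r + 1) +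
      (fun u => N.green (N.noise η u))^[R] v := by
  have h1 : v = a • N.neumann η 1 + N.green (N.noise η v) := by
    conv_lhs => rw [← H.green_lap hv, hs]
    rw [map_add, map_smul, map_add, map_smul, neumann_succ, neumann_zero]
  have hlin : ∀ (R : ℕ) (x y : V → ℝ), (fun u => N.green (N.noise η u))^[R] (a • x + y) =
      a • (fun u => N.green (N.noise η u))^[R] x + (fun u => N.green (N.noise η u))^[R] y := by
    intro R
    induction R with
    | zero => intro x y; rfl
    | succ R ih =>
      intro x y
      simp only [Function.iterate_succ_apply, map_add, map_smul, ih]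
  induction R with
  | zero => simp
  | succ R ih =>
    conv_lhs => rw [ih]
    conv_lhs => enter [2]; rw [h1, hlin]
    rw [Finset.sum_range_succ, smul_add, add_assoc, Function.iterate_succ_apply]
    congr 2

lemma l2norm_iterate_le [Nonempty V] (hb : 0 ≤ b) (hη : N.IsBoundedNoise b η) (v : V → ℝ)
    (R : ℕ) : l2norm ((fun u => N.green (N.noise η u))^[R] v) ≤
      (3 * (b * h / lam)) ^ R * l2norm v := by
  have hl := H.lam_pos
  have hh := zero_le_one.trans H.one_le_h
  induction R with
  | zero => simp
  | succ R ih =>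
    rw [Function.iterate_succ_apply', pow_succ', mul_assoc]
    exact (H.l2norm_green_noise_le hb hη _).trans (mul_le_mul_of_nonneg_left ih (by positivity))

lemma l2norm_le_of_lap_eq_noise [Nonempty V] (hb : 0 ≤ b) (hη : N.IsBoundedNoise b η)
    (hτ : b * h / lam ≤ 1 / 4) {v : V → ℝ} {a : ℝ} (hv : ∑ i, v i = 0)
    (hs : N.lap v = N.noise η (a • 1 + v)) :
    l2norm v ≤ 4 * (|a| * l2norm (N.neumann η 1)) := by
  have h1 := H.eq_sum_neumann_add hv hs 1
  have h2 := H.l2norm_iterate_le hb hη v 1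
  rw [Finset.sum_range_one, zero_add] at h1
  have h3 : l2norm v ≤ |a| * l2norm (N.neumann η 1) + 3 * (b * h / lam) * l2norm v := by
    conv_lhs => rw [h1]
    refine (l2norm_add_le _ _).trans ?_
    rw [l2norm_smul]
    rw [pow_one] at h2
    linarith
  nlinarith [l2norm_nonneg v]

/-- The supremum norm of the fluctuation of a solution of the noisy Poisson equation. -/
lemma norm_le_of_lap_eq_noise [Nontrivial V] (hn : 1 ≤ Real.log (Fintype.card V)) (hb : 0 ≤ b)
    (hη : N.IsBoundedNoise b η) {R : ℕ} (hloo : N.IsLeaveOneOutNoise h b R η)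
    (h1 : ‖N.neumann η 1‖ ≤ 3 * (b * h / lam)) (hτ : b * h / lam ≤ 1 / 4) {v : V → ℝ} {a : ℝ}
    (hv : ∑ i, v i = 0) (hs : N.lap v = N.noise η (a • 1 + v)) :
    ‖v‖ ≤ |a| * (12 * (b * h / lam)) *
      (∑ r ∈ Finset.range R, (21 * Real.log (Fintype.card V) * (b * h / lam)) ^ r +
        √(Fintype.card V) * (3 * (b * h / lam)) ^ R) := by
  have hl := H.lam_pos
  have hh := zero_le_one.trans H.one_le_h
  set τ := b * h / lam with hτdef
  have hτ0 : 0 ≤ τ := by positivity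
  have hl2 : l2norm v ≤ 4 * (|a| * (√(Fintype.card V) * (3 * τ))) := by
    refine (H.l2norm_le_of_lap_eq_noise hb hη hτ hv hs).trans ?_
    have := (l2norm_le_sqrt_card_mul (N.neumann η 1)).trans
      (mul_le_mul_of_nonneg_left h1 (Real.sqrt_nonneg _))
    gcongr
  have h2 := H.l2norm_iterate_le hb hη v R
  have h3 : ‖∑ r ∈ Finset.range R, N.neumann η (r + 1)‖ ≤
      12 * τ * ∑ r ∈ Finset.range R, (21 * Real.log (Fintype.card V) * τ) ^ r := by
    rw [Finset.mul_sum]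
    exact (norm_sum_le _ _).trans (Finset.sum_le_sum fun r hr =>
      H.norm_neumann_le hn hb hη hloo h1 (Finset.mem_range.1 hr))
  have h4 : (3 * τ) ^ R * l2norm v ≤
      (3 * τ) ^ R * (4 * (|a| * (√(Fintype.card V) * (3 * τ)))) :=
    mul_le_mul_of_nonneg_left hl2 (by positivity)
  have h5 := mul_le_mul_of_nonneg_left h3 (abs_nonneg a)
  calc ‖v‖ = ‖a • ∑ r ∈ Finset.range R, N.neumann η (r + 1) +
        (fun u => N.green (N.noise η u))^[R] v‖ := by rw [← H.eq_sum_neumann_add hv hs R]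
    _ ≤ |a| * ‖∑ r ∈ Finset.range R, N.neumann η (r + 1)‖ +
        l2norm ((fun u => N.green (N.noise η u))^[R] v) := by
        refine (norm_add_le _ _).trans (add_le_add ?_ (norm_le_l2norm _))
        rw [norm_smul, Real.norm_eq_abs]
    _ ≤ _ := by linarith

end IsBounded

end ComparisonNetwork

namespace ComparisonNetwork

variable {V ι : Type*} [Fintype V] [DecidableEq V] [Fintype ι] [DecidableEq ι]
  (N : ComparisonNetwork V ι)

/-! ### Probability bounds for the noise -/

/-- The symmetric dilation of the contribution of a comparison to the antisymmetric noise. -/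
def dilation (c : ι) : Matrix (V ⊕ V) (V ⊕ V) ℝ :=
  N.weight c • Matrix.fromBlocks 0 (single (N.tgt c) (N.src c) 1 - single (N.src c) (N.tgt c) 1)
    (single (N.src c) (N.tgt c) 1 - single (N.tgt c) (N.src c) 1) 0

omit [Fintype V] [Fintype ι] [DecidableEq ι] in
lemma dilation_transpose (c : ι) : (N.dilation c)ᵀ = N.dilation c := by
  rw [dilation, transpose_smul, fromBlocks_transpose]
  simp [transpose_sub]

omit [Fintype V] [DecidableEq ι] in
lemma bernoulliMatrix_dilation (p : ι → ℝ) (z : ι → Bool) :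
    bernoulliMatrix p N.dilation z =
      fromBlocks 0 (N.skewNoise (centered p z)) (-N.skewNoise (centered p z)) 0 := by
  ext i j
  simp only [bernoulliMatrix, dilation, skewNoise, Matrix.sum_apply, smul_smul, Matrix.smul_apply]
  rcases i with i | i <;> rcases j with j | j <;>
    simp [Matrix.sum_apply, ← Finset.sum_neg_distrib]
  refine Finset.sum_congr rfl fun c _ => ?_
  ring

omit [DecidableEq ι] in
lemma sum_dilation_sq : ∑ c, N.dilation c ^ 2 =
    diagonal (Sum.elim (fun i => ∑ c ∈ N.incident i, N.weight c ^ 2)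
      (fun i => ∑ c ∈ N.incident i, N.weight c ^ 2)) := by
  have hsq : ∀ c, N.dilation c ^ 2 = diagonal (Sum.elim
      (fun i => if N.src c = i ∨ N.tgt c = i then N.weight c ^ 2 else 0)
      (fun i => if N.src c = i ∨ N.tgt c = i then N.weight c ^ 2 else 0)) := by
    intro c
    have hne := N.src_ne_tgt c
    have hd : ∀ i j : V, N.weight c * N.weight c *
        (single (N.tgt c) (N.tgt c) (1 : ℝ) + single (N.src c) (N.src c) 1 : Matrix V V ℝ) i j =
        if i = j then (if N.src c = i ∨ N.tgt c = i then N.weight c ^ 2 else 0) else 0 := by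
      intro i j
      simp only [Matrix.add_apply, single_apply]
      by_cases hij : i = j
      · subst hij
        by_cases h1 : N.src c = i
        · subst h1; simp [hne.symm]; ring
        · by_cases h2 : N.tgt c = i
          · subst h2; simp [h1]; ring
          · simp [h1, h2]
      · have h1 : ¬ (N.tgt c = i ∧ N.tgt c = j) := fun h => hij (h.1.symm.trans h.2)
        have h2 : ¬ (N.src c = i ∧ N.src c = j) := fun h => hij (h.1.symm.trans h.2)
        simp [hij, h1, h2]
    have hJ : (single (N.tgt c) (N.src c) (1 : ℝ) - single (N.src c) (N.tgt c) 1 : Matrix V V ℝ) *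
        (single (N.src c) (N.tgt c) 1 - single (N.tgt c) (N.src c) 1) =
        single (N.tgt c) (N.tgt c) 1 + single (N.src c) (N.src c) 1 := by
      simp [Matrix.mul_sub, Matrix.sub_mul, hne, hne.symm]
    have hJ' : (single (N.src c) (N.tgt c) (1 : ℝ) - single (N.tgt c) (N.src c) 1 : Matrix V V ℝ) *
        (single (N.tgt c) (N.src c) 1 - single (N.src c) (N.tgt c) 1) =
        single (N.tgt c) (N.tgt c) 1 + single (N.src c) (N.src c) 1 := by
      simp [Matrix.mul_sub, Matrix.sub_mul, hne, hne.symm, add_comm]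
    rw [pow_two, dilation, smul_mul_smul_comm, fromBlocks_multiply]
    simp only [Matrix.zero_mul, Matrix.mul_zero, zero_add, add_zero, hJ, hJ']
    ext i j
    rcases i with i | i <;> rcases j with j | j
    · simp only [Matrix.smul_apply, fromBlocks_apply₁₁, smul_eq_mul, hd, diagonal_apply,
        Sum.inl.injEq, Sum.elim_inl]
    · simp
    · simp
    · simp only [Matrix.smul_apply, fromBlocks_apply₂₂, smul_eq_mul, hd, diagonal_apply,
        Sum.inr.injEq, Sum.elim_inr]
  simp only [hsq]
  ext i j
  rw [Matrix.sum_apply]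
  by_cases hij : i = j
  · subst hij
    rcases i with i | i <;> simp [incident, Finset.sum_filter]
  · simp [hij]

namespace IsBounded

variable {N} {h κ D lam : ℝ} (H : N.IsBounded h κ D lam) {b : ℝ}
include H

omit [DecidableEq ι] in
lemma sq_weight_le (c : ι) : N.weight c ^ 2 ≤ κ * N.weight c := by
  rw [pow_two]
  exact mul_le_mul_of_nonneg_right (H.weight_le c) (N.weight_nonneg c)

omit [DecidableEq ι] in
lemma sum_sq_weight_le (hκ : 0 ≤ κ) (i : V) : ∑ c ∈ N.incident i, N.weight c ^ 2 ≤ κ * D := by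
  refine (Finset.sum_le_sum fun c _ => H.sq_weight_le c).trans ?_
  rw [← Finset.mul_sum]
  exact mul_le_mul_of_nonneg_left (H.degree_le i) hκ

lemma bernoulliProb_skewNoise_le [Nontrivial V] (hκ : 0 ≤ κ) (hb : 0 < b) {q : ℕ} (hq : q ≠ 0) :
    bernoulliProb N.winProb
      (fun z => ¬ ∀ u, l2norm (N.skewNoise (centered N.winProb z) *ᵥ u) ≤ b * l2norm u) ≤
      2 * Fintype.card V * (q * (κ * D) / b ^ 2) ^ q := by
  have hD := H.degree_pos
  have hX : ∀ z, (bernoulliMatrix N.winProb N.dilation z)ᵀ =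
      bernoulliMatrix N.winProb N.dilation z := bernoulliMatrix_transpose N.dilation_transpose
  have hm := bernoulliExp_trace_pow_le H.winProb_mem N.dilation_transpose
    (by positivity : 0 ≤ κ * D) N.sum_dilation_sq
    (by rintro (i | i) <;> exact H.sum_sq_weight_le hκ i) (le_refl q)
  have hcard : (Fintype.card (V ⊕ V) : ℝ) = 2 * Fintype.card V := by
    rw [Fintype.card_sum]; push_cast; ring
  rw [hcard] at hm
  refine (bernoulliProb_le_of_le H.winProb_mem (pow_pos hb (2 * q)) (fun z => ?_)
    fun z hz => ?_).trans ((div_le_div_of_nonneg_right hm (by positivity)).trans (le_of_eq ?_))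
  · rw [trace]
    exact Finset.sum_nonneg fun i _ => pow_diag_nonneg (hX z) (even_two_mul q) i
  · by_contra hlt
    refine hz fun u => ?_
    have h1 := mulVec_dotProduct_self_le (hX z) hq (not_le.1 hlt).le (Sum.elim 0 u)
    rw [bernoulliMatrix_dilation, fromBlocks_mulVec] at h1
    simp only [zero_mulVec, mulVec_zero, zero_add, add_zero, Sum.elim_comp_inl, Sum.elim_comp_inr]
      at h1
    rw [sumElim_dotProduct_sumElim, sumElim_dotProduct_sumElim, zero_dotProduct,
      add_zero, zero_add, ← l2norm_sq_eq_dotProduct u] at h1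
    refine l2norm_le_of_sq_le (mul_nonneg hb.le (l2norm_nonneg u)) ?_
    rwa [mul_pow]
  · rw [pow_mul b, div_pow, mul_div_assoc]

lemma bernoulliProb_netNoise_le [Nontrivial V] (hκ : 0 ≤ κ) {x : ℝ} (hx : 0 ≤ x)
    (hb : b = 2 * (x * √(κ * D))) (j : V) :
    bernoulliProb N.winProb (fun z => b / 2 < |N.netNoise (centered N.winProb z) j|) ≤
      2 * Real.exp (-(2 * x ^ 2)) := by
  simp only [netNoise_apply]
  refine bernoulliProb_abs_sum_gt_le H.winProb_mem (N.incident j)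
    (fun _ c => N.weight c * (if N.tgt c = j then 1 else -1)) (fun _ _ _ _ => rfl) hx
    (fun _ => b / 2) fun z => ?_
  rw [hb, mul_div_cancel_left₀ _ two_ne_zero]
  refine mul_le_mul_of_nonneg_left (Real.sqrt_le_sqrt ?_) hx
  refine le_trans (le_of_eq (Finset.sum_congr rfl fun c _ => ?_)) (H.sum_sq_weight_le hκ j)
  split_ifs <;> ring

lemma bernoulliProb_leaveOneOut_le [Nontrivial V] (hκ : 0 ≤ κ) {x : ℝ} (hx : 0 ≤ x)
    (hb : b = 2 * (x * √(κ * D))) (j : V) (r : ℕ) :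
    bernoulliProb N.winProb (fun z => b / 2 *
      (h * ‖N.neumann (N.dropNoise j (centered N.winProb z)) r‖) <
      |(N.skewNoise (centered N.winProb z) *ᵥ
        (N.score * N.neumann (N.dropNoise j (centered N.winProb z)) r)) j|) ≤
      2 * Real.exp (-(2 * x ^ 2)) := by
  have hh := zero_le_one.trans H.one_le_h
  have hdrop : ∀ c ∈ N.incident j, ∀ (z : ι → Bool) (b : Bool),
      N.dropNoise j (centered N.winProb (Function.update z c b)) =
        N.dropNoise j (centered N.winProb z) := by
    intro c hc z b
    ext c'
    simp only [dropNoise]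
    split_ifs with h'
    · rfl
    · have : c' ≠ c := by
        rintro rfl
        exact h' (by simpa [incident] using hc)
      simp [centered, this]
  simp only [skewNoise_mulVec_apply]
  refine bernoulliProb_abs_sum_gt_le H.winProb_mem (N.incident j)
    (fun z c => N.weight c * (if N.tgt c = j then
      (N.score * N.neumann (N.dropNoise j (centered N.winProb z)) r) (N.src c) else
      -(N.score * N.neumann (N.dropNoise j (centered N.winProb z)) r) (N.tgt c)))
    (fun c hc z b => by simp only [hdrop c hc z b]) hx
    (fun z => b / 2 * (h * ‖N.neumann (N.dropNoise j (centered N.winProb z)) r‖)) fun z => ?_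
  set y := N.neumann (N.dropNoise j (centered N.winProb z)) r
  have hcoord : ∀ i, (N.score * y) i ^ 2 ≤ (h * ‖y‖) ^ 2 := fun i => by
    rw [sq_le_sq, Pi.mul_apply, abs_mul, abs_of_nonneg (by positivity : 0 ≤ h * ‖y‖)]
    exact mul_le_mul (H.abs_score_le i) (norm_le_pi_norm y i) (abs_nonneg _) hh
  rw [hb, mul_div_cancel_left₀ _ two_ne_zero, mul_assoc]
  refine mul_le_mul_of_nonneg_left ?_ hx
  rw [← Real.sqrt_sq (by positivity : 0 ≤ h * ‖y‖), ← Real.sqrt_mul' _ (sq_nonneg _)]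
  refine Real.sqrt_le_sqrt ?_
  refine le_trans ?_ (mul_le_mul_of_nonneg_right (H.sum_sq_weight_le hκ j) (sq_nonneg _))
  rw [Finset.sum_mul]
  refine Finset.sum_le_sum fun c _ => ?_
  rw [mul_pow]
  refine mul_le_mul_of_nonneg_left ?_ (sq_nonneg _)
  split_ifs
  · exact hcoord _
  · rw [neg_sq]; exact hcoord _

lemma bernoulliProb_neumann_one_le [Nontrivial V] (hκ : 0 ≤ κ) {x : ℝ} (hx : 0 ≤ x)
    (hb : b = 2 * (x * √(κ * D))) (i : V) :
    bernoulliProb N.winProb (fun z => 3 * (b * h / lam) <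
      |N.neumann (centered N.winProb z) 1 i|) ≤ 2 * Real.exp (-(2 * x ^ 2)) := by
  have hh := zero_le_one.trans H.one_le_h
  have hl := H.lam_pos
  have hD := H.degree_pos
  have e : ∀ z, N.neumann (centered N.winProb z) 1 i = ∑ c, centered N.winProb z c *
      (N.weight c * (N.score (N.src c) + N.score (N.tgt c)) *
        (N.greenRow i (N.tgt c) - N.greenRow i (N.src c))) := by
    intro z
    rw [neumann_succ, neumann_zero, ← H.greenRow_dotProduct i (N.sum_noise _ _), dotProduct_noise]
    simp
  simp only [e]
  refine bernoulliProb_abs_sum_gt_le H.winProb_mem Finset.univ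
    (fun _ c => N.weight c * (N.score (N.src c) + N.score (N.tgt c)) *
        (N.greenRow i (N.tgt c) - N.greenRow i (N.src c))) (fun _ _ _ _ => rfl) hx
    (fun _ => 3 * (b * h / lam)) fun z => ?_
  have hsum : ∑ c, (N.weight c * (N.score (N.src c) + N.score (N.tgt c)) *
      (N.greenRow i (N.tgt c) - N.greenRow i (N.src c))) ^ 2 ≤ κ * (2 * h) ^ 2 * (4 / lam) := by
    refine le_trans ?_ (mul_le_mul_of_nonneg_left (H.energy_greenRow_le i) (by positivity))
    rw [Finset.mul_sum]
    refine Finset.sum_le_sum fun c _ => ?_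
    rw [mul_pow, mul_pow, ← mul_assoc]
    refine mul_le_mul_of_nonneg_right ?_ (sq_nonneg _)
    have h1 := H.sq_weight_le c
    have h2 : (N.score (N.src c) + N.score (N.tgt c)) ^ 2 ≤ (2 * h) ^ 2 :=
      pow_le_pow_left₀ (add_nonneg (H.score_pos _).le (H.score_pos _).le)
        (by linarith [H.score_le (N.src c), H.score_le (N.tgt c)]) 2
    calc _ ≤ κ * N.weight c * (2 * h) ^ 2 :=
          mul_le_mul h1 h2 (sq_nonneg _) (mul_nonneg hκ (N.weight_nonneg c))
      _ = _ := by ring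
  have hbound : κ * (2 * h) ^ 2 * (4 / lam) ≤ (6 * (√(κ * D) * h / lam)) ^ 2 := by
    rw [mul_pow 6, div_pow, mul_pow √(κ * D), Real.sq_sqrt (by positivity)]
    have : κ * (2 * h) ^ 2 * (4 / lam) = κ * h ^ 2 / lam ^ 2 * (16 * lam) := by
      field_simp; ring
    rw [this, show (6 : ℝ) ^ 2 * (κ * D * h ^ 2 / lam ^ 2) = κ * h ^ 2 / lam ^ 2 * (36 * D) by ring]
    exact mul_le_mul_of_nonneg_left (by linarith [H.lam_le]) (by positivity)
  calc _ ≤ x * √((6 * (√(κ * D) * h / lam)) ^ 2) :=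
        mul_le_mul_of_nonneg_left (Real.sqrt_le_sqrt (hsum.trans hbound)) hx
    _ = 3 * (b * h / lam) := by
        rw [Real.sqrt_sq (by positivity), hb]; ring

end IsBounded

/-- The noise satisfies all bounds that the analysis of the stationary distribution needs. -/
structure IsGoodNoise (h lam b : ℝ) (R : ℕ) (η : ι → ℝ) : Prop where
  bounded : N.IsBoundedNoise b η
  leaveOneOut : N.IsLeaveOneOutNoise h b R η
  neumann_one : ‖N.neumann η 1‖ ≤ 3 * (b * h / lam)

namespace IsBounded

variable {N} {h κ D lam : ℝ} (H : N.IsBounded h κ D lam) {b : ℝ}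
include H

lemma bernoulliProb_not_isGoodNoise_le [Nontrivial V] (hκ : 0 < κ) {x : ℝ} (hx : 0 < x)
    (hb : b = 2 * (x * √(κ * D))) (R : ℕ) {q : ℕ} (hq : q ≠ 0) :
    bernoulliProb N.winProb (fun z => ¬ N.IsGoodNoise h lam b R (centered N.winProb z)) ≤
      2 * Fintype.card V * (q / (4 * x ^ 2)) ^ q +
        2 * (Fintype.card V * (R + 2)) * Real.exp (-(2 * x ^ 2)) := by
  have hD := H.degree_pos
  have hl := H.lam_pos
  have hh := zero_le_one.trans H.one_le_h
  have hb0 : 0 < b := by rw [hb]; positivity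
  have hp := H.winProb_mem
  have hq' : q * (κ * D) / b ^ 2 = q / (4 * x ^ 2) := by
    rw [hb, mul_pow, mul_pow, Real.sq_sqrt (by positivity)]
    field_simp
    norm_num
  have p1 := H.bernoulliProb_skewNoise_le hκ.le hb0 hq
  rw [hq'] at p1
  have p2 := (bernoulliProb_exists_le hp Finset.univ
    (fun j z => b / 2 < |N.netNoise (centered N.winProb z) j|)).trans
    (Finset.sum_le_sum fun j _ => H.bernoulliProb_netNoise_le hκ.le hx.le hb j)
  have p3 := (bernoulliProb_exists_le hp (Finset.univ ×ˢ Finset.range R)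
    (fun (y : V × ℕ) z => b / 2 *
      (h * ‖N.neumann (N.dropNoise y.1 (centered N.winProb z)) y.2‖) <
      |(N.skewNoise (centered N.winProb z) *ᵥ
        (N.score * N.neumann (N.dropNoise y.1 (centered N.winProb z)) y.2)) y.1|)).trans
    (Finset.sum_le_sum fun y _ => H.bernoulliProb_leaveOneOut_le hκ.le hx.le hb y.1 y.2)
  have p4 := (bernoulliProb_exists_le hp Finset.univ
    (fun i z => 3 * (b * h / lam) < |N.neumann (centered N.winProb z) 1 i|)).trans
    (Finset.sum_le_sum fun j _ => H.bernoulliProb_neumann_one_le hκ.le hx.le hb j)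
  simp only [Finset.sum_const, Finset.card_univ, Finset.card_product, Finset.card_range,
    nsmul_eq_mul] at p2 p3 p4
  refine (bernoulliProb_mono hp fun z hz => ?_).trans ((bernoulliProb_or_le hp _ _).trans
    (add_le_add p1 ((bernoulliProb_or_le hp _ _).trans (add_le_add p2
      ((bernoulliProb_or_le hp _ _).trans (add_le_add p3 p4)))))) |>.trans (le_of_eq ?_)
  · by_contra hcon
    push Not at hcon
    obtain ⟨h1, h2, h3, h4⟩ := hcon
    refine hz ⟨⟨h1, fun j => h2 j (Finset.mem_univ j)⟩, fun j r hr => ?_, ?_⟩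
    · exact h3 (j, r) (by simpa using hr)
    · exact (pi_norm_le_iff_of_nonneg (by positivity)).2 fun i => h4 i (Finset.mem_univ i)
  · push_cast
    ring

end IsBounded

end ComparisonNetwork

/-! ### The truncation of the Neumann series -/

lemma exists_truncation_order : ∃ n₀ : ℕ, ∀ n : ℕ, n₀ ≤ n → 1 ≤ Real.log n ∧ ∃ R : ℕ,
    3 ≤ R ∧ R ≤ n ∧ R * (6 * Real.log n) ^ R * Real.log n ^ 3 ≤ √n ∧
      (3 / 4 : ℝ) ^ R * Real.log n ^ 3 ≤ 1 := by
  have h1 : Filter.Tendsto (fun n : ℕ => Real.log n) Filter.atTop Filter.atTop :=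
    Real.tendsto_log_atTop.comp tendsto_natCast_atTop_atTop
  have h2 : Filter.Tendsto (fun n : ℕ => Real.log (Real.log n)) Filter.atTop Filter.atTop :=
    Real.tendsto_log_atTop.comp h1
  have h3 : ∀ᶠ l : ℝ in Filter.atTop, 67 * l ^ 2 ≤ Real.exp l / 2 := by
    have := (Real.isLittleO_pow_exp_atTop (n := 2)).bound (by norm_num : (0 : ℝ) < 1 / 134)
    filter_upwards [this] with l hl
    rw [Real.norm_of_nonneg (by positivity), Real.norm_of_nonneg (Real.exp_pos l).le] at hl
    linarith
  obtain ⟨n₀, hn₀⟩ := Filter.eventually_atTop.1 ((h1.eventually_ge_atTop 1).and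
    ((h2.eventually_ge_atTop 1).and (h2.eventually h3)))
  refine ⟨max n₀ 1, fun n hn => ?_⟩
  obtain ⟨hL, hl, hbig⟩ := hn₀ n (le_of_max_le_left hn)
  have hn1 : (1 : ℝ) ≤ n := by exact_mod_cast le_of_max_le_right hn
  refine ⟨hL, ?_⟩
  set L := Real.log n with hLdef
  set l := Real.log L with hldef
  have hLpos : 0 < L := by linarith
  have hexpl : Real.exp l = L := Real.exp_log hLpos
  have hexpL : Real.exp L = n := Real.exp_log (by linarith)
  rw [hexpl] at hbig
  set R := ⌈12 * l⌉₊ + 3 with hR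
  have hRle : (R : ℝ) ≤ 12 * l + 4 := by
    have := Nat.ceil_lt_add_one (by positivity : 0 ≤ 12 * l)
    rw [hR]; push_cast; linarith
  have hRge : 12 * l ≤ R := by
    have := Nat.le_ceil (12 * l)
    rw [hR]; push_cast; linarith
  refine ⟨R, by omega, ?_, ?_, ?_⟩
  · have : (R : ℝ) ≤ n := by
      rw [← hexpL]
      nlinarith [Real.add_one_le_exp L]
    exact_mod_cast this
  · have hsix : 6 * L ≤ Real.exp (l + 2) := by
      rw [Real.exp_add, hexpl, mul_comm]
      refine mul_le_mul_of_nonneg_left ?_ hLpos.le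
      have h := Real.quadratic_le_exp_of_nonneg (by norm_num : (0 : ℝ) ≤ 1)
      have h25 : (5 / 2 : ℝ) ≤ Real.exp 1 := by linarith
      calc (6 : ℝ) ≤ (5 / 2) * (5 / 2) := by norm_num
        _ ≤ Real.exp 1 * Real.exp 1 := by gcongr
        _ = Real.exp 2 := by rw [← Real.exp_add]; norm_num
    have hRexp : (R : ℝ) ≤ Real.exp R := by linarith [Real.add_one_le_exp (R : ℝ)]
    calc R * (6 * L) ^ R * L ^ 3
        ≤ Real.exp R * Real.exp (l + 2) ^ R * Real.exp l ^ 3 := by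
          rw [hexpl]
          gcongr
      _ = Real.exp (R + R * (l + 2) + 3 * l) := by
          rw [← Real.exp_nat_mul, ← Real.exp_nat_mul, ← Real.exp_add, ← Real.exp_add]
          norm_num
      _ ≤ Real.exp (L / 2) := by
          rw [Real.exp_le_exp]
          nlinarith
      _ = √n := by rw [Real.exp_half, hexpL]
  · calc (3 / 4 : ℝ) ^ R * L ^ 3 ≤ Real.exp (-(1 / 4)) ^ R * Real.exp l ^ 3 := by
          rw [hexpl]
          have := Real.one_sub_le_exp_neg (1 / 4)
          gcongr
          linarith
      _ = Real.exp (-(R / 4) + 3 * l) := by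
          rw [← Real.exp_nat_mul, ← Real.exp_nat_mul, ← Real.exp_add]
          congr 1
          push_cast
          ring
      _ ≤ 1 := by
          rw [Real.exp_le_one_iff]
          linarith

lemma neumann_sum_le {n R : ℕ} {L τ : ℝ} (hL : 1 ≤ L) (hR : 3 ≤ R)
    (h1 : R * (6 * L) ^ R * L ^ 3 ≤ √n) (h2 : (3 / 4 : ℝ) ^ R * L ^ 3 ≤ 1) (hτ : 0 ≤ τ)
    (hτ4 : τ ≤ 1 / 4) :
    ∑ r ∈ Finset.range R, (21 * L * τ) ^ r + √n * (3 * τ) ^ R ≤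
      3600 * (1 + √n * (τ ^ 2 / L)) := by
  have hL0 : 0 < L := by linarith
  have hs : 0 ≤ √(n : ℝ) := Real.sqrt_nonneg _
  rcases le_total (21 * L * τ) (1 / 2) with hc | hc
  · have hsum : ∑ r ∈ Finset.range R, (21 * L * τ) ^ r ≤ 2 := by
      calc _ ≤ ∑ r ∈ Finset.range R, (1 / 2 : ℝ) ^ r :=
            Finset.sum_le_sum fun r _ => pow_le_pow_left₀ (by positivity) hc r
        _ ≤ 2 := sum_geometric_two_le R
    have hpow : (3 * τ) ^ R ≤ τ ^ 2 / L := by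
      calc (3 * τ) ^ R ≤ (3 * τ) ^ 3 :=
            pow_le_pow_of_le_one (by positivity) (by linarith) hR
        _ ≤ τ ^ 2 / L := by
            rw [le_div_iff₀ hL0]
            nlinarith [mul_le_mul_of_nonneg_left hc (sq_nonneg τ)]
    have := mul_le_mul_of_nonneg_left hpow hs
    have h0 : 0 ≤ √(n : ℝ) * (τ ^ 2 / L) := by positivity
    linarith
  · have hτL : 1 / (1764 * L ^ 3) ≤ τ ^ 2 / L := by
      rw [div_le_div_iff₀ (by positivity) hL0]
      nlinarith [pow_le_pow_left₀ (by norm_num) hc 2]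
    have hsum : ∑ r ∈ Finset.range R, (21 * L * τ) ^ r ≤ √n / L ^ 3 := by
      rw [le_div_iff₀ (by positivity)]
      refine le_trans (mul_le_mul_of_nonneg_right ?_ (by positivity)) h1
      calc _ ≤ ∑ _r ∈ Finset.range R, (6 * L) ^ R := by
            refine Finset.sum_le_sum fun r hr => ?_
            calc (21 * L * τ) ^ r ≤ (6 * L) ^ r :=
                  pow_le_pow_left₀ (by positivity) (by nlinarith) r
              _ ≤ (6 * L) ^ R := pow_le_pow_right₀ (by linarith) (Finset.mem_range.1 hr).le
        _ = R * (6 * L) ^ R := by simp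
    have hpow : (3 * τ) ^ R ≤ 1 / L ^ 3 := by
      rw [le_div_iff₀ (by positivity)]
      refine le_trans (mul_le_mul_of_nonneg_right ?_ (by positivity)) h2
      exact pow_le_pow_left₀ (by positivity) (by linarith) R
    have h3 := mul_le_mul_of_nonneg_left hpow hs
    have h4 := mul_le_mul_of_nonneg_left hτL hs
    have e1 : √(n : ℝ) * (1 / L ^ 3) = √n / L ^ 3 := by ring
    have e2 : √(n : ℝ) * (1 / (1764 * L ^ 3)) = √n / L ^ 3 / 1764 := by field_simp
    rw [e1] at h3
    rw [e2] at h4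
    have h0 : 0 ≤ √(n : ℝ) * (τ ^ 2 / L) := by positivity
    linarith

lemma failure_prob_le {n R : ℕ} (hn : 1 ≤ n) (hL : 1 ≤ Real.log n) (hR : R ≤ n) {x : ℝ}
    (hx : x ^ 2 = 5 * Real.log n) :
    2 * n * (⌈6 * Real.log n⌉₊ / (4 * x ^ 2)) ^ ⌈6 * Real.log n⌉₊ +
      2 * (n * (R + 2)) * Real.exp (-(2 * x ^ 2)) ≤ 8 / (n : ℝ) ^ 5 := by
  set L := Real.log n
  have hn0 : (0 : ℝ) < n := by exact_mod_cast hn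
  have hn1 : (1 : ℝ) ≤ n := by exact_mod_cast hn
  have hexpL : Real.exp L = n := Real.exp_log hn0
  have hq1 : 6 * L ≤ ⌈6 * L⌉₊ := Nat.le_ceil _
  have hq2 : (⌈6 * L⌉₊ : ℝ) ≤ 7 * L := by
    linarith [Nat.ceil_lt_add_one (by positivity : 0 ≤ 6 * L)]
  have hexp : ∀ m : ℕ, Real.exp (-(m * L)) = 1 / (n : ℝ) ^ m := fun m => by
    rw [Real.exp_neg, Real.exp_nat_mul, hexpL, one_div]
  have h1 : (⌈6 * L⌉₊ / (4 * x ^ 2)) ^ ⌈6 * L⌉₊ ≤ 1 / (n : ℝ) ^ 6 := by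
    have hbase : ⌈6 * L⌉₊ / (4 * x ^ 2) ≤ Real.exp (-1) := by
      rw [hx, Real.exp_neg, div_le_iff₀ (by positivity)]
      have : (20 / 7 : ℝ)⁻¹ ≤ (Real.exp 1)⁻¹ :=
        inv_anti₀ (Real.exp_pos 1) (by linarith [Real.exp_one_lt_d9])
      nlinarith
    calc _ ≤ Real.exp (-1) ^ ⌈6 * L⌉₊ := pow_le_pow_left₀ (by positivity) hbase _
      _ = Real.exp (-⌈6 * L⌉₊) := by rw [← Real.exp_nat_mul]; congr 1; ring
      _ ≤ Real.exp (-((6 : ℕ) * L)) := by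
          rw [Real.exp_le_exp]; push_cast; linarith
      _ = _ := hexp 6
  have h2 : Real.exp (-(2 * x ^ 2)) = 1 / (n : ℝ) ^ 10 := by
    rw [← hexp 10, hx]; congr 1; push_cast; ring
  have hR' : (R : ℝ) ≤ n := by exact_mod_cast hR
  have h3 : 2 * (n * ((R : ℝ) + 2)) ≤ 6 * n ^ 5 := by
    have : (n : ℝ) ^ 2 ≤ n ^ 5 := pow_le_pow_right₀ hn1 (by norm_num)
    nlinarith
  rw [h2]
  calc _ ≤ 2 * (n : ℝ) * (1 / n ^ 6) + 6 * n ^ 5 * (1 / n ^ 10) :=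
        add_le_add (mul_le_mul_of_nonneg_left h1 (by positivity))
          (mul_le_mul_of_nonneg_right h3 (by positivity))
    _ = _ := by field_simp; norm_num

/-! ### The law of a finite family of independent Bernoulli variables -/

lemma measureReal_eq_bernoulliProb {ι Ω : Type*} [Fintype ι] [DecidableEq ι] [MeasurableSpace Ω]
    {P : Measure Ω} [IsProbabilityMeasure P] {p : ι → ℝ} (hp : ∀ c, p c ∈ Set.Icc (0 : ℝ) 1)
    {Z : ι → Ω → Bool} (hZ : ∀ c, Measurable (Z c))
    (hlaw : ∀ c, P {ω | Z c ω = true} = ENNReal.ofReal (p c)) (hind : iIndepFun Z P)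
    (S : (ι → Bool) → Prop) :
    P.real {ω | S fun c => Z c ω} = bernoulliProb p S := by
  classical
  have hsingle : ∀ z : ι → Bool, P.real {ω | (fun c => Z c ω) = z} = bernoulliMass p z := by
    intro z
    have e : {ω | (fun c => Z c ω) = z} = ⋂ c ∈ (Finset.univ : Finset ι), Z c ⁻¹' {z c} := by
      ext ω
      simp [funext_iff]
    rw [measureReal_def, e, hind.measure_inter_preimage_eq_mul Finset.univ
      (fun c _ => measurableSet_singleton (z c)), ENNReal.toReal_prod, bernoulliMass]
    refine Finset.prod_congr rfl fun c _ => ?_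
    have htrue : P (Z c ⁻¹' {true}) = ENNReal.ofReal (p c) := hlaw c
    by_cases hz : z c = true
    · rw [hz, htrue, ENNReal.toReal_ofReal (hp c).1]
      simp
    · have hz' : z c = false := by simpa using hz
      have hcompl : Z c ⁻¹' {false} = (Z c ⁻¹' {true})ᶜ := by
        ext ω; simp
      rw [hz', hcompl, ← measureReal_def,
        probReal_compl_eq_one_sub (hZ c (measurableSet_singleton true)), measureReal_def, htrue,
        ENNReal.toReal_ofReal (hp c).1]
      simp
  have hunion : {ω | S fun c => Z c ω} =
      ⋃ z ∈ (Finset.univ.filter S : Finset (ι → Bool)), {ω | (fun c => Z c ω) = z} := by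
    ext ω
    simp
  rw [hunion, measureReal_biUnion_finset]
  · rw [bernoulliProb, bernoulliExp, Finset.sum_filter]
    refine Finset.sum_congr rfl fun z _ => ?_
    rw [hsingle]
    split_ifs <;> simp
  · intro z _ z' _ hzz
    refine Set.disjoint_left.2 fun ω h1 h2 => hzz ?_
    exact h1.symm.trans h2
  · intro z _
    have e : {ω | (fun c => Z c ω) = z} = (fun ω c => Z c ω) ⁻¹' {z} := rfl
    rw [e]
    exact (measurable_pi_lambda _ hZ) (measurableSet_singleton z)

/-! ### Stationary distributions of stochastic matrices -/

lemma exists_isStationary {n : ℕ} [NeZero n] {M : Matrix (Fin n) (Fin n) ℝ}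
    (hM : ∀ i j, 0 ≤ M i j) (hrow : ∀ i, ∑ j, M i j = 1) : ∃ μ, IsStationary M μ := by
  have hker : (1 - M) *ᵥ (1 : Fin n → ℝ) = 0 := by
    rw [Matrix.sub_mulVec, Matrix.one_mulVec, sub_eq_zero]
    ext i
    simp [Matrix.mulVec, dotProduct, hrow]
  have hdet : (1 - M).det = 0 :=
    Matrix.exists_mulVec_eq_zero_iff.1 ⟨1, one_ne_zero, hker⟩
  obtain ⟨x, hx0, hx⟩ := Matrix.exists_vecMul_eq_zero_iff.2 hdet
  rw [Matrix.vecMul_sub, Matrix.vecMul_one, sub_eq_zero] at hx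
  have hle : ∀ j, |x j| ≤ ∑ i, |x i| * M i j := by
    intro j
    conv_lhs => rw [hx]
    rw [Matrix.vecMul, dotProduct]
    refine (Finset.abs_sum_le_sum_abs _ _).trans (le_of_eq (Finset.sum_congr rfl fun i _ => ?_))
    rw [abs_mul, abs_of_nonneg (hM i j)]
  have hsum : ∑ j, |x j| = ∑ j, ∑ i, |x i| * M i j := by
    rw [Finset.sum_comm]
    refine Finset.sum_congr rfl fun i _ => ?_
    rw [← Finset.mul_sum, hrow, mul_one]
  have heq := (Finset.sum_eq_sum_iff_of_le (s := Finset.univ) (f := fun j => |x j|)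
    (g := fun j => ∑ i, |x i| * M i j) fun j _ => hle j).1 hsum
  have hpos : 0 < ∑ j, |x j| := by
    obtain ⟨i, hi⟩ := Function.ne_iff.1 hx0
    exact Finset.sum_pos' (fun j _ => abs_nonneg (x j)) ⟨i, Finset.mem_univ i, abs_pos.2 hi⟩
  refine ⟨fun j => |x j| / ∑ i, |x i|, fun j => by positivity, ?_, ?_⟩
  · rw [← Finset.sum_div, div_self hpos.ne']
  · ext j
    rw [heq j (Finset.mem_univ j), Finset.sum_div, Matrix.vecMul, dotProduct]
    exact Finset.sum_congr rfl fun i _ => by ring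

namespace ComparisonNetwork.IsBounded

variable {V ι : Type*} [Fintype V] [DecidableEq V] [Fintype ι]
  {N : ComparisonNetwork V ι} {h κ D lam b : ℝ} (H : N.IsBounded h κ D lam) {η : ι → ℝ}
include H

omit H in
lemma lap_sub_mean_eq [Nonempty V] {u : V → ℝ} (hu : N.lap u = N.noise η u) (a : ℝ)
    (ha : a = (∑ i, u i) / Fintype.card V) :
    ∑ i, (u - a • 1) i = 0 ∧ N.lap (u - a • 1) = N.noise η (a • 1 + (u - a • 1)) := by
  have hc : (Fintype.card V : ℝ) ≠ 0 := by exact_mod_cast Fintype.card_ne_zero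
  constructor
  · simp [ha]
    field_simp
    ring
  · rw [add_sub_cancel, ← hu, map_sub]
    have : N.lap (a • (1 : V → ℝ)) = 0 := by
      have e : a • (1 : V → ℝ) = fun _ => a := by ext; simp
      rw [e, lap_const]
    rw [this, sub_zero]

/-- Solutions of the noisy Poisson equation with zero mean vanish. -/
lemma eq_zero_of_lap_eq_noise [Nonempty V] (hb : 0 ≤ b) (hη : N.IsBoundedNoise b η)
    (hτ : b * h / lam ≤ 1 / 4) {u : V → ℝ} (hu : N.lap u = N.noise η u) (hs : ∑ i, u i = 0) :
    u = 0 := by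
  have := H.l2norm_le_of_lap_eq_noise hb hη hτ (a := 0) hs (by rw [zero_smul, zero_add, hu])
  rw [abs_zero, zero_mul, mul_zero] at this
  exact eq_zero_of_l2norm_eq_zero (le_antisymm this (l2norm_nonneg u))

/-- A probability vector `μ` for which `μ / score` solves the noisy Poisson equation is close to
the normalized score vector. -/
lemma norm_sub_normalized_le [Nontrivial V] (hn : 1 ≤ Real.log (Fintype.card V)) (hb : 0 ≤ b)
    {R : ℕ} (hη : N.IsGoodNoise h lam b R η) (hτ : b * h / lam ≤ 1 / 4) {ε : ℝ}
    (hε : 12 * (b * h / lam) *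
      (∑ r ∈ Finset.range R, (21 * Real.log (Fintype.card V) * (b * h / lam)) ^ r +
        √(Fintype.card V) * (3 * (b * h / lam)) ^ R) ≤ ε)
    {u : V → ℝ} (hu : N.lap u = N.noise η u) (hu0 : ∀ i, 0 ≤ u i)
    (hu1 : ∑ i, N.score i * u i = 1) :
    ‖N.score * u - fun i => N.score i / ∑ j, N.score j‖ /
      ‖(fun i => N.score i / ∑ j, N.score j : V → ℝ)‖ ≤ 2 * h * ε := by
  have hl := H.lam_pos
  have hh := zero_le_one.trans H.one_le_h
  set n : ℝ := (Fintype.card V : ℝ) with hndef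
  have hn0 : 0 < n := by rw [hndef]; exact_mod_cast Fintype.card_pos
  obtain ⟨a, ha⟩ : ∃ a, a = (∑ i, u i) / n := ⟨_, rfl⟩
  obtain ⟨hv, hs⟩ := lap_sub_mean_eq hu a ha
  set v := u - a • (1 : V → ℝ) with hvdef
  have ha0 : 0 ≤ a := by
    rw [ha]; exact div_nonneg (Finset.sum_nonneg fun i _ => hu0 i) hn0.le
  have ha1 : a ≤ 1 / n := by
    rw [ha]
    refine div_le_div_of_nonneg_right ?_ hn0.le
    rw [← hu1]
    refine Finset.sum_le_sum fun i _ => ?_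
    nlinarith [H.one_le_score i, hu0 i]
  have hvn : ‖v‖ ≤ a * ε := by
    have := H.norm_le_of_lap_eq_noise hn hb hη.bounded hη.leaveOneOut hη.neumann_one hτ hv hs
    rw [abs_of_nonneg ha0, mul_assoc] at this
    exact this.trans (mul_le_mul_of_nonneg_left hε ha0)
  have haε : 0 ≤ a * ε := (norm_nonneg v).trans hvn
  have hui : ∀ i, u i = a + v i := fun i => by simp [hvdef]
  have hvi : ∀ i, |v i| ≤ a * ε := fun i => (norm_le_pi_norm v i).trans hvn
  set A := ∑ j, N.score j with hA
  have hA0 : 0 < A := Finset.sum_pos (fun j _ => H.score_pos j) Finset.univ_nonempty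
  have hmean : |a - 1 / A| ≤ a * ε := by
    have e : a - 1 / A = -(∑ i, N.score i * v i) / A := by
      rw [← hu1]
      simp only [hui, mul_add, Finset.sum_add_distrib, ← Finset.sum_mul, ← hA]
      field_simp
      ring
    rw [e, abs_div, abs_neg, abs_of_pos hA0, div_le_iff₀ hA0, hA, Finset.mul_sum]
    refine (Finset.abs_sum_le_sum_abs _ _).trans (Finset.sum_le_sum fun i _ => ?_)
    rw [abs_mul, abs_of_pos (H.score_pos i), mul_comm]
    exact mul_le_mul_of_nonneg_right (hvi i) (H.score_pos i).le
  have hnum : ‖N.score * u - fun i => N.score i / A‖ ≤ h * (2 * (a * ε)) := by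
    refine (pi_norm_le_iff_of_nonneg (by positivity)).2 fun i => ?_
    have e : (N.score * u - fun i => N.score i / A) i = N.score i * ((a - 1 / A) + v i) := by
      simp only [Pi.sub_apply, Pi.mul_apply, hui]; ring
    rw [e, Real.norm_eq_abs, abs_mul]
    refine mul_le_mul (H.abs_score_le i) ((abs_add_le _ _).trans ?_) (abs_nonneg _) hh
    linarith [hvi i]
  have hden : 1 / n ≤ ‖(fun i => N.score i / A : V → ℝ)‖ := by
    have h1 : ∑ i, N.score i / A = 1 := by rw [← Finset.sum_div, ← hA, div_self hA0.ne']
    have h2 : ∑ i, N.score i / A ≤ ∑ _i : V, ‖(fun i => N.score i / A : V → ℝ)‖ :=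
      Finset.sum_le_sum fun i _ => (le_abs_self _).trans
        (norm_le_pi_norm (fun i => N.score i / A : V → ℝ) i)
    rw [h1, Finset.sum_const, Finset.card_univ, nsmul_eq_mul, ← hndef] at h2
    rwa [div_le_iff₀' hn0]
  have hden0 : 0 < ‖(fun i => N.score i / A : V → ℝ)‖ := lt_of_lt_of_le (by positivity) hden
  have hε0 : 0 ≤ ε := by
    refine le_trans ?_ hε
    have : 0 ≤ Real.log n := by linarith
    positivity
  rw [div_le_iff₀ hden0]
  refine hnum.trans ?_
  have h3 := mul_le_mul_of_nonneg_right (ha1.trans hden) hε0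
  nlinarith [mul_le_mul_of_nonneg_left h3 hh]

end ComparisonNetwork.IsBounded

/-! ### The comparison network of a weighted graph -/

lemma sum_sum_eq_sum_sum_lt {n : ℕ} (a : Fin n → Fin n → ℝ) (ha : ∀ i, a i i = 0) :
    ∑ i, ∑ j, a i j = ∑ i, ∑ j, if i < j then a i j + a j i else 0 := by
  have h1 : ∀ i j, a i j = (if i < j then a i j else 0) + (if j < i then a i j else 0) := by
    intro i j
    rcases lt_trichotomy i j with h | h | h
    · simp [h, h.not_gt]
    · subst h; simp [ha]
    · simp [h, h.not_gt]
  have h2 : ∀ i j, (if i < j then a i j + a j i else 0) =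
      (if i < j then a i j else 0) + (if i < j then a j i else 0) := by
    intro i j
    split_ifs <;> simp
  calc _ = ∑ i, ∑ j, (if i < j then a i j else 0) + ∑ i, ∑ j, (if j < i then a i j else 0) := by
        simp only [← Finset.sum_add_distrib, ← h1]
    _ = ∑ i, ∑ j, (if i < j then a i j else 0) + ∑ i, ∑ j, (if i < j then a j i else 0) := by
        congr 1
        exact Finset.sum_comm
    _ = _ := by simp only [h2, Finset.sum_add_distrib]

namespace WeightedGraph

variable {n : ℕ} (G : WeightedGraph n)

/-- The single comparisons made on a weighted graph with `k` comparisons per edge. -/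
abbrev Comparison (k : ℕ) : Type := {e : Fin n × Fin n // e.1 < e.2 ∧ G.graph.Adj e.1 e.2} × Fin k

open Classical in
instance : Fintype {e : Fin n × Fin n // e.1 < e.2 ∧ G.graph.Adj e.1 e.2} :=
  Subtype.fintype _

lemma sum_comparison (k : ℕ) (f : Fin n → Fin n → Fin k → ℝ) :
    ∑ c : G.Comparison k, G.weight c.1.1.1 c.1.1.2 / k * f c.1.1.1 c.1.1.2 c.2 =
      ∑ i, ∑ j, if i < j then G.weight i j * ((∑ m, f i j m) / k) else 0 := by
  classical
  have h1 : ∀ e : {e : Fin n × Fin n // e.1 < e.2 ∧ G.graph.Adj e.1 e.2},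
      ∑ m, G.weight e.1.1 e.1.2 / k * f e.1.1 e.1.2 m =
        G.weight e.1.1 e.1.2 * ((∑ m, f e.1.1 e.1.2 m) / k) := fun e => by
    rw [Finset.sum_div, Finset.mul_sum]
    exact Finset.sum_congr rfl fun m _ => by ring
  rw [Fintype.sum_prod_type, Finset.sum_congr rfl fun e _ => h1 e,
    ← Finset.sum_subtype (Finset.univ.filter fun e : Fin n × Fin n =>
      e.1 < e.2 ∧ G.graph.Adj e.1 e.2) (by simp)
      (fun e => G.weight e.1 e.2 * ((∑ m, f e.1 e.2 m) / k)),
    Finset.sum_filter, Fintype.sum_prod_type]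
  refine Finset.sum_congr rfl fun i _ => Finset.sum_congr rfl fun j _ => ?_
  by_cases hij : i < j
  · by_cases hadj : G.graph.Adj i j
    · simp [hij, hadj]
    · simp [hij, hadj, G.weight_eq_zero i j hadj]
  · simp [hij]

lemma weight_self (i : Fin n) : G.weight i i = 0 :=
  G.weight_eq_zero i i (G.graph.loopless.irrefl i)

lemma degree_eq (i : Fin n) : G.degree i = ∑ j, G.weight i j := by
  classical
  rw [degree, Finset.sum_filter]
  refine Finset.sum_congr rfl fun j _ => ?_
  split_ifs with h
  · rfl
  · exact (G.weight_eq_zero i j h).symm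

lemma degree_le_dMax (i : Fin n) : G.degree i ≤ G.dMax :=
  le_ciSup (Set.finite_range _).bddAbove i

lemma dMin_le_degree (i : Fin n) : G.dMin ≤ G.degree i :=
  ciInf_le (Set.finite_range _).bddBelow i

/-- The comparison network of a weighted graph with `k` comparisons per edge. -/
def network (k : ℕ) (s : Fin n → ℝ) : ComparisonNetwork (Fin n) (G.Comparison k) where
  src c := c.1.1.1
  tgt c := c.1.1.2
  src_ne_tgt c := c.1.2.1.ne
  weight c := G.weight c.1.1.1 c.1.1.2 / k
  weight_nonneg _ := div_nonneg (G.weight_nonneg _ _) (Nat.cast_nonneg k)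
  score := s

variable {k : ℕ} (hk : k ≠ 0)
include hk

lemma sum_network_incident (s : Fin n → ℝ) (i : Fin n) :
    ∑ c ∈ (G.network k s).incident i, (G.network k s).weight c = G.degree i := by
  have hk' : (k : ℝ) ≠ 0 := Nat.cast_ne_zero.2 hk
  rw [ComparisonNetwork.incident, Finset.sum_filter, degree_eq]
  have h1 := G.sum_comparison k fun a b _ => if a = i ∨ b = i then 1 else 0
  have h2 := sum_sum_eq_sum_sum_lt (fun a b => if a = i then G.weight a b else 0)
    (fun a => by simp [G.weight_self])
  have h3 : ∑ a, ∑ b, (if a = i then G.weight a b else 0) = ∑ b, G.weight i b := by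
    rw [Finset.sum_eq_single i (fun a _ ha => by simp [ha]) (by simp)]
    simp
  rw [← h3, h2]
  refine Eq.trans ?_ (h1.trans ?_)
  · refine Finset.sum_congr rfl fun c _ => ?_
    by_cases hc : c.1.1.1 = i ∨ c.1.1.2 = i <;> simp [network, hc]
  · refine Finset.sum_congr rfl fun a _ => Finset.sum_congr rfl fun b _ => ?_
    by_cases hab : a < b
    · by_cases ha : a = i
      · have hb : b ≠ i := fun h => hab.ne (ha.trans h.symm)
        simp [ha, hb, hk', ha ▸ hab]
      · by_cases hb : b = i
        · simp [ha, hb, hk', hb ▸ hab, G.weight_symm a i]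
        · simp [ha, hb]
    · simp [hab]

lemma dotProduct_laplacian_eq (s v : Fin n → ℝ) : v ⬝ᵥ (G.laplacian *ᵥ v) =
    ∑ c, (G.network k s).weight c *
      (v ((G.network k s).tgt c) - v ((G.network k s).src c)) ^ 2 := by
  classical
  have hk' : (k : ℝ) ≠ 0 := Nat.cast_ne_zero.2 hk
  have h1 := G.sum_comparison k fun a b _ => (v b - v a) ^ 2
  refine Eq.trans ?_ h1.symm
  rw [laplacian, Matrix.sum_mulVec, dotProduct_sum, Finset.sum_filter, Fintype.sum_prod_type]
  refine Finset.sum_congr rfl fun a _ => Finset.sum_congr rfl fun b _ => ?_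
  by_cases hab : a < b
  · have e : v ⬝ᵥ (G.weight a b • Matrix.vecMulVec (Pi.single a 1 - Pi.single b 1)
        (Pi.single a 1 - Pi.single b 1)) *ᵥ v = G.weight a b * (v b - v a) ^ 2 := by
      rw [Matrix.smul_mulVec, dotProduct_smul, Matrix.vecMulVec_mulVec]
      simp [dotProduct_sub, sub_dotProduct]
      left
      ring
    by_cases hadj : G.graph.Adj a b
    · simp only [hab, hadj, and_self, if_true, e]
      simp [hk']
    · simp [hab, hadj, G.weight_eq_zero a b hadj]
  · simp [hab]

omit hk in
lemma spectralGap_set_nonneg {x : ℝ} (hx : x ∈ {x : ℝ | ∃ v : Fin n → ℝ, v ≠ 0 ∧ ∑ i, v i = 0 ∧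
    x = (v ⬝ᵥ (G.laplacian *ᵥ v)) / ∑ i, v i ^ 2}) : 0 ≤ x := by
  obtain ⟨v, -, -, rfl⟩ := hx
  rw [G.dotProduct_laplacian_eq one_ne_zero 0]
  exact div_nonneg (Finset.sum_nonneg fun c _ => mul_nonneg
    ((G.network 1 0).weight_nonneg c) (sq_nonneg _)) (Finset.sum_nonneg fun i _ => sq_nonneg _)

omit hk in
lemma spectralGap_mul_le {v : Fin n → ℝ} (hv : ∑ i, v i = 0) :
    G.spectralGap * ∑ i, v i ^ 2 ≤ v ⬝ᵥ (G.laplacian *ᵥ v) := by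
  by_cases h0 : v = 0
  · simp [h0]
  · have hpos : 0 < ∑ i, v i ^ 2 := by
      obtain ⟨i, hi⟩ := Function.ne_iff.1 h0
      exact Finset.sum_pos' (fun j _ => sq_nonneg (v j)) ⟨i, Finset.mem_univ i, pow_pos_of_ne hi⟩
    rw [← le_div_iff₀ hpos]
    exact csInf_le ⟨0, fun x hx => G.spectralGap_set_nonneg hx⟩ ⟨v, h0, hv, rfl⟩
where
  pow_pos_of_ne {a : ℝ} (h : a ≠ 0) : 0 < a ^ 2 := by positivity

omit hk in
/-- On a connected weighted graph the quadratic form of the Laplacian vanishes only on constant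
vectors. -/
lemma eq_zero_of_laplacian_eq_zero (hG : G.Connected) {v : Fin n → ℝ} (hv : ∑ i, v i = 0)
    (h : v ⬝ᵥ (G.laplacian *ᵥ v) = 0) : v = 0 := by
  classical
  rw [G.dotProduct_laplacian_eq one_ne_zero 0, Finset.sum_eq_zero_iff_of_nonneg fun c _ =>
    mul_nonneg ((G.network 1 0).weight_nonneg c) (sq_nonneg _)] at h
  have hlt : ∀ i j, i < j → G.support.Adj i j → v i = v j := by
    intro i j hij hadj
    have := h ⟨⟨(i, j), hij, hadj.1⟩, 0⟩ (Finset.mem_univ _)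
    simp only [network, Nat.cast_one, div_one] at this
    rcases mul_eq_zero.1 this with h0 | h0
    · exact absurd h0 hadj.2.ne'
    · linarith [pow_eq_zero_iff two_ne_zero |>.1 h0]
  have hadj : ∀ i j, G.support.Adj i j → v i = v j := by
    intro i j hadj
    rcases lt_trichotomy i j with h | h | h
    · exact hlt i j h hadj
    · rw [h]
    · exact (hlt j i h hadj.symm).symm
  have hreach : ∀ i j, v i = v j := by
    intro i j
    obtain ⟨w⟩ := hG.preconnected i j
    induction w with
    | nil => rfl
    | cons h _ ih => exact (hadj _ _ h).trans ih
  ext i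
  have hsum : ∑ j, v j = n * v i := by
    rw [Finset.sum_congr rfl fun j _ => hreach j i]
    simp
  rw [hv] at hsum
  have : (n : ℝ) ≠ 0 := Nat.cast_ne_zero.2 (Fin.pos i).ne'
  simpa [this] using hsum.symm

omit hk in
lemma spectralGap_pos (hG : G.Connected) (hn : 2 ≤ n) : 0 < G.spectralGap := by
  set f : (Fin n → ℝ) → ℝ := fun v => v ⬝ᵥ (G.laplacian *ᵥ v) with hf
  have hfc : Continuous f := by
    simp only [hf, dotProduct, Matrix.mulVec]
    fun_prop
  have hsc : Continuous fun v : Fin n → ℝ => ∑ i, v i ^ 2 := by fun_prop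
  set K : Set (Fin n → ℝ) := {v | ∑ i, v i = 0 ∧ ∑ i, v i ^ 2 = 1} with hK
  have hKc : IsCompact K := by
    refine Metric.isCompact_of_isClosed_isBounded ?_ ?_
    · exact (isClosed_eq (by fun_prop) continuous_const).inter (isClosed_eq hsc continuous_const)
    · refine (Metric.isBounded_iff_subset_closedBall 0).2 ⟨1, fun v hv => ?_⟩
      rw [mem_closedBall_zero_iff]
      refine (norm_le_l2norm v).trans (le_of_eq ?_)
      rw [← Real.sqrt_sq (l2norm_nonneg v), l2norm_sq, hv.2, Real.sqrt_one]
  have hscale : ∀ v : Fin n → ℝ, v ≠ 0 → ∑ i, v i = 0 →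
      (√(∑ i, v i ^ 2))⁻¹ • v ∈ K ∧
        f ((√(∑ i, v i ^ 2))⁻¹ • v) = f v / ∑ i, v i ^ 2 := by
    intro v h0 hv
    have hpos : 0 < ∑ i, v i ^ 2 := by
      obtain ⟨i, hi⟩ := Function.ne_iff.1 h0
      exact Finset.sum_pos' (fun j _ => sq_nonneg (v j))
        ⟨i, Finset.mem_univ i, by have : v i ≠ 0 := hi; positivity⟩
    refine ⟨⟨?_, ?_⟩, ?_⟩
    · simp [← Finset.mul_sum, hv]
    · simp only [Pi.smul_apply, smul_eq_mul, mul_pow, ← Finset.mul_sum, inv_pow]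
      rw [Real.sq_sqrt hpos.le, inv_mul_cancel₀ hpos.ne']
    · simp only [hf, Matrix.mulVec_smul, smul_dotProduct, dotProduct_smul, smul_eq_mul]
      rw [← mul_assoc, ← mul_inv, Real.mul_self_sqrt hpos.le, div_eq_inv_mul]
  obtain ⟨w, hw0, hw⟩ : ∃ w : Fin n → ℝ, w ≠ 0 ∧ ∑ i, w i = 0 := by
    refine ⟨Pi.single ⟨0, by omega⟩ 1 - Pi.single ⟨1, by omega⟩ 1, fun h => ?_, by simp⟩
    have := congrFun h ⟨0, by omega⟩
    simp at this
  obtain ⟨v₀, hv₀, hmin⟩ := hKc.exists_isMinOn ⟨_, (hscale w hw0 hw).1⟩ hfc.continuousOn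
  have hpos : 0 < f v₀ := by
    have hnn : 0 ≤ f v₀ := by
      simp only [hf]
      rw [G.dotProduct_laplacian_eq one_ne_zero 0]
      exact Finset.sum_nonneg fun c _ => mul_nonneg
        ((G.network 1 0).weight_nonneg c) (sq_nonneg _)
    refine lt_of_le_of_ne hnn fun h0 => ?_
    have := G.eq_zero_of_laplacian_eq_zero hG hv₀.1 h0.symm
    have h1 := hv₀.2
    rw [this] at h1
    simp at h1
  refine lt_of_lt_of_le hpos (le_csInf ⟨_, w, hw0, hw, rfl⟩ ?_)
  rintro x ⟨v, hv0, hv, rfl⟩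
  rw [← show f v = v ⬝ᵥ (G.laplacian *ᵥ v) from rfl, ← (hscale v hv0 hv).2]
  exact hmin (hscale v hv0 hv).1

lemma network_isBounded (hG : G.Connected) (hn : 2 ≤ n) {s : Fin n → ℝ} {h : ℝ}
    (hs1 : ∀ i, 1 ≤ s i) (hsh : ∀ i, s i ≤ h) :
    (G.network k s).IsBounded h (1 / k) G.dMax G.spectralGap where
  one_le_score := hs1
  score_le := hsh
  weight_le c := div_le_div_of_nonneg_right (G.weight_le_one _ _) (Nat.cast_nonneg k)
  degree_le i := by
    rw [G.sum_network_incident hk]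
    exact G.degree_le_dMax i
  lam_pos := G.spectralGap_pos hG hn
  poincare v hv := by
    rw [← G.dotProduct_laplacian_eq hk s]
    exact G.spectralGap_mul_le hv

end WeightedGraph

/-! ### The Markov matrix of the observed comparisons -/

lemma empiricalProb_mem {n k : ℕ} (z : Fin n → Fin n → Fin k → Bool) (i j : Fin n) :
    empiricalProb z i j ∈ Set.Icc (0 : ℝ) 1 := by
  have key : ∀ a b : Fin n,
      (∑ m : Fin k, if z a b m = true then (1 : ℝ) else 0) / k ∈ Set.Icc (0 : ℝ) 1 := by
    intro a b
    have h1 : (∑ m : Fin k, if z a b m = true then (1 : ℝ) else 0) ≤ k := by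
      calc _ ≤ ∑ _m : Fin k, (1 : ℝ) := Finset.sum_le_sum fun m _ => by split_ifs <;> norm_num
        _ = k := by simp
    have h0 : 0 ≤ ∑ m : Fin k, if z a b m = true then (1 : ℝ) else 0 :=
      Finset.sum_nonneg fun m _ => by positivity
    exact ⟨by positivity, div_le_one_of_le₀ h1 (Nat.cast_nonneg k)⟩
  rw [empiricalProb]
  split_ifs
  · exact key i j
  · have := key j i
    exact ⟨by linarith [this.2], by linarith [this.1]⟩

namespace WeightedGraph

variable {n : ℕ} (G : WeightedGraph n)

lemma markovMatrix_eq (q : Fin n → Fin n → ℝ) (i j : Fin n) : G.markovMatrix q i j =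
    q i j * G.weight i j / G.dMax +
      if i = j then 1 - (1 / G.dMax) * ∑ l, q i l * G.weight i l else 0 := by
  classical
  have hsum : ∑ l with G.graph.Adj i l, q i l * G.weight i l = ∑ l, q i l * G.weight i l := by
    rw [Finset.sum_filter]
    refine Finset.sum_congr rfl fun l _ => ?_
    split_ifs with h
    · rfl
    · rw [G.weight_eq_zero i l h, mul_zero]
  rw [markovMatrix, Matrix.of_apply]
  by_cases hadj : G.graph.Adj i j
  · have hij : i ≠ j := hadj.ne
    simp [hadj, hij]
  · rw [if_neg hadj, G.weight_eq_zero i j hadj, mul_zero, zero_div, zero_add, ← hsum]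

lemma sum_markovMatrix (q : Fin n → Fin n → ℝ) (i : Fin n) :
    ∑ j, G.markovMatrix q i j = 1 := by
  simp only [markovMatrix_eq, Finset.sum_add_distrib, Finset.sum_ite_eq, Finset.mem_univ, if_true,
    ← Finset.sum_div]
  ring

lemma markovMatrix_nonneg (hD : 0 < G.dMax) {q : Fin n → Fin n → ℝ}
    (hq : ∀ i j, q i j ∈ Set.Icc (0 : ℝ) 1) (i j : Fin n) : 0 ≤ G.markovMatrix q i j := by
  rw [markovMatrix_eq]
  refine add_nonneg (div_nonneg (mul_nonneg (hq i j).1 (G.weight_nonneg i j)) hD.le) ?_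
  split_ifs
  · have h1 : ∑ l, q i l * G.weight i l ≤ G.dMax := by
      refine le_trans (Finset.sum_le_sum fun l _ => ?_) ((G.degree_eq i).symm.le.trans
        (G.degree_le_dMax i))
      exact mul_le_of_le_one_left (G.weight_nonneg i l) (hq i l).2
    rw [sub_nonneg, one_div_mul_eq_div]
    exact (div_le_one hD).2 h1
  · exact le_rfl

lemma vecMul_markovMatrix (q : Fin n → Fin n → ℝ) (μ : Fin n → ℝ) (j : Fin n) :
    (μ ᵥ* G.markovMatrix q) j =
      μ j + (1 / G.dMax) * ∑ i, G.weight i j * (μ i * q i j - μ j * q j i) := by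
  have h1 : ∑ i, G.weight i j * (μ i * q i j - μ j * q j i) =
      ∑ i, μ i * (q i j * G.weight i j) - μ j * ∑ i, q j i * G.weight j i := by
    rw [Finset.mul_sum, ← Finset.sum_sub_distrib]
    refine Finset.sum_congr rfl fun i _ => ?_
    rw [G.weight_symm j i]
    ring
  rw [Matrix.vecMul, dotProduct, h1]
  simp only [markovMatrix_eq, mul_add, Finset.sum_add_distrib, mul_ite, mul_zero,
    Finset.sum_ite_eq', Finset.mem_univ, if_true]
  have : ∑ i, μ i * (q i j * G.weight i j / G.dMax) =
      1 / G.dMax * ∑ i, μ i * (q i j * G.weight i j) := by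
    rw [Finset.mul_sum]
    exact Finset.sum_congr rfl fun i _ => by ring
  rw [this]
  ring

variable {k : ℕ} (hk : k ≠ 0)

/-- Restriction of comparison outcomes to the comparisons that are made. -/
def outcome (z : Fin n → Fin n → Fin k → Bool) (c : G.Comparison k) : Bool :=
  z c.1.1.1 c.1.1.2 c.2

include hk in
lemma sum_weight_mul_flow_eq {s : Fin n → ℝ} (hs : ∀ i, 0 < s i)
    (z : Fin n → Fin n → Fin k → Bool) (u : Fin n → ℝ) (j : Fin n) :
    ∑ i, G.weight i j * (s i * u i * empiricalProb z i j - s j * u j * empiricalProb z j i) =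
      ((G.network k s).noise (centered (G.network k s).winProb (G.outcome z)) u -
        (G.network k s).lap u) j := by
  have hk' : (k : ℝ) ≠ 0 := Nat.cast_ne_zero.2 hk
  set N := G.network k s with hN
  have hRHS : (N.noise (centered N.winProb (G.outcome z)) u - N.lap u) j =
      ∑ c : G.Comparison k, G.weight c.1.1.1 c.1.1.2 / k *
        (((if z c.1.1.1 c.1.1.2 c.2 = true then (1 : ℝ) else 0) *
          (s c.1.1.1 * u c.1.1.1 + s c.1.1.2 * u c.1.1.2) - s c.1.1.2 * u c.1.1.2) *
          ((if c.1.1.2 = j then 1 else 0) - (if c.1.1.1 = j then 1 else 0))) := by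
    rw [Pi.sub_apply, N.noise_apply_coord, N.lap_apply, Finset.sum_apply,
      ← Finset.sum_sub_distrib]
    refine Finset.sum_congr rfl fun c _ => ?_
    have h1 := hs c.1.1.1
    have h2 := hs c.1.1.2
    have hedge : N.edge c j = (if c.1.1.2 = j then 1 else 0) - (if c.1.1.1 = j then 1 else 0) := by
      simp only [hN, network, ComparisonNetwork.edge, Pi.sub_apply, Pi.single_apply, eq_comm]
    rw [Pi.smul_apply, smul_eq_mul, hedge]
    simp only [hN, network, centered, outcome, ComparisonNetwork.winProb,
      ComparisonNetwork.conductance]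
    have h3 : s c.1.1.1 + s c.1.1.2 ≠ 0 := by positivity
    generalize ((if c.1.1.2 = j then (1 : ℝ) else 0) - (if c.1.1.1 = j then 1 else 0)) = e
    by_cases hz : z c.1.1.1 c.1.1.2 c.2 = true <;> simp only [hz, if_true]
    · field_simp
      ring
    · field_simp
      ring
  have hsum := G.sum_comparison k fun a b m =>
    (((if z a b m = true then (1 : ℝ) else 0) * (s a * u a + s b * u b) - s b * u b) *
          ((if b = j then 1 else 0) - (if a = j then 1 else 0)))
  rw [hRHS]
  refine Eq.trans ?_ hsum.symm
  have hlhs : ∑ i, G.weight i j *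
      (s i * u i * empiricalProb z i j - s j * u j * empiricalProb z j i) =
      ∑ a, ∑ b, if b = j then G.weight a b *
        (s a * u a * empiricalProb z a b - s b * u b * empiricalProb z b a) else 0 := by
    refine Finset.sum_congr rfl fun a _ => ?_
    rw [Finset.sum_ite_eq' Finset.univ j]
    simp
  rw [hlhs, sum_sum_eq_sum_sum_lt _ fun a => by simp [G.weight_self]]
  refine Finset.sum_congr rfl fun a _ => Finset.sum_congr rfl fun b _ => ?_
  by_cases hab : a < b
  · have e : (∑ m : Fin k, ((if z a b m = true then (1 : ℝ) else 0) * (s a * u a + s b * u b) -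
        s b * u b) * ((if b = j then 1 else 0) - (if a = j then 1 else 0))) / k =
        ((∑ m : Fin k, if z a b m = true then (1 : ℝ) else 0) / k * (s a * u a + s b * u b) -
          s b * u b) * ((if b = j then 1 else 0) - (if a = j then 1 else 0)) := by
      rw [← Finset.sum_mul, Finset.sum_sub_distrib, ← Finset.sum_mul, Finset.sum_const,
        Finset.card_univ, Fintype.card_fin, nsmul_eq_mul]
      field_simp
    rw [if_pos hab, if_pos hab, e, empiricalProb, empiricalProb, if_pos hab, if_neg hab.not_gt,
      G.weight_symm b a]
    generalize (∑ m : Fin k, if z a b m = true then (1 : ℝ) else 0) / k = Q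
    split_ifs <;> ring
  · rw [if_neg hab, if_neg hab]

include hk in
/-- A vector is invariant under the Markov matrix if and only if its quotient by the scores solves
the noisy Poisson equation. -/
lemma vecMul_markovMatrix_eq_iff (hD : 0 < G.dMax) {s : Fin n → ℝ} (hs : ∀ i, 0 < s i)
    (z : Fin n → Fin n → Fin k → Bool) (u : Fin n → ℝ) :
    (s * u) ᵥ* G.markovMatrix (empiricalProb z) = s * u ↔
      (G.network k s).lap u =
        (G.network k s).noise (centered (G.network k s).winProb (G.outcome z)) u := by
  rw [eq_comm (a := (G.network k s).lap u), ← sub_eq_zero (b := (G.network k s).lap u),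
    funext_iff, funext_iff]
  refine forall_congr' fun j => ?_
  rw [vecMul_markovMatrix, ← G.sum_weight_mul_flow_eq hk hs z u j]
  simp only [Pi.mul_apply, Pi.zero_apply, add_eq_left, mul_eq_zero, one_div, inv_eq_zero, hD.ne',
    false_or]

end WeightedGraph

lemma btlProb_div {n : ℕ} (α : Fin n → ℝ) {a : ℝ} (ha : a ≠ 0) (i j : Fin n) :
    btlProb α i j = btlProb (fun i => α i / a) i j := by
  rw [btlProb, btlProb, ← add_div, div_div_div_cancel_right₀ ha]

lemma normalizedScore_div {n : ℕ} (α : Fin n → ℝ) {a : ℝ} (ha : a ≠ 0) :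
    normalizedScore (fun i => α i / a) = normalizedScore α := by
  ext i
  rw [normalizedScore, normalizedScore, ← Finset.sum_div, div_div_div_cancel_right₀ ha]

/-- Scores of dynamic range at most `h` may be rescaled into `[1, h]`. -/
lemma exists_rescaled_score {n : ℕ} [NeZero n] {α : Fin n → ℝ} {h : ℝ} (hα : ∀ i, 0 < α i)
    (hh : dynamicRange α ≤ h) : ∃ a, a ≠ 0 ∧ ∀ i, 1 ≤ α i / a ∧ α i / a ≤ h := by
  obtain ⟨i₀, hi₀⟩ := exists_eq_ciInf_of_finite (f := α)
  have ha : 0 < ⨅ i, α i := hi₀ ▸ hα i₀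
  refine ⟨⨅ i, α i, ha.ne', fun i => ⟨?_, le_trans ?_ hh⟩⟩
  · rw [le_div_iff₀ ha, one_mul]
    exact ciInf_le (Set.finite_range α).bddBelow i
  · exact div_le_div_of_nonneg_right (le_ciSup (Set.finite_range α).bddAbove i) ha.le

/-! ### The error bound -/

lemma noise_ratio_mul_le {n k h L p lam D τ : ℝ} (hn : 0 < n) (hk : 1 ≤ k) (hh : 0 < h)
    (hL : 1 ≤ L) (hp : 0 < p) (hl : 0 < lam) (hDp : D ≤ 2 * n * p)
    (hτ2 : τ ^ 2 = 20 * h ^ 2 * (D * L) / (k * lam ^ 2)) :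
    86400 * h * (τ * (1 + √n * (τ ^ 2 / L))) ≤
      604800 * (h ^ 2 + 1) / lam * √(n * L * p / k) +
        24192000 * (h ^ 4 + 1) / lam ^ 3 * √(n ^ 4 * L * p ^ 3 / k) := by
  have hk0 : 0 < k := by linarith
  have hL0 : 0 < L := by linarith
  set T := √(n * L * p / k) with hT
  have hT2 : T ^ 2 = n * L * p / k := Real.sq_sqrt (by positivity)
  have hT0 : 0 ≤ T := Real.sqrt_nonneg _
  have hτ1 : τ ≤ 7 * h * T / lam := by
    refine le_of_sq_le_sq ?_ (by positivity)
    rw [hτ2, div_pow, mul_pow, hT2]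
    calc 20 * h ^ 2 * (D * L) / (k * lam ^ 2)
        ≤ 20 * h ^ 2 * (2 * n * p * L) / (k * lam ^ 2) := by gcongr
      _ = 40 * (h ^ 2 * (n * L * p / k) / lam ^ 2) := by field_simp; norm_num
      _ ≤ 49 * (h ^ 2 * (n * L * p / k) / lam ^ 2) := by gcongr; norm_num
      _ = (7 * h) ^ 2 * (n * L * p / k) / lam ^ 2 := by ring
  have hτL : τ ^ 2 / L ≤ 40 * h ^ 2 * (n * p) / lam ^ 2 := by
    calc τ ^ 2 / L = 20 * h ^ 2 * D / (k * lam ^ 2) := by rw [hτ2]; field_simp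
      _ ≤ 20 * h ^ 2 * (2 * n * p) / (1 * lam ^ 2) := by gcongr
      _ = _ := by ring
  have hT3 : √(n ^ 4 * L * p ^ 3 / k) = √n * (n * p) * T := by
    rw [Real.sqrt_eq_iff_mul_self_eq (by positivity) (by positivity)]
    calc n ^ 4 * L * p ^ 3 / k = √n ^ 2 * (n * p) ^ 2 * T ^ 2 := by
          rw [hT2, Real.sq_sqrt hn.le]; ring
      _ = _ := by ring
  have hs : 0 ≤ √n := Real.sqrt_nonneg n
  rw [hT3]
  calc 86400 * h * (τ * (1 + √n * (τ ^ 2 / L)))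
      ≤ 86400 * h * (7 * h * T / lam * (1 + √n * (40 * h ^ 2 * (n * p) / lam ^ 2))) := by gcongr
    _ = 604800 * h ^ 2 / lam * T + 24192000 * h ^ 4 / lam ^ 3 * (√n * (n * p) * T) := by
        field_simp; ring
    _ ≤ _ := by gcongr <;> linarith

namespace WeightedGraph

variable {n : ℕ} (G : WeightedGraph n)

lemma two_le_of_one_le_dMin (hG : G.Connected) (hd : 1 ≤ G.dMin) : 2 ≤ n := by
  have : Nonempty (Fin n) := hG.nonempty
  obtain ⟨i⟩ := this
  by_contra hn
  have h1 : n = 1 := by have := i.2; omega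
  subst h1
  have h2 := hd.trans (G.dMin_le_degree i)
  rw [G.degree_eq, Fintype.sum_unique, Subsingleton.elim i default, G.weight_self] at h2
  norm_num at h2

variable {k : ℕ} {s : Fin n → ℝ} {h κ D lam b : ℝ}

/-- On good noise, the Markov matrix has a unique stationary distribution. -/
lemma existsUnique_isStationary [NeZero n] (hk : k ≠ 0) (hD : 0 < G.dMax) (hs : ∀ i, 0 < s i)
    (H : (G.network k s).IsBounded h κ D lam) (hb : 0 ≤ b) (hτ : b * h / lam ≤ 1 / 4)
    (z : Fin n → Fin n → Fin k → Bool)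
    (hη : (G.network k s).IsBoundedNoise b (centered (G.network k s).winProb (G.outcome z))) :
    ∃! μ, IsStationary (G.markovMatrix (empiricalProb z)) μ := by
  obtain ⟨μ, hμ⟩ := exists_isStationary
    (G.markovMatrix_nonneg hD (empiricalProb_mem z)) (G.sum_markovMatrix _)
  refine ⟨μ, hμ, fun ν hν => ?_⟩
  have key : ∀ μ : Fin n → ℝ, IsStationary (G.markovMatrix (empiricalProb z)) μ →
      μ = s * (μ / s) ∧ 0 < ∑ i, (μ / s) i ∧ (G.network k s).lap (μ / s) =
        (G.network k s).noise (centered (G.network k s).winProb (G.outcome z)) (μ / s) := by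
    intro μ hμ
    have e : μ = s * (μ / s) := by
      ext i
      exact (mul_div_cancel₀ _ (hs i).ne').symm
    refine ⟨e, ?_, ?_⟩
    · obtain ⟨i, -, hi⟩ : ∃ i ∈ Finset.univ, μ i ≠ 0 :=
        Finset.exists_ne_zero_of_sum_ne_zero (by rw [hμ.2.1]; exact one_ne_zero)
      exact Finset.sum_pos' (fun j _ => div_nonneg (hμ.1 j) (hs j).le)
        ⟨i, Finset.mem_univ i, div_pos ((hμ.1 i).lt_of_ne' hi) (hs i)⟩
    · rw [← G.vecMul_markovMatrix_eq_iff hk hD hs z, ← e]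
      exact hμ.2.2
  obtain ⟨e1, c1, l1⟩ := key μ hμ
  obtain ⟨e2, c2, l2⟩ := key ν hν
  set c := ∑ i, (μ / s) i
  set c' := ∑ i, (ν / s) i
  have hw : c' • (μ / s) - c • (ν / s) = 0 := by
    refine H.eq_zero_of_lap_eq_noise hb hη hτ ?_ ?_
    · simp only [map_sub, map_smul, l1, l2]
    · simp only [Pi.sub_apply, Pi.smul_apply, smul_eq_mul, Finset.sum_sub_distrib,
        ← Finset.mul_sum]
      exact sub_eq_zero.2 (mul_comm c' c)
  have hμν : c' • μ = c • ν := by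
    rw [e1, e2, ← mul_smul_comm, ← mul_smul_comm, sub_eq_zero.1 hw]
  have hcc : c' = c := by
    have := congrArg (fun f : Fin n → ℝ => ∑ i, f i) hμν
    simpa only [Pi.smul_apply, smul_eq_mul, ← Finset.mul_sum, hμ.2.1, hν.2.1, mul_one] using this
  rw [hcc] at hμν
  exact (smul_right_injective _ c1.ne' hμν).symm

/-- On good noise, stationary distributions are close to the normalized scores. -/
lemma norm_sub_normalizedScore_le (hn : 2 ≤ n) (hL : 1 ≤ Real.log n) (hk : k ≠ 0)
    (hD : 0 < G.dMax) (hs : ∀ i, 0 < s i) (H : (G.network k s).IsBounded h κ D lam) (hb : 0 ≤ b)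
    (hτ : b * h / lam ≤ 1 / 4) {R : ℕ} (hR : 3 ≤ R)
    (h1 : R * (6 * Real.log n) ^ R * Real.log n ^ 3 ≤ √n)
    (h2 : (3 / 4 : ℝ) ^ R * Real.log n ^ 3 ≤ 1) (z : Fin n → Fin n → Fin k → Bool)
    (hη : (G.network k s).IsGoodNoise h lam b R
      (centered (G.network k s).winProb (G.outcome z)))
    {μ : Fin n → ℝ} (hμ : IsStationary (G.markovMatrix (empiricalProb z)) μ) :
    ‖μ - normalizedScore s‖ / ‖normalizedScore s‖ ≤
      86400 * h * (b * h / lam * (1 + √n * ((b * h / lam) ^ 2 / Real.log n))) := by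
  have : Nontrivial (Fin n) := Fin.nontrivial_iff_two_le.2 hn
  have hh := zero_le_one.trans H.one_le_h
  have hl := H.lam_pos
  have e : μ = s * (μ / s) := by
    ext i
    exact (mul_div_cancel₀ _ (hs i).ne').symm
  have hsum := neumann_sum_le hL hR h1 h2 (τ := b * h / lam) (by positivity) hτ
  have := H.norm_sub_normalized_le (R := R)
    (ε := 12 * (b * h / lam) * (3600 * (1 + √n * ((b * h / lam) ^ 2 / Real.log n))))
    (by rwa [Fintype.card_fin]) hb hη hτ
    (by rw [Fintype.card_fin]; gcongr) (u := μ / s)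
    (by rw [← G.vecMul_markovMatrix_eq_iff hk hD hs z, ← e]; exact hμ.2.2)
    (fun i => div_nonneg (hμ.1 i) (hs i).le)
    (by
      have := hμ.2.1
      rw [e] at this
      exact this)
  change ‖s * (μ / s) - normalizedScore s‖ / ‖normalizedScore s‖ ≤ _ at this
  rw [← e] at this
  refine this.trans (le_of_eq (by ring))

end WeightedGraph

/-- The probability of an event that contains the good noise event. -/
lemma one_sub_le_measureReal {n k : ℕ} {α s : Fin n → ℝ} {G : WeightedGraph n} {Ω : Type*}
    [MeasurableSpace Ω] {P : Measure Ω} [IsProbabilityMeasure P]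
    {Z : Fin n → Fin n → Fin k → Ω → Bool} (hZ : IsBTLSample P G.graph α Z) {a : ℝ} (ha : a ≠ 0)
    (hs : s = fun i => α i / a) (hn : 2 ≤ n) (hL : 1 ≤ Real.log n) {h κ D lam : ℝ}
    (H : (G.network k s).IsBounded h κ D lam) (hκ : 0 < κ) {R : ℕ} (hR : R ≤ n)
    {E : (Fin n → Fin n → Fin k → Bool) → Prop}
    (hE : ∀ z, (G.network k s).IsGoodNoise h lam (2 * (√(5 * Real.log n) * √(κ * D))) R
      (centered (G.network k s).winProb (G.outcome z)) → E z) :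
    1 - 8 / (n : ℝ) ^ 5 ≤ P.real {ω | E fun i j m => Z i j m ω} := by
  classical
  have : Nontrivial (Fin n) := Fin.nontrivial_iff_two_le.2 hn
  set x := √(5 * Real.log n) with hx
  have hx0 : 0 < x := Real.sqrt_pos.2 (by positivity)
  have hx2 : x ^ 2 = 5 * Real.log n := Real.sq_sqrt (by positivity)
  set N := G.network k s with hN
  set S : (G.Comparison k → Bool) → Prop := fun z =>
    N.IsGoodNoise h lam (2 * (x * √(κ * D))) R (centered N.winProb z)
  have hq : ⌈6 * Real.log n⌉₊ ≠ 0 := (Nat.ceil_pos.2 (by positivity)).ne'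
  have hbad := H.bernoulliProb_not_isGoodNoise_le hκ hx0 rfl R hq
  rw [Fintype.card_fin] at hbad
  replace hbad := hbad.trans (failure_prob_le (by omega) hL hR hx2)
  have hlaw := measureReal_eq_bernoulliProb (P := P) H.winProb_mem
    (Z := fun c : G.Comparison k => Z c.1.1.1 c.1.1.2 c.2)
    (fun c => hZ.measurable _ _ _ c.1.2.1 c.1.2.2)
    (fun c => by
      rw [hZ.prob_true _ _ _ c.1.2.1 c.1.2.2, btlProb_div α ha, ← hs]
      rfl) hZ.indep S
  calc 1 - 8 / (n : ℝ) ^ 5 ≤ bernoulliProb N.winProb S := by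
        rw [bernoulliProb_compl]
        exact sub_le_sub_left hbad 1
    _ = P.real {ω | S fun c => Z c.1.1.1 c.1.1.2 c.2 ω} := hlaw.symm
    _ ≤ _ := measureReal_mono fun ω hω => hE (fun i j m => Z i j m ω) hω

end WeightedBTL

end

theorem theorem4p1 (h : ℝ) :
    ∃ c₁ c₂ c₃ C : ℝ, 0 < c₁ ∧ 0 < c₂ ∧ 0 < c₃ ∧ 0 < C ∧
      ∀ (n k : ℕ) (α : Fin n → ℝ) (G : WeightedBTL.WeightedGraph n) (p : ℝ)
        {Ω : Type*} [MeasurableSpace Ω] (P : Measure Ω) [IsProbabilityMeasure P]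
        (Z : Fin n → Fin n → Fin k → Ω → Bool),
        (∀ i, 0 < α i) →
        WeightedBTL.dynamicRange α ≤ h →
        WeightedBTL.IsBTLSample P G.graph α Z →
        G.Connected →
        1 ≤ G.dMin →
        G.dMax ≤ 2 * n * p →
        640 * h ^ 2 * n * Real.log n * p / G.spectralGap ^ 2 ≤ k →
        1 - C / (n : ℝ) ^ 5 ≤
          P.real {ω |
            (∃! μ : Fin n → ℝ, WeightedBTL.IsStationary
              (G.markovMatrix (WeightedBTL.empiricalProb fun i j m => Z i j m ω)) μ) ∧
            ∀ μ : Fin n → ℝ, WeightedBTL.IsStationary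
              (G.markovMatrix (WeightedBTL.empiricalProb fun i j m => Z i j m ω)) μ →
              ‖μ - WeightedBTL.normalizedScore α‖ / ‖WeightedBTL.normalizedScore α‖ ≤
                c₁ / G.spectralGap * √(n * Real.log n * p / k) +
                c₂ / G.spectralGap ^ 2 * √(n ^ 2 * Real.log n * p ^ 2 / k) +
                c₃ / G.spectralGap ^ 3 * √(n ^ 4 * Real.log n * p ^ 3 / k)} := by
  obtain ⟨n₀, hn₀⟩ := WeightedBTL.exists_truncation_order
  refine ⟨604800 * (h ^ 2 + 1), 1, 24192000 * (h ^ 4 + 1), 8 + (n₀ : ℝ) ^ 5, by positivity,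
    one_pos, by positivity, by positivity, ?_⟩
  intro n k α G p Ω _ P _ Z hα hh hZ hG hdmin hdmax hk
  have hn2 := G.two_le_of_one_le_dMin hG hdmin
  have : NeZero n := ⟨by omega⟩
  have hn0 : (0 : ℝ) < n := by exact_mod_cast (by omega : 0 < n)
  rcases lt_or_ge n n₀ with hlt | hge
  · refine le_trans ?_ measureReal_nonneg
    rw [sub_nonpos, one_le_div (by positivity)]
    have : (n : ℝ) ^ 5 ≤ (n₀ : ℝ) ^ 5 := by
      gcongr
    linarith
  obtain ⟨hL, R, hR3, hRn, hR1, hR2⟩ := hn₀ n hge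
  set L := Real.log n with hLdef
  obtain ⟨a, ha, hs⟩ := WeightedBTL.exists_rescaled_score hα hh
  obtain ⟨s, hsdef⟩ : ∃ s : Fin n → ℝ, s = fun i => α i / a := ⟨_, rfl⟩
  have hs1 : ∀ i, 1 ≤ s i := fun i => hsdef ▸ (hs i).1
  have hsh : ∀ i, s i ≤ h := fun i => hsdef ▸ (hs i).2
  have hs0 : ∀ i, 0 < s i := fun i => one_pos.trans_le (hs1 i)
  have hh1 : 1 ≤ h := (hs1 0).trans (hsh 0)
  have hD1 : 1 ≤ G.dMax := hdmin.trans ((G.dMin_le_degree 0).trans (G.degree_le_dMax 0))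
  have hD0 : 0 < G.dMax := by linarith
  have hp : 0 < p := pos_of_mul_pos_right (by linarith : 0 < 2 * (n : ℝ) * p)
    (by positivity)
  have hl := G.spectralGap_pos hG hn2
  set lam := G.spectralGap with hlam
  have hkpos : (0 : ℝ) < k := lt_of_lt_of_le (by positivity) hk
  have hk0 : k ≠ 0 := by rintro rfl; simp at hkpos
  have hk1 : (1 : ℝ) ≤ k := by exact_mod_cast Nat.one_le_iff_ne_zero.2 hk0
  have H := G.network_isBounded hk0 hG hn2 hs1 hsh
  obtain ⟨b, hb⟩ : ∃ b, b = 2 * (√(5 * L) * √(1 / k * G.dMax)) := ⟨_, rfl⟩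
  have hb0 : 0 ≤ b := by rw [hb]; positivity
  have hτ0 : 0 ≤ b * h / lam := by positivity
  have hτ2 : (b * h / lam) ^ 2 = 20 * h ^ 2 * (G.dMax * L) / (k * lam ^ 2) := by
    rw [hb, div_pow, mul_pow, mul_pow, mul_pow, Real.sq_sqrt (by positivity),
      Real.sq_sqrt (by positivity)]
    field_simp
    norm_num
  have hτ : b * h / lam ≤ 1 / 4 := by
    refine le_of_sq_le_sq ?_ (by norm_num)
    rw [hτ2, div_le_iff₀ (by positivity)]
    rw [div_le_iff₀ (by positivity)] at hk
    calc 20 * h ^ 2 * (G.dMax * L) ≤ 20 * h ^ 2 * (2 * n * p * L) := by gcongr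
      _ = (1 / 4) ^ 2 * (640 * h ^ 2 * n * L * p) := by ring
      _ ≤ _ := by gcongr
  have hpi : WeightedBTL.normalizedScore α = WeightedBTL.normalizedScore s := by
    rw [hsdef, WeightedBTL.normalizedScore_div α ha]
  have hC : 1 - (8 + (n₀ : ℝ) ^ 5) / (n : ℝ) ^ 5 ≤ 1 - 8 / (n : ℝ) ^ 5 := by
    gcongr
    linarith [pow_nonneg (Nat.cast_nonneg (α := ℝ) n₀) 5]
  refine hC.trans (WeightedBTL.one_sub_le_measureReal hZ ha hsdef hn2 hL H (by positivity) hRn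
    (E := fun z => (∃! μ, WeightedBTL.IsStationary
        (G.markovMatrix (WeightedBTL.empiricalProb z)) μ) ∧
      ∀ μ, WeightedBTL.IsStationary (G.markovMatrix (WeightedBTL.empiricalProb z)) μ →
        ‖μ - WeightedBTL.normalizedScore α‖ / ‖WeightedBTL.normalizedScore α‖ ≤
          604800 * (h ^ 2 + 1) / lam * √(n * L * p / k) +
          1 / lam ^ 2 * √(n ^ 2 * L * p ^ 2 / k) +
          24192000 * (h ^ 4 + 1) / lam ^ 3 * √(n ^ 4 * L * p ^ 3 / k))
    fun z hη => ?_)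
  rw [← hLdef, ← hb] at hη
  refine ⟨G.existsUnique_isStationary hk0 hD0 hs0 H hb0 hτ z hη.bounded, fun μ hμ => ?_⟩
  rw [hpi]
  refine (G.norm_sub_normalizedScore_le hn2 hL hk0 hD0 hs0 H hb0 hτ hR3 hR1 hR2 z hη hμ).trans ?_
  have hmid : 0 ≤ 1 / lam ^ 2 * √(n ^ 2 * L * p ^ 2 / k) := by positivity
  linarith [WeightedBTL.noise_ratio_mul_le hn0 hk1 (by linarith) hL hp hl hdmax hτ2]
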